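/- Let $\mathbb K$ be a field of characteristic $0$. A superspace is a $\mathbb Z_2$-graded vector space; $|x|$ is the parity of a homogeneous element, identities are stated for homogeneous elements, $\tau(x\otimes y)=(-1)^{|x||y|}y\otimes x$, and $\xi(x\otimes y\otimes z)=(-1)^{|x|(|y|+|z|)}y\otimes z\otimes x$. For an even linear map $T:\mathcal A\to \mathrm{End}(\mathcal A)$ write $(T(x)\otimes 1)(u\otimes v)=T(x)u\otimes v$ and $(1\otimes T(x))(u\otimes v)=(-1)^{|x||u|}u\otimes T(x)v$; write $\mathrm{ad}(x)y=\{x,y\}$, $L(x)y=x\bullet y$. **Definitions.** A *Poisson superalgebra* $(\mathcal A,\{,\},\bullet)$ is a Lie superalgebra $(\mathcal A,\{,\})$ and a supercommutative associative superalgebra $(\mathcal A,\bullet)$ (with even operations, no unit required) with $\{x,y\bullet z\}=\{x,y\}\bullet z+(-1)^{|x||y|}y\bullet\{x,z\}$. A *Poisson superbialgebra* $(\mathcal A,\{,\},\bullet,\delta,\Delta)$ is a Poisson superalgebra with even linear maps $\delta,\Delta:\mathcal A\to\mathcal A\otimes\mathcal A$ such that * $\mathrm{Im}\,\delta\subset\mathrm{Im}(\mathrm{id}-\tau)$,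 $(\mathrm{id}+\xi+\xi^2)(\mathrm{id}\otimes\delta)\delta=0$; $\tau\Delta=\Delta$, $(\mathrm{id}\otimes\Delta)\Delta=(\Delta\otimes\mathrm{id})\Delta$; $(\mathrm{id}\otimes\Delta)\delta=(\delta\otimes\mathrm{id})\Delta+(\tau\otimes\mathrm{id})(\mathrm{id}\otimes\delta)\Delta$; * $\delta(\{x,y\})=(\mathrm{ad}(x)\otimes1+1\otimes\mathrm{ad}(x))\delta(y)-(-1)^{|x||y|}(\mathrm{ad}(y)\otimes1+1\otimes\mathrm{ad}(y))\delta(x)$; * $\Delta(x\bullet y)=\sum (x\bullet y_1)\otimes y_2+\sum x_1\otimes (x_2\bullet y)$, where $\Delta(x)=\sum x_1\otimes x_2$, $\Delta(y)=\sum y_1\otimes y_2$; * $\delta(x\bullet y)=(-1)^{|x||y|}(L(y)\otimes1)\delta(x)+(L(x)\otimes1)\delta(y)+(1\otimes\mathrm{ad}(x))\Delta(y)+(-1)^{|x||y|}(1\otimes\mathrm{ad}(y))\Delta(x)$; * $\Delta(\{x,y\})=(\mathrm{ad}(x)\otimes1+1\otimes\mathrm{ad}(x))\Delta(y)+(-1)^{|x||y|}(L(y)\otimes1-1\otimes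 L(y))\delta(x)$. A *coboundary Poisson superbialgebra* is a Poisson superbialgebra together with an even $r\in\mathcal A\otimes\mathcal A$ such that for all $x$ $$\delta(x)=(\mathrm{ad}(x)\otimes1+1\otimes\mathrm{ad}(x))\,r,\qquad \Delta(x)=-(L(x)\otimes1-1\otimes L(x))\,r .$$ For $r=\sum r_1\otimes r_2=\sum r_1'\otimes r_2'$, the equation CYBE is $$\sum(-1)^{|r_1'||r_2|}\{r_1,r_1'\}\otimes r_2\otimes r_2'+\sum r_1\otimes\{r_2,r_1'\}\otimes r_2'+\sum(-1)^{|r_1'||r_2|}r_1\otimes r_1'\otimes\{r_2,r_2'\}=0,$$ and AYBE is $$\sum (r_1\bullet r_1')\otimes r_2'\otimes r_2-\sum r_1\otimes (r_2\bullet r_1')\otimes r_2'+\sum r_1'\otimes r_1\otimes (r_2\bullet r_2')=0.$$ **The double.** Let $(\mathcal A,\{,\}_1,\bullet_1,\delta,\Delta)$ be a finite-dimensional Poisson superbialgebra and $\mathcal A^*$ the dual superspace. Pair by $\langle a\otimes b,u\otimes v\rangle=(-1)^{|b||u|}\langle a,u\rangle\langle b,v\rangle$ and $\langle x,a\rangle=(-1)^{|x||a|}\langle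 a,x\rangle$ (which identifies $\mathcal A$ with $\mathcal A^{**}$). Let $\langle\{a,b\}_2,x\rangle=\langle a\otimes b,\delta(x)\rangle$ and $\langle a\bullet_2b,x\rangle=\langle a\otimes b,\Delta(x)\rangle$ for $a,b\in\mathcal A^*$. For $T:\mathcal P\to\mathrm{End}(V)$ even, let $T^*:\mathcal P\to\mathrm{End}(V^*)$, $\langle T^*(x)\eta,v\rangle=-(-1)^{|x||\eta|}\langle\eta,T(x)v\rangle$; thus $\mathrm{ad}_1^*,L_1^*:\mathcal A\to\mathrm{End}(\mathcal A^*)$ and $\mathrm{ad}_2^*,L_2^*:\mathcal A^*\to\mathrm{End}(\mathcal A)$. On $\mathcal{PD}(\mathcal A)=\mathcal A\oplus\mathcal A^*$ the matched-pair operations $\{,\}$, $\bullet$ extend those of $\mathcal A$ and $\mathcal A^*$ by $$\{x,a\}=-(-1)^{|x||a|}\{a,x\}=\mathrm{ad}_1^*(x)a-(-1)^{|x||a|}\mathrm{ad}_2^*(a)x,$$ $$x\bullet a=(-1)^{|x||a|}a\bullet x=-L_1^*(x)a-(-1)^{|x||a|}L_2^*(a)x\qquad(x\in\mathcal A,\ a\in\mathcal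 A^*).$$ **Theorem (Drinfeld classical double).** For every finite-dimensional Poisson superbialgebra $(\mathcal A,\{,\}_1,\bullet_1,\delta,\Delta)$ over $\mathbb K$: $(\mathcal A^*,\{,\}_2,\bullet_2)$ is a Poisson superalgebra. Let $r\in\mathcal A\otimes\mathcal A^*\subset\mathcal{PD}(\mathcal A)\otimes\mathcal{PD}(\mathcal A)$ correspond to $\mathrm{id}_{\mathcal A}$, i.e. $r=\sum_ie_i\otimes e_i^*$ for every basis $(e_i)$ of $\mathcal A$ with dual basis $(e_i^*)$. Then $r$ is even and satisfies CYBE and AYBE in $\mathcal{PD}(\mathcal A)$, and for all $u\in\mathcal{PD}(\mathcal A)$ $$(\mathrm{ad}(u)\otimes1+1\otimes\mathrm{ad}(u))(r+\tau(r))=0=(L(u)\otimes1-1\otimes L(u))(r+\tau(r)).$$ Moreover $\mathcal{PD}(\mathcal A)$ with $\{,\}$, $\bullet$ and $$\delta_{\mathcal{PD}}(u)=(\mathrm{ad}(u)\otimes1+1\otimes\mathrm{ad}(u))\,r,\qquad \Delta_{\mathcal{PD}}(u)=-(L(u)\otimes1-1\otimes L(u))\,r$$ and the element $r$ is a coboundary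 Poisson superbialgebra; in particular $(\mathcal{PD}(\mathcal A),\{,\},\bullet)$ is a Poisson superalgebra. -/

import Mathlib

set_option maxSynthPendingDepth 3

open scoped TensorProduct

noncomputable section

namespace PoissonSuper

/-! ## Superspaces

A superspace over `K` is a `K`-module `A` with a `ZMod 2`-grading `𝒜` and
`[DirectSum.Decomposition 𝒜]`. -/

/-- The Koszul sign `(-1)^{ij}` for parities `i`, `j`. -/
def koszulSign (K : Type*) [Field K] (i j : ZMod 2) : K :=
  (-1) ^ (i.val * j.val)

section Superspace

variable {K A : Type*} [Field K] [AddCommGroup A] [Module K A]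

/-- The projection of a superspace onto its component of parity `i`. -/
def superProj (𝒜 : ZMod 2 → Submodule K A) [DirectSum.Decomposition 𝒜] (i : ZMod 2) :
    A →ₗ[K] A :=
  (𝒜 i).subtype ∘ₗ DirectSum.component K (ZMod 2) (fun i => 𝒜 i) i ∘ₗ
    (DirectSum.decomposeLinearEquiv 𝒜).toLinearMap

theorem superProj_apply (𝒜 : ZMod 2 → Submodule K A) [DirectSum.Decomposition 𝒜]
    (i : ZMod 2) (x : A) : superProj 𝒜 i x = (DirectSum.decompose 𝒜 x i : A) := rfl

theorem superProj_mem (𝒜 : ZMod 2 → Submodule K A) [DirectSum.Decomposition 𝒜]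
    (i : ZMod 2) (x : A) : superProj 𝒜 i x ∈ 𝒜 i := (DirectSum.decompose 𝒜 x i).2

theorem superProj_of_mem (𝒜 : ZMod 2 → Submodule K A) [DirectSum.Decomposition 𝒜]
    {i : ZMod 2} {x : A} (hx : x ∈ 𝒜 i) (j : ZMod 2) :
    superProj 𝒜 j x = if i = j then x else 0 := by
  rw [superProj_apply]
  split_ifs with h
  · subst h; exact DirectSum.decompose_of_mem_same 𝒜 hx
  · exact DirectSum.decompose_of_mem_ne 𝒜 hx h

theorem sum_superProj (𝒜 : ZMod 2 → Submodule K A) [DirectSum.Decomposition 𝒜] (x : A) :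
    ∑ i, superProj 𝒜 i x = x := by
  refine DirectSum.Decomposition.inductionOn 𝒜 (motive := fun x => ∑ i, superProj 𝒜 i x = x)
    (by simp) (fun {i} m => ?_) (fun x y hx hy => ?_) x
  · simp [superProj_of_mem 𝒜 m.2]
  · simp only [map_add, Finset.sum_add_distrib, hx, hy]

/-- A grading together with a system of projections onto its components is a decomposition. -/
@[reducible] def decompositionOfProj (ℳ : ZMod 2 → Submodule K A) (p : ZMod 2 → A →ₗ[K] A)
    (hp : ∀ i x, p i x ∈ ℳ i) (hsum : ∀ x, ∑ i, p i x = x)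
    (hmem : ∀ i j x, x ∈ ℳ i → p j x = if i = j then x else 0) :
    DirectSum.Decomposition ℳ :=
  DirectSum.Decomposition.ofLinearMap ℳ
    (∑ i, DirectSum.lof K (ZMod 2) (fun i => ℳ i) i ∘ₗ (p i).codRestrict (ℳ i) (hp i))
    (by
      ext x
      simp [DirectSum.coeLinearMap_lof, hsum])
    (by
      ext i x : 2
      simp only [LinearMap.comp_apply, DirectSum.coeLinearMap_lof, LinearMap.sum_apply,
        LinearMap.id_apply]
      rw [Finset.sum_eq_single i]
      · congr 1
        exact Subtype.ext (by simp [hmem i i x x.2])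
      · intro j _ hj
        have : (p j).codRestrict (ℳ j) (hp j) (x : A) = 0 :=
          Subtype.ext (by simp [hmem i j x x.2, hj.symm])
        rw [this, map_zero]
      · simp)

/-- The induced grading of the dual superspace: a functional has parity `i` when it vanishes on
the elements of the other parity `i + 1`. -/
def dualGrading (𝒜 : ZMod 2 → Submodule K A) : ZMod 2 → Submodule K (Module.Dual K A) :=
  fun i => (𝒜 (i + 1)).dualAnnihilator

instance dualDecomposition (𝒜 : ZMod 2 → Submodule K A) [DirectSum.Decomposition 𝒜] :
    DirectSum.Decomposition (dualGrading 𝒜) :=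
  decompositionOfProj (dualGrading 𝒜) (fun i => (superProj 𝒜 i).dualMap)
    (by
      intro i φ
      refine (Submodule.mem_dualAnnihilator _).2 fun x hx => ?_
      rw [LinearMap.dualMap_apply, superProj_of_mem 𝒜 hx]
      simp)
    (by
      intro φ
      ext x
      rw [LinearMap.sum_apply]
      simp only [LinearMap.dualMap_apply]
      rw [← map_sum, sum_superProj])
    (by
      intro i j φ hφ
      have h0 : ∀ k, k ≠ i → ∀ x, φ (superProj 𝒜 k x) = 0 := by
        intro k hk x
        have hk' : k = i + 1 := (show ∀ i k : ZMod 2, k ≠ i → k = i + 1 by decide) i k hk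
        subst hk'
        exact (Submodule.mem_dualAnnihilator _).1 hφ _ (superProj_mem 𝒜 _ x)
      ext x
      rw [LinearMap.dualMap_apply]
      split_ifs with h
      · subst h
        conv_rhs => rw [← sum_superProj 𝒜 x, map_sum]
        rw [Finset.sum_eq_single i (fun k _ hk => h0 k hk x) (by simp)]
      · exact h0 j (Ne.symm h) x)

/-- The grading of the direct sum of two superspaces. -/
def prodGrading {B : Type*} [AddCommGroup B] [Module K B] (𝒜 : ZMod 2 → Submodule K A)
    (ℬ : ZMod 2 → Submodule K B) : ZMod 2 → Submodule K (A × B) :=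
  fun i => (𝒜 i).prod (ℬ i)

instance prodDecomposition {B : Type*} [AddCommGroup B] [Module K B]
    (𝒜 : ZMod 2 → Submodule K A) (ℬ : ZMod 2 → Submodule K B)
    [DirectSum.Decomposition 𝒜] [DirectSum.Decomposition ℬ] :
    DirectSum.Decomposition (prodGrading 𝒜 ℬ) :=
  decompositionOfProj (prodGrading 𝒜 ℬ)
    (fun i => (superProj 𝒜 i).prodMap (superProj ℬ i))
    (fun i x => ⟨superProj_mem 𝒜 i x.1, superProj_mem ℬ i x.2⟩)
    (by
      intro x
      refine Prod.ext ?_ ?_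
      · rw [Prod.fst_sum]; exact sum_superProj 𝒜 x.1
      · rw [Prod.snd_sum]; exact sum_superProj ℬ x.2)
    (by
      intro i j x hx
      have h1 := superProj_of_mem 𝒜 hx.1 j
      have h2 := superProj_of_mem ℬ hx.2 j
      refine Prod.ext ?_ ?_
      · rw [LinearMap.prodMap_apply, h1]; split_ifs <;> rfl
      · rw [LinearMap.prodMap_apply, h2]; split_ifs <;> rfl)

/-- The component of parity `i` of `A ⊗ A`: the sum of all `A_j ⊗ A_k` with `j + k = i`. -/
def tensorGrading (𝒜 : ZMod 2 → Submodule K A) (i : ZMod 2) : Submodule K (A ⊗[K] A) :=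
  ⨆ (j : ZMod 2) (k : ZMod 2) (_ : j + k = i),
    LinearMap.range (TensorProduct.map (𝒜 j).subtype (𝒜 k).subtype)

variable (𝒜 : ZMod 2 → Submodule K A) [DirectSum.Decomposition 𝒜]

/-- The super-twist `τ (x ⊗ y) = (-1)^{|x||y|} y ⊗ x`. -/
def superTwist : A ⊗[K] A →ₗ[K] A ⊗[K] A :=
  ∑ i, ∑ j, koszulSign K i j •
    ((TensorProduct.comm K A A).toLinearMap ∘ₗ
      TensorProduct.map (superProj 𝒜 i) (superProj 𝒜 j))

/-- `τ ⊗ id` on `A ⊗ A ⊗ A`. -/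
def twistLeft : A ⊗[K] (A ⊗[K] A) →ₗ[K] A ⊗[K] (A ⊗[K] A) :=
  (TensorProduct.assoc K A A A).toLinearMap ∘ₗ (superTwist 𝒜).rTensor A ∘ₗ
    (TensorProduct.assoc K A A A).symm.toLinearMap

/-- The super-cyclic map `ξ = (id ⊗ τ)(τ ⊗ id)`. -/
def superCyclic : A ⊗[K] (A ⊗[K] A) →ₗ[K] A ⊗[K] (A ⊗[K] A) :=
  (superTwist 𝒜).lTensor A ∘ₗ twistLeft 𝒜

/-- For a linear family `T` of endomorphisms, `leftAct T x = T(x) ⊗ id` on `A ⊗ A`. -/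
def leftAct (T : A →ₗ[K] A →ₗ[K] A) : A →ₗ[K] A ⊗[K] A →ₗ[K] A ⊗[K] A :=
  LinearMap.rTensorHom A ∘ₗ T

/-- For an even linear family `T` of endomorphisms, `rightAct 𝒜 T x` is `id ⊗ T(x)` with the
Koszul sign: `u ⊗ v ↦ (-1)^{|x||u|} u ⊗ T(x) v`. -/
def rightAct (T : A →ₗ[K] A →ₗ[K] A) : A →ₗ[K] A ⊗[K] A →ₗ[K] A ⊗[K] A :=
  ∑ i, ∑ j, koszulSign K i j •
    (TensorProduct.mapBilinear (RingHom.id K) A A A A (superProj 𝒜 j) ∘ₗ T ∘ₗ superProj 𝒜 i)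

end Superspace

/-! ## Super(bi)algebras

A bilinear product is a map `A →ₗ A →ₗ A`; it is at the same time its own family of left
multiplications (the adjoint maps in the Lie case). -/

section Algebras

variable {K A : Type*} [Field K] [AddCommGroup A] [Module K A]

structure IsLieSuperalgebra (𝒜 : ZMod 2 → Submodule K A) (br : A →ₗ[K] A →ₗ[K] A) :
    Prop where
  even : ∀ i j, ∀ x ∈ 𝒜 i, ∀ y ∈ 𝒜 j, br x y ∈ 𝒜 (i + j)
  skew : ∀ i j, ∀ x ∈ 𝒜 i, ∀ y ∈ 𝒜 j, br x y = -(koszulSign K i j • br y x)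
  jacobi : ∀ i j k, ∀ x ∈ 𝒜 i, ∀ y ∈ 𝒜 j, ∀ z ∈ 𝒜 k,
    koszulSign K i k • br x (br y z) + koszulSign K k j • br z (br x y) +
      koszulSign K j i • br y (br z x) = 0

structure IsAssociativeSuperalgebra (𝒜 : ZMod 2 → Submodule K A)
    (mul : A →ₗ[K] A →ₗ[K] A) : Prop where
  even : ∀ i j, ∀ x ∈ 𝒜 i, ∀ y ∈ 𝒜 j, mul x y ∈ 𝒜 (i + j)
  assoc : ∀ x y z, mul x (mul y z) = mul (mul x y) z

structure IsCommAssociativeSuperalgebra (𝒜 : ZMod 2 → Submodule K A)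
    (mul : A →ₗ[K] A →ₗ[K] A) : Prop extends IsAssociativeSuperalgebra 𝒜 mul where
  comm : ∀ i j, ∀ x ∈ 𝒜 i, ∀ y ∈ 𝒜 j, mul x y = koszulSign K i j • mul y x

structure IsPoissonSuperalgebra (𝒜 : ZMod 2 → Submodule K A)
    (br mul : A →ₗ[K] A →ₗ[K] A) : Prop where
  lie : IsLieSuperalgebra 𝒜 br
  commAssoc : IsCommAssociativeSuperalgebra 𝒜 mul
  leibniz : ∀ i j, ∀ x ∈ 𝒜 i, ∀ y ∈ 𝒜 j, ∀ z,
    br x (mul y z) = mul (br x y) z + koszulSign K i j • mul y (br x z)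

variable (𝒜 : ZMod 2 → Submodule K A) [DirectSum.Decomposition 𝒜]

structure IsLieSupercoalgebra (δ : A →ₗ[K] A ⊗[K] A) : Prop where
  even : ∀ i, ∀ x ∈ 𝒜 i, δ x ∈ tensorGrading 𝒜 i
  skew : LinearMap.range δ ≤ LinearMap.range (LinearMap.id - superTwist 𝒜)
  cojacobi :
    (LinearMap.id + superCyclic 𝒜 + superCyclic 𝒜 ∘ₗ superCyclic 𝒜) ∘ₗ δ.lTensor A ∘ₗ δ = 0

structure IsCoassociativeSupercoalgebra (Δ : A →ₗ[K] A ⊗[K] A) : Prop where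
  even : ∀ i, ∀ x ∈ 𝒜 i, Δ x ∈ tensorGrading 𝒜 i
  coassoc : Δ.lTensor A ∘ₗ Δ =
    (TensorProduct.assoc K A A A).toLinearMap ∘ₗ Δ.rTensor A ∘ₗ Δ

structure IsPoissonSupercoalgebra (δ Δ : A →ₗ[K] A ⊗[K] A) : Prop where
  lie : IsLieSupercoalgebra 𝒜 δ
  coassoc : IsCoassociativeSupercoalgebra 𝒜 Δ
  cocomm : superTwist 𝒜 ∘ₗ Δ = Δ
  /-- `(id ⊗ Δ) δ = (δ ⊗ id) Δ + (τ ⊗ id) (id ⊗ δ) Δ` -/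
  compat : Δ.lTensor A ∘ₗ δ =
    (TensorProduct.assoc K A A A).toLinearMap ∘ₗ δ.rTensor A ∘ₗ Δ +
      twistLeft 𝒜 ∘ₗ δ.lTensor A ∘ₗ Δ

structure IsLieSuperbialgebra (br : A →ₗ[K] A →ₗ[K] A) (δ : A →ₗ[K] A ⊗[K] A) : Prop where
  alg : IsLieSuperalgebra 𝒜 br
  coalg : IsLieSupercoalgebra 𝒜 δ
  compat : ∀ i j, ∀ x ∈ 𝒜 i, ∀ y ∈ 𝒜 j,
    δ (br x y) = (leftAct br x + rightAct 𝒜 br x) (δ y) -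
      koszulSign K i j • (leftAct br y + rightAct 𝒜 br y) (δ x)

/-- The compatibility condition is `Δ(ab) = a b₁ ⊗ b₂ + a₁ ⊗ a₂ b`. -/
structure IsInfinitesimalSuperbialgebra (mul : A →ₗ[K] A →ₗ[K] A) (Δ : A →ₗ[K] A ⊗[K] A) :
    Prop where
  alg : IsAssociativeSuperalgebra 𝒜 mul
  coalg : IsCoassociativeSupercoalgebra 𝒜 Δ
  compat : ∀ a b, Δ (mul a b) = leftAct mul a (Δ b) + (mul.flip b).lTensor A (Δ a)

/-- In the last two conditions `rightAct` carries the Koszul sign `(-1)^{|x||u|}` on `u ⊗ v`. -/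
structure IsPoissonSuperbialgebra (br mul : A →ₗ[K] A →ₗ[K] A) (δ Δ : A →ₗ[K] A ⊗[K] A) :
    Prop where
  alg : IsPoissonSuperalgebra 𝒜 br mul
  coalg : IsPoissonSupercoalgebra 𝒜 δ Δ
  lie : IsLieSuperbialgebra 𝒜 br δ
  infinitesimal : IsInfinitesimalSuperbialgebra 𝒜 mul Δ
  compat_mul : ∀ i j, ∀ x ∈ 𝒜 i, ∀ y ∈ 𝒜 j,
    δ (mul x y) = koszulSign K i j • leftAct mul y (δ x) + leftAct mul x (δ y) +
      rightAct 𝒜 br x (Δ y) + koszulSign K i j • rightAct 𝒜 br y (Δ x)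
  compat_bracket : ∀ i j, ∀ x ∈ 𝒜 i, ∀ y ∈ 𝒜 j,
    Δ (br x y) = (leftAct br x + rightAct 𝒜 br x) (Δ y) +
      koszulSign K i j • (leftAct mul y - rightAct 𝒜 mul y) (δ x)

/-! ## Coboundaries and Yang-Baxter equations -/

/-- `x ↦ (ad(x) ⊗ id + (-1)^{|x||r₁|} id ⊗ ad(x)) r`. -/
def adTensor (br : A →ₗ[K] A →ₗ[K] A) (r : A ⊗[K] A) : A →ₗ[K] A ⊗[K] A :=
  (leftAct br + rightAct 𝒜 br).flip r

/-- `x ↦ (L(x) ⊗ id - (-1)^{|x||r₁|} id ⊗ L(x)) r`. -/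
def mulTensor (mul : A →ₗ[K] A →ₗ[K] A) (r : A ⊗[K] A) : A →ₗ[K] A ⊗[K] A :=
  (leftAct mul - rightAct 𝒜 mul).flip r

/-- A coboundary Poisson superbialgebra: `δ` and `Δ` come from an even `r` through
`δ(x) = (ad(x) ⊗ id + (-1)^{|x||r₁|} id ⊗ ad(x)) r` and
`Δ(x) = -(L(x) ⊗ id - (-1)^{|x||r₁|} id ⊗ L(x)) r`. -/
structure IsCoboundaryPoissonSuperbialgebra (br mul : A →ₗ[K] A →ₗ[K] A)
    (δ Δ : A →ₗ[K] A ⊗[K] A) (r : A ⊗[K] A) : Prop where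
  bialg : IsPoissonSuperbialgebra 𝒜 br mul δ Δ
  even : r ∈ tensorGrading 𝒜 0
  cobracket : ∀ x, δ x = adTensor 𝒜 br r x
  coproduct : ∀ x, Δ x = -mulTensor 𝒜 mul r x

/-- `(r₁ ⊗ r₂) ⊗ (s₁ ⊗ s₂) ↦ (-1)^{|s₁||r₂|} (r₁ ⊗ s₁) ⊗ (r₂ ⊗ s₂)`. -/
def superMiddleSwap :
    (A ⊗[K] A) ⊗[K] (A ⊗[K] A) →ₗ[K] (A ⊗[K] A) ⊗[K] (A ⊗[K] A) :=
  ∑ i, ∑ j, koszulSign K i j •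
    ((TensorProduct.tensorTensorTensorComm K A A A A).toLinearMap ∘ₗ
      TensorProduct.map ((superProj 𝒜 j).lTensor A) ((superProj 𝒜 i).rTensor A))

/-- `[r₁₂, s₁₃] = ∑ (-1)^{|s₁||r₂|} [r₁, s₁] ⊗ r₂ ⊗ s₂`. -/
def bracket1213 (br : A →ₗ[K] A →ₗ[K] A) (r s : A ⊗[K] A) : A ⊗[K] (A ⊗[K] A) :=
  (TensorProduct.lift br).rTensor (A ⊗[K] A) (superMiddleSwap 𝒜 (r ⊗ₜ[K] s))

/-- `r₁₂ * s₂₃ = ∑ r₁ ⊗ (r₂ * s₁) ⊗ s₂`, for the bracket as well as for the product. -/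
def op1223 (op : A →ₗ[K] A →ₗ[K] A) (r s : A ⊗[K] A) : A ⊗[K] (A ⊗[K] A) :=
  ((TensorProduct.lift op).rTensor A ∘ₗ
      (TensorProduct.assoc K A A A).symm.toLinearMap).lTensor A
    (TensorProduct.assoc K A A (A ⊗[K] A) (r ⊗ₜ[K] s))

/-- `[r₁₃, s₂₃] = ∑ (-1)^{|s₁||r₂|} r₁ ⊗ s₁ ⊗ [r₂, s₂]`. -/
def bracket1323 (br : A →ₗ[K] A →ₗ[K] A) (r s : A ⊗[K] A) : A ⊗[K] (A ⊗[K] A) :=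
  TensorProduct.assoc K A A A
    ((TensorProduct.lift br).lTensor (A ⊗[K] A) (superMiddleSwap 𝒜 (r ⊗ₜ[K] s)))

/-- `r₁₃ • s₁₂ = ∑ (r₁ • s₁) ⊗ s₂ ⊗ r₂`. -/
def mul1312 (mul : A →ₗ[K] A →ₗ[K] A) (r s : A ⊗[K] A) : A ⊗[K] (A ⊗[K] A) :=
  TensorProduct.map (TensorProduct.lift mul) (TensorProduct.comm K A A).toLinearMap
    (TensorProduct.tensorTensorTensorComm K A A A A (r ⊗ₜ[K] s))

/-- `r₂₃ • s₁₃ = ∑ s₁ ⊗ r₁ ⊗ (r₂ • s₂)`. -/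
def mul2313 (mul : A →ₗ[K] A →ₗ[K] A) (r s : A ⊗[K] A) : A ⊗[K] (A ⊗[K] A) :=
  TensorProduct.assoc K A A A
    (TensorProduct.map (TensorProduct.comm K A A).toLinearMap (TensorProduct.lift mul)
      (TensorProduct.tensorTensorTensorComm K A A A A (r ⊗ₜ[K] s)))

/-- The classical Yang-Baxter equation. -/
def SatisfiesCYBE (br : A →ₗ[K] A →ₗ[K] A) (r : A ⊗[K] A) : Prop :=
  bracket1213 𝒜 br r r + op1223 br r r + bracket1323 𝒜 br r r = 0

end Algebras

section Associative

variable {K A : Type*} [Field K] [AddCommGroup A] [Module K A]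

/-- The associative Yang-Baxter equation. -/
def SatisfiesAYBE (mul : A →ₗ[K] A →ₗ[K] A) (r : A ⊗[K] A) : Prop :=
  mul1312 mul r r - op1223 mul r r + mul2313 mul r r = 0

end Associative

/-! ## Dual structures, matched pairs and the double -/

section Double

variable {K A : Type*} [Field K] [AddCommGroup A] [Module K A]

/-- The pairing `⟨a ⊗ b, u ⊗ v⟩ = (-1)^{|b||u|} ⟨a, u⟩ ⟨b, v⟩` of `A* ⊗ A*` with `A ⊗ A`. -/
def superDualDistrib (𝒜 : ZMod 2 → Submodule K A) [DirectSum.Decomposition 𝒜] :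
    Module.Dual K A ⊗[K] Module.Dual K A →ₗ[K] Module.Dual K (A ⊗[K] A) :=
  ∑ i, ∑ j, koszulSign K i j •
    (((superProj 𝒜 j).rTensor A).dualMap ∘ₗ TensorProduct.dualDistrib K A A ∘ₗ
      (superProj (dualGrading 𝒜) i).lTensor (Module.Dual K A))

/-- The product on `A*` dual to a coproduct `D`: `⟨a * b, x⟩ = ⟨a ⊗ b, D(x)⟩`. -/
def dualOp (𝒜 : ZMod 2 → Submodule K A) [DirectSum.Decomposition 𝒜]
    (D : A →ₗ[K] A ⊗[K] A) :
    Module.Dual K A →ₗ[K] Module.Dual K A →ₗ[K] Module.Dual K A :=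
  (TensorProduct.mk K (Module.Dual K A) (Module.Dual K A)).compr₂
    (D.dualMap ∘ₗ superDualDistrib 𝒜)

/-- The dual `T*` of an even linear map `T : P → End(V)`, with
`⟨T*(x) ξ, v⟩ = -(-1)^{|x||ξ|} ⟨ξ, T(x) v⟩`. -/
def dualRep {P V : Type*} [AddCommGroup P] [Module K P] [AddCommGroup V] [Module K V]
    (𝒢 : ZMod 2 → Submodule K P) (𝒱 : ZMod 2 → Submodule K V)
    [DirectSum.Decomposition 𝒢] [DirectSum.Decomposition 𝒱] (T : P →ₗ[K] V →ₗ[K] V) :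
    P →ₗ[K] Module.Dual K V →ₗ[K] Module.Dual K V :=
  -∑ i, ∑ j, koszulSign K i j •
    (LinearMap.lcomp K (Module.Dual K V) (superProj (dualGrading 𝒱) j) ∘ₗ
      Module.Dual.transpose ∘ₗ T ∘ₗ superProj 𝒢 i)

/-- The parity automorphism `x ↦ (-1)^{|x|} x`. -/
def superParity (𝒜 : ZMod 2 → Submodule K A) [DirectSum.Decomposition 𝒜] : A ≃ₗ[K] A :=
  LinearEquiv.ofInvolutive (∑ i, koszulSign K i i • superProj 𝒜 i) (by
    intro x
    have h1 : ∀ i j, superProj 𝒜 j (superProj 𝒜 i x) = if i = j then superProj 𝒜 i x else 0 :=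
      fun i j => superProj_of_mem 𝒜 (superProj_mem 𝒜 i x) j
    have h2 : ∀ i : ZMod 2, koszulSign K i i * koszulSign K i i = 1 := by
      intro i
      rw [koszulSign, ← mul_pow]; simp
    simp only [LinearMap.sum_apply, LinearMap.smul_apply, map_sum, map_smul, h1]
    conv_rhs => rw [← sum_superProj 𝒜 x]
    refine Finset.sum_congr rfl fun i _ => ?_
    simp [smul_smul, h2])

/-- The canonical isomorphism `A ≅ A**` of finite-dimensional superspaces,
`⟨x, b⟩ = (-1)^{|x||b|} ⟨b, x⟩` for `x ∈ A`, `b ∈ A*`; as `⟨b, x⟩ = 0` unless `|b| = |x|`, the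
sign is `(-1)^{|x|}`. -/
def superEval (𝒜 : ZMod 2 → Submodule K A) [DirectSum.Decomposition 𝒜]
    [FiniteDimensional K A] : A ≃ₗ[K] Module.Dual K (Module.Dual K A) :=
  (superParity 𝒜).trans (Module.evalEquiv K A)

/-- The dual `T* : A* → End(A** ) = End(A)` of an even linear map `T : A* → End(A*)`. -/
def bidualRep (𝒜 : ZMod 2 → Submodule K A) [DirectSum.Decomposition 𝒜]
    [FiniteDimensional K A]
    (T : Module.Dual K A →ₗ[K] Module.Dual K A →ₗ[K] Module.Dual K A) :
    Module.Dual K A →ₗ[K] A →ₗ[K] A :=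
  (superEval 𝒜).symm.conj.toLinearMap ∘ₗ dualRep (dualGrading 𝒜) (dualGrading 𝒜) T

/-- For `B : Q × P → U`, the map `P × Q → U`, `(x, b) ↦ (-1)^{|x||b|} B(b, x)`. -/
def superFlip {P Q U : Type*} [AddCommGroup P] [Module K P] [AddCommGroup Q] [Module K Q]
    [AddCommGroup U] [Module K U]
    (𝒢 : ZMod 2 → Submodule K P) (ℋ : ZMod 2 → Submodule K Q)
    [DirectSum.Decomposition 𝒢] [DirectSum.Decomposition ℋ] (B : Q →ₗ[K] P →ₗ[K] U) :
    P →ₗ[K] Q →ₗ[K] U :=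
  ∑ i, ∑ j, koszulSign K i j • B.flip.compl₁₂ (superProj 𝒢 i) (superProj ℋ j)

/-- The operation on `P ⊕ Q` built from operations on `P`, `Q` and maps `ρ₁ : P → End(Q)`,
`ρ₂ : Q → End(P)`; with `s = -1` it is the bracket, with `s = 1` the product of a matched pair:
`(x + a) * (y + b) = (x * y + ρ₂(a) y + s (-1)^{|x||b|} ρ₂(b) x)
  + (a * b + ρ₁(x) b + s (-1)^{|a||y|} ρ₁(y) a)`. -/
def matchedPairOp {P Q : Type*} [AddCommGroup P] [Module K P] [AddCommGroup Q] [Module K Q]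
    (𝒢 : ZMod 2 → Submodule K P) (ℋ : ZMod 2 → Submodule K Q)
    [DirectSum.Decomposition 𝒢] [DirectSum.Decomposition ℋ] (s : K)
    (op₁ : P →ₗ[K] P →ₗ[K] P) (op₂ : Q →ₗ[K] Q →ₗ[K] Q)
    (ρ₁ : P →ₗ[K] Q →ₗ[K] Q) (ρ₂ : Q →ₗ[K] P →ₗ[K] P) :
    P × Q →ₗ[K] P × Q →ₗ[K] P × Q :=
  (op₁.compl₁₂ (LinearMap.fst K P Q) (LinearMap.fst K P Q) +
      ρ₂.compl₁₂ (LinearMap.snd K P Q) (LinearMap.fst K P Q) +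
      s • (superFlip 𝒢 ℋ ρ₂).compl₁₂ (LinearMap.fst K P Q) (LinearMap.snd K P Q)).compr₂
    (LinearMap.inl K P Q) +
  (op₂.compl₁₂ (LinearMap.snd K P Q) (LinearMap.snd K P Q) +
      ρ₁.compl₁₂ (LinearMap.fst K P Q) (LinearMap.snd K P Q) +
      s • (superFlip ℋ 𝒢 ρ₁).compl₁₂ (LinearMap.snd K P Q) (LinearMap.fst K P Q)).compr₂
    (LinearMap.inr K P Q)

/-- The grading of `A ⊕ A*`. -/
abbrev doubleGrading (𝒜 : ZMod 2 → Submodule K A) :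
    ZMod 2 → Submodule K (A × Module.Dual K A) :=
  prodGrading 𝒜 (dualGrading 𝒜)

variable (𝒜 : ZMod 2 → Submodule K A) [DirectSum.Decomposition 𝒜] [FiniteDimensional K A]

/-- The bracket of `A ⋈ A*`, with actions `ad₁*` and `ad₂*`. -/
def doubleBracket (br : A →ₗ[K] A →ₗ[K] A) (δ : A →ₗ[K] A ⊗[K] A) :
    A × Module.Dual K A →ₗ[K] A × Module.Dual K A →ₗ[K] A × Module.Dual K A :=
  matchedPairOp 𝒜 (dualGrading 𝒜) (-1) br (dualOp 𝒜 δ)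
    (dualRep 𝒜 𝒜 br) (bidualRep 𝒜 (dualOp 𝒜 δ))

/-- The product of `A ⋈ A*`, with actions `-L₁*` and `-L₂*`. -/
def doubleMul (mul : A →ₗ[K] A →ₗ[K] A) (Δ : A →ₗ[K] A ⊗[K] A) :
    A × Module.Dual K A →ₗ[K] A × Module.Dual K A →ₗ[K] A × Module.Dual K A :=
  matchedPairOp 𝒜 (dualGrading 𝒜) 1 mul (dualOp 𝒜 Δ)
    (-dualRep 𝒜 𝒜 mul) (-bidualRep 𝒜 (dualOp 𝒜 Δ))

/-- The image in `(A ⊕ A*) ⊗ (A ⊕ A*)` of the element of `A ⊗ A*` that corresponds to the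
identity map of `A`. -/
def doubleR (K A : Type*) [Field K] [AddCommGroup A] [Module K A] [FiniteDimensional K A] :
    (A × Module.Dual K A) ⊗[K] (A × Module.Dual K A) :=
  TensorProduct.map (LinearMap.inl K A (Module.Dual K A))
    (LinearMap.inr K A (Module.Dual K A)) (coevaluation K A 1)

end Double

end PoissonSuper

end

/-! Everything is read through the canonical form ⟨x + a, y + b⟩ = ⟨a, y⟩ + ⟨x, b⟩ on A ⊕ A*
(`doubleForm`). It is even, supersymmetric and nondegenerate, and A and A* are isotropic. The
matched-pair operations extend those of A and A* in such a way that the form is invariant: ⟨uv, w⟩ =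
⟨u, vw⟩. The structure `IsManinOp` records this for bracket (s = -1) and product (s = 1) at once,
and `isManinOp_matchedPairOp` proves it.

Poisson axioms of the double: paired with a fourth element, the Jacobi, associativity and Leibniz
identities become relations between quantities ⟨M(u, v), N(w, t)⟩, with enough permutation symmetry
that few distributions of the arguments over A and A* remain. Three arguments in A give an axiom of
A; three in A* give an axiom of A*, dual to a coalgebra axiom; two and two give a compatibility
condition of the bialgebra (`form_compat_lie`, `form_compat_mul`, `form_compat_bracket_mul`,
`form_compat_mul_bracket`).

Coalgebra axioms of the double: in finite dimension they are equivalent to the Poisson axioms of the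
dual operations (`IsPoissonSupercoalgebra.dual`, `IsPoissonSupercoalgebra.of_dual`). Transported by
the form, the operation dual to a coboundary of r is (x + a)(y + b) = -xy + ab, without mixed terms
(`doubleForm_splitOp`). It is the direct sum of A with negated operations and of A*, hence Poisson.
The conditions linking operations and cooperations hold for coboundaries in any Poisson
superalgebra, by operator identities for ad and L; evenness of r enters only the rule for Δ of a
product.

Yang-Baxter: contracting a leg of r against the form projects onto A* or, up to sign, onto A. So
CYBE and AYBE both reduce to a single consequence of invariance (`form_yangBaxter`). Finally r +
τ(r) is the tensor of the form itself, and its invariance is that of the form. -/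

noncomputable section

namespace PoissonSuper

/-! ## Koszul signs -/

section Sign

variable (K : Type*) [Field K]

theorem koszulSign_comm (i j : ZMod 2) : koszulSign K i j = koszulSign K j i := by
  rw [koszulSign, koszulSign, mul_comm]

@[simp] theorem koszulSign_zero_left (j : ZMod 2) : koszulSign K 0 j = 1 := by
  simp [koszulSign]

@[simp] theorem koszulSign_zero_right (i : ZMod 2) : koszulSign K i 0 = 1 := by
  simp [koszulSign]

@[simp] theorem koszulSign_one_one : koszulSign K 1 1 = -1 := by
  simp [koszulSign, ZMod.val_one]

/-- Most sign identities below are settled by running through both values of every parity, after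
which each Koszul sign is 1 or -1. -/
theorem parity_cases (i : ZMod 2) : i = 0 ∨ i = 1 := by
  revert i; decide

@[simp] theorem one_add_one_parity : (1 : ZMod 2) + 1 = 0 := by decide

theorem koszulSign_add_left (i j k : ZMod 2) :
    koszulSign K (i + j) k = koszulSign K i k * koszulSign K j k := by
  rcases parity_cases i with rfl | rfl <;> rcases parity_cases j with rfl | rfl <;>
    rcases parity_cases k with rfl | rfl <;> simp

theorem koszulSign_add_right (i j k : ZMod 2) :
    koszulSign K i (j + k) = koszulSign K i j * koszulSign K i k := by
  rw [koszulSign_comm, koszulSign_add_left, koszulSign_comm K j, koszulSign_comm K k]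

theorem koszulSign_mul_self (i j : ZMod 2) : koszulSign K i j * koszulSign K i j = 1 := by
  rw [koszulSign, ← mul_pow]; simp

theorem koszulSign_ne_zero (i j : ZMod 2) : koszulSign K i j ≠ 0 := by
  intro h
  simpa [h] using koszulSign_mul_self K i j

end Sign

/-! ## Homogeneous functionals -/

section Functionals

variable {K A : Type*} [Field K] [AddCommGroup A] [Module K A]

theorem mem_dualGrading {𝒜 : ZMod 2 → Submodule K A} {i : ZMod 2} {φ : Module.Dual K A} :
    φ ∈ dualGrading 𝒜 i ↔ ∀ x ∈ 𝒜 (i + 1), φ x = 0 :=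
  Submodule.mem_dualAnnihilator _

theorem dual_apply_eq_zero {𝒜 : ZMod 2 → Submodule K A} {i j : ZMod 2} {φ : Module.Dual K A}
    (hφ : φ ∈ dualGrading 𝒜 i) {x : A} (hx : x ∈ 𝒜 j) (hij : i ≠ j) : φ x = 0 := by
  have : j = i + 1 := (show ∀ i j : ZMod 2, i ≠ j → j = i + 1 by decide) i j hij
  subst this
  exact mem_dualGrading.1 hφ x hx

theorem mem_dualGrading_of_forall {𝒜 : ZMod 2 → Submodule K A} {i : ZMod 2}
    {φ : Module.Dual K A} (h : ∀ j, j ≠ i → ∀ x ∈ 𝒜 j, φ x = 0) : φ ∈ dualGrading 𝒜 i :=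
  mem_dualGrading.2 fun x hx => h _ ((show ∀ i : ZMod 2, i + 1 ≠ i by decide) i) x hx

theorem dual_comp_mem {𝒜 : ZMod 2 → Submodule K A} {i k : ZMod 2} {φ : Module.Dual K A}
    (hφ : φ ∈ dualGrading 𝒜 i)
    {T : A →ₗ[K] A} (hT : ∀ j, ∀ y ∈ 𝒜 j, T y ∈ 𝒜 (k + j)) :
    φ ∘ₗ T ∈ dualGrading 𝒜 (i + k) := by
  refine mem_dualGrading_of_forall fun j hj y hy => ?_
  exact dual_apply_eq_zero hφ (hT j y hy)
    ((show ∀ i j k : ZMod 2, j ≠ i + k → i ≠ k + j by decide) i j k hj)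

variable (𝒜 : ZMod 2 → Submodule K A) [DirectSum.Decomposition 𝒜]

/-- The part of φ of parity j vanishes on the component of A of parity i unless i = j. Hence a
homogeneous functional composed with a projection is itself or 0, which collapses every sum over
parities in the signed operations. -/
theorem superProj_dual (i : ZMod 2) (φ : Module.Dual K A) :
    superProj (dualGrading 𝒜) i φ = φ ∘ₗ superProj 𝒜 i := by
  have h := sum_superProj (dualGrading 𝒜) φ
  have key : ∀ j, ∀ x, (superProj (dualGrading 𝒜) j φ) (superProj 𝒜 i x) =
      if j = i then (superProj (dualGrading 𝒜) i φ) x else 0 := by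
    intro j x
    split_ifs with hji
    · subst hji
      conv_rhs => rw [← sum_superProj 𝒜 x, map_sum]
      rw [Finset.sum_eq_single j]
      · intro k _ hk
        exact dual_apply_eq_zero (superProj_mem _ j φ) (superProj_mem 𝒜 k x) hk.symm
      · simp
    · exact dual_apply_eq_zero (superProj_mem _ j φ) (superProj_mem 𝒜 i x) hji
  ext x
  rw [LinearMap.comp_apply]
  conv_rhs => rw [← h]
  simp [LinearMap.sum_apply, key]

variable {𝒜}

theorem dual_comp_superProj {i : ZMod 2} {φ : Module.Dual K A} (hφ : φ ∈ dualGrading 𝒜 i)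
    (j : ZMod 2) : φ ∘ₗ superProj 𝒜 j = if i = j then φ else 0 := by
  rw [← superProj_dual, superProj_of_mem _ hφ]

theorem hom_ext {U : Type*} [AddCommGroup U] [Module K U] {f g : A →ₗ[K] U}
    (h : ∀ i, ∀ x ∈ 𝒜 i, f x = g x) : f = g := by
  ext x
  rw [← sum_superProj 𝒜 x, map_sum, map_sum]
  exact Finset.sum_congr rfl fun i _ => h i _ (superProj_mem 𝒜 i x)

end Functionals

/-! ## Functionals on tensor products -/

section Pairings

variable {K V W U : Type*} [Field K] [AddCommGroup V] [Module K V] [AddCommGroup W] [Module K W]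
  [AddCommGroup U] [Module K U]

/-- The functional `x ⊗ y ↦ φ x * ψ y` (no sign). -/
def pair₂ : Module.Dual K V →ₗ[K] Module.Dual K W →ₗ[K] Module.Dual K (V ⊗[K] W) :=
  (TensorProduct.mk K (Module.Dual K V) (Module.Dual K W)).compr₂ (TensorProduct.dualDistrib K V W)

@[simp] theorem pair₂_tmul (φ : Module.Dual K V) (ψ : Module.Dual K W) (x : V) (y : W) :
    pair₂ φ ψ (x ⊗ₜ[K] y) = φ x * ψ y := rfl

/-- In finite dimension every functional on V ⊗ W is a sum of product functionals. -/
theorem tensor_eq_of_pair₂ [FiniteDimensional K V] [FiniteDimensional K W] {X Y : V ⊗[K] W}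
    (h : ∀ φ ψ, pair₂ φ ψ X = pair₂ φ ψ Y) : X = Y := by
  rw [← sub_eq_zero, ← Module.forall_dual_apply_eq_zero_iff K]
  intro f
  obtain ⟨w, rfl⟩ := (TensorProduct.dualDistribEquiv K V W).surjective f
  change TensorProduct.dualDistrib K V W w (X - Y) = 0
  induction w with
  | zero => simp
  | add a b ha hb => rw [map_add, LinearMap.add_apply, ha, hb, add_zero]
  | tmul φ ψ =>
    have := h φ ψ
    rw [map_sub, sub_eq_zero]
    exact this

/-- The functional `x ⊗ y ⊗ z ↦ φ x * ψ y * χ z` (no sign). -/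
def pair₃ (φ ψ χ : Module.Dual K V) : Module.Dual K (V ⊗[K] (V ⊗[K] V)) :=
  pair₂ φ (pair₂ ψ χ)

@[simp] theorem pair₃_tmul (φ ψ χ : Module.Dual K V) (x y z : V) :
    pair₃ φ ψ χ (x ⊗ₜ[K] (y ⊗ₜ[K] z)) = φ x * (ψ y * χ z) := rfl

theorem pair₂_rTensor {V' : Type*} [AddCommGroup V'] [Module K V'] (φ : Module.Dual K V')
    (ψ : Module.Dual K W) (T : V →ₗ[K] V') (X : V ⊗[K] W) :
    pair₂ φ ψ (T.rTensor W X) = pair₂ (φ ∘ₗ T) ψ X := by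
  induction X with
  | zero => simp
  | add a b ha hb => simp only [map_add, ha, hb]
  | tmul x y => simp

theorem pair₂_lTensor {W' : Type*} [AddCommGroup W'] [Module K W'] (φ : Module.Dual K V)
    (ψ : Module.Dual K W') (T : W →ₗ[K] W') (X : V ⊗[K] W) :
    pair₂ φ ψ (T.lTensor V X) = pair₂ φ (ψ ∘ₗ T) X := by
  induction X with
  | zero => simp
  | add a b ha hb => simp only [map_add, ha, hb]
  | tmul x y => simp

theorem pair₂_map {V' W' : Type*} [AddCommGroup V'] [Module K V'] [AddCommGroup W'] [Module K W']
    (φ : Module.Dual K V') (ψ : Module.Dual K W') (S : V →ₗ[K] V') (T : W →ₗ[K] W')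
    (X : V ⊗[K] W) :
    pair₂ φ ψ (TensorProduct.map S T X) = pair₂ (φ ∘ₗ S) (ψ ∘ₗ T) X := by
  induction X with
  | zero => simp
  | add a b ha hb => simp only [map_add, ha, hb]
  | tmul x y => simp

theorem pair₂_comm (φ ψ : Module.Dual K V) (X : V ⊗[K] V) :
    pair₂ φ ψ (TensorProduct.comm K V V X) = pair₂ ψ φ X := by
  induction X with
  | zero => simp
  | add a b ha hb => simp only [map_add, ha, hb]
  | tmul x y => simp [mul_comm]

theorem pair₃_assoc (φ ψ χ : Module.Dual K V) (X : (V ⊗[K] V) ⊗[K] V) :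
    pair₃ φ ψ χ (TensorProduct.assoc K V V V X) = pair₂ (pair₂ φ ψ) χ X := by
  induction X with
  | zero => simp
  | add a b ha hb => simp only [map_add, ha, hb]
  | tmul x y =>
    induction x with
    | zero => simp
    | add a b ha hb => simp only [map_add, ha, hb, TensorProduct.add_tmul]
    | tmul x z => simp [mul_assoc]

theorem pair₂_eq_zero_of_mem {𝒜 : ZMod 2 → Submodule K V} {i j k : ZMod 2} {φ ψ : Module.Dual K V}
    (hφ : φ ∈ dualGrading 𝒜 i) (hψ : ψ ∈ dualGrading 𝒜 j) {X : V ⊗[K] V}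
    (hX : X ∈ tensorGrading 𝒜 k) (hijk : i + j ≠ k) : pair₂ φ ψ X = 0 := by
  suffices tensorGrading 𝒜 k ≤ LinearMap.ker (pair₂ φ ψ) from this hX
  refine iSup_le fun l => iSup_le fun m => iSup_le fun hlm => ?_
  rintro _ ⟨Y, rfl⟩
  rw [LinearMap.mem_ker, pair₂_map]
  by_cases hil : i = l
  · have hjm : j ≠ m := by rintro rfl; exact hijk (hil ▸ hlm)
    have : ψ ∘ₗ (𝒜 m).subtype = 0 := by
      ext y; exact dual_apply_eq_zero hψ y.2 hjm
    rw [this, map_zero, LinearMap.zero_apply]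
  · have : φ ∘ₗ (𝒜 l).subtype = 0 := by
      ext y; exact dual_apply_eq_zero hφ y.2 hil
    rw [this, map_zero, LinearMap.zero_apply, LinearMap.zero_apply]

end Pairings

/-! ## Signed operations under homogeneous functionals -/

section SignedOps

variable {K A : Type*} [Field K] [AddCommGroup A] [Module K A]
  {𝒜 : ZMod 2 → Submodule K A} [DirectSum.Decomposition 𝒜]

/-- Testing only on homogeneous functionals turns each signed operation on tensors into an unsigned
one with a single scalar sign. -/
theorem tensor_eq_of_hom [FiniteDimensional K A] {X Y : A ⊗[K] A}
    (h : ∀ i j, ∀ φ ∈ dualGrading 𝒜 i, ∀ ψ ∈ dualGrading 𝒜 j, pair₂ φ ψ X = pair₂ φ ψ Y) :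
    X = Y := by
  refine tensor_eq_of_pair₂ fun φ ψ => ?_
  rw [← sum_superProj (dualGrading 𝒜) φ, ← sum_superProj (dualGrading 𝒜) ψ]
  simp only [map_sum, LinearMap.sum_apply]
  exact Finset.sum_congr rfl fun i _ => Finset.sum_congr rfl fun j _ =>
    h _ _ _ (superProj_mem _ _ _) _ (superProj_mem _ _ _)

theorem tensor₃_eq_of_hom [FiniteDimensional K A] {X Y : A ⊗[K] (A ⊗[K] A)}
    (h : ∀ i j k, ∀ φ ∈ dualGrading 𝒜 i, ∀ ψ ∈ dualGrading 𝒜 j, ∀ χ ∈ dualGrading 𝒜 k,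
      pair₃ φ ψ χ X = pair₃ φ ψ χ Y) :
    X = Y := by
  refine tensor_eq_of_pair₂ fun φ ω => ?_
  obtain ⟨w, rfl⟩ := (TensorProduct.dualDistribEquiv K A A).surjective ω
  change pair₂ φ (TensorProduct.dualDistrib K A A w) X =
    pair₂ φ (TensorProduct.dualDistrib K A A w) Y
  induction w with
  | zero => simp
  | add a b ha hb => simp only [map_add, LinearMap.add_apply, ha, hb]
  | tmul ψ χ =>
    change pair₃ φ ψ χ X = pair₃ φ ψ χ Y
    rw [← sum_superProj (dualGrading 𝒜) φ, ← sum_superProj (dualGrading 𝒜) ψ,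
      ← sum_superProj (dualGrading 𝒜) χ]
    simp only [pair₃, map_sum, LinearMap.sum_apply]
    exact Finset.sum_congr rfl fun i _ => Finset.sum_congr rfl fun j _ =>
      Finset.sum_congr rfl fun k _ =>
      h _ _ _ _ (superProj_mem _ _ _) _ (superProj_mem _ _ _) _ (superProj_mem _ _ _)

theorem pair₂_superTwist {i j : ZMod 2} {φ ψ : Module.Dual K A} (hφ : φ ∈ dualGrading 𝒜 i)
    (hψ : ψ ∈ dualGrading 𝒜 j) (X : A ⊗[K] A) :
    pair₂ φ ψ (superTwist 𝒜 X) = koszulSign K i j * pair₂ ψ φ X := by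
  simp only [superTwist, LinearMap.sum_apply, map_sum, LinearMap.smul_apply, map_smul,
    LinearMap.comp_apply, LinearEquiv.coe_coe, pair₂_comm, pair₂_map, dual_comp_superProj hφ,
    dual_comp_superProj hψ, smul_eq_mul]
  -- The flip puts ψ on the first factor, so the surviving summand has indices (j, i).
  rw [Finset.sum_eq_single j, Finset.sum_eq_single i]
  · simp [koszulSign_comm K i j]
  · intro k _ hk; simp [hk.symm]
  · simp
  · intro k _ hk
    refine Finset.sum_eq_zero fun l _ => ?_
    simp [hk.symm]
  · simp

theorem pair₃_lTensor_superTwist {j k : ZMod 2} (φ : Module.Dual K A) {ψ χ : Module.Dual K A}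
    (hψ : ψ ∈ dualGrading 𝒜 j) (hχ : χ ∈ dualGrading 𝒜 k) (X : A ⊗[K] (A ⊗[K] A)) :
    pair₃ φ ψ χ ((superTwist 𝒜).lTensor A X) = koszulSign K j k * pair₃ φ χ ψ X := by
  have : pair₂ ψ χ ∘ₗ superTwist 𝒜 = koszulSign K j k • pair₂ χ ψ := by
    ext1; ext x y
    simp [pair₂_superTwist hψ hχ]
  rw [pair₃, pair₂_lTensor, this, map_smul]; rfl

theorem pair₃_twistLeft {i j : ZMod 2} {φ ψ : Module.Dual K A} (χ : Module.Dual K A)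
    (hφ : φ ∈ dualGrading 𝒜 i) (hψ : ψ ∈ dualGrading 𝒜 j) (X : A ⊗[K] (A ⊗[K] A)) :
    pair₃ φ ψ χ (twistLeft 𝒜 X) = koszulSign K i j * pair₃ ψ φ χ X := by
  have : pair₂ φ ψ ∘ₗ superTwist 𝒜 = koszulSign K i j • pair₂ ψ φ := by
    ext1; ext x y
    simp [pair₂_superTwist hφ hψ]
  obtain ⟨Y, rfl⟩ := (TensorProduct.assoc K A A A).surjective X
  simp only [twistLeft, LinearMap.comp_apply, LinearEquiv.coe_coe, LinearEquiv.symm_apply_apply,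
    pair₃_assoc, pair₂_rTensor, this, map_smul, LinearMap.smul_apply, smul_eq_mul]

theorem pair₃_superCyclic {i j k : ZMod 2} {φ ψ χ : Module.Dual K A}
    (hφ : φ ∈ dualGrading 𝒜 i) (hψ : ψ ∈ dualGrading 𝒜 j) (hχ : χ ∈ dualGrading 𝒜 k)
    (X : A ⊗[K] (A ⊗[K] A)) :
    pair₃ φ ψ χ (superCyclic 𝒜 X) =
      koszulSign K j k * koszulSign K i k * pair₃ χ φ ψ X := by
  rw [superCyclic, LinearMap.comp_apply, pair₃_lTensor_superTwist φ hψ hχ,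
    pair₃_twistLeft ψ hφ hχ, mul_assoc]

theorem pair₂_leftAct (T : A →ₗ[K] A →ₗ[K] A) (φ ψ : Module.Dual K A) (x : A) (X : A ⊗[K] A) :
    pair₂ φ ψ (leftAct T x X) = pair₂ (φ ∘ₗ T x) ψ X :=
  pair₂_rTensor φ ψ (T x) X

theorem pair₂_rightAct (T : A →ₗ[K] A →ₗ[K] A) {i k : ZMod 2} {φ : Module.Dual K A}
    (ψ : Module.Dual K A) {x : A} (hx : x ∈ 𝒜 k) (hφ : φ ∈ dualGrading 𝒜 i) (X : A ⊗[K] A) :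
    pair₂ φ ψ (rightAct 𝒜 T x X) = koszulSign K k i * pair₂ φ (ψ ∘ₗ T x) X := by
  simp only [rightAct, LinearMap.sum_apply, LinearMap.smul_apply, LinearMap.comp_apply, map_sum,
    map_smul, superProj_of_mem 𝒜 hx, TensorProduct.mapBilinear_apply, pair₂_map,
    dual_comp_superProj hφ, smul_eq_mul]
  rw [Finset.sum_eq_single k, Finset.sum_eq_single i]
  · simp
  · intro l _ hl; simp [hl.symm]
  · simp
  · intro l _ hl
    refine Finset.sum_eq_zero fun m _ => ?_
    rw [if_neg hl.symm, map_zero, LinearMap.comp_zero, map_zero, LinearMap.zero_apply, mul_zero]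
  · simp

/-- X is the sum of its bihomogeneous components; one of bidegree (i, j) with i + j ≠ k is killed by
all homogeneous functionals, hence zero. -/
theorem mem_tensorGrading_of_pair₂ [FiniteDimensional K A] {k : ZMod 2} {X : A ⊗[K] A}
    (h : ∀ i j, ∀ φ ∈ dualGrading 𝒜 i, ∀ ψ ∈ dualGrading 𝒜 j, i + j ≠ k → pair₂ φ ψ X = 0) :
    X ∈ tensorGrading 𝒜 k := by
  have hX : ∑ i, ∑ j, TensorProduct.map (superProj 𝒜 i) (superProj 𝒜 j) X = X := by
    refine tensor_eq_of_hom (𝒜 := 𝒜) fun i j φ hφ ψ hψ => ?_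
    simp only [map_sum, pair₂_map, dual_comp_superProj hφ, dual_comp_superProj hψ]
    rw [Finset.sum_eq_single i, Finset.sum_eq_single j]
    · simp
    · intro l _ hl; simp [hl.symm]
    · simp
    · intro l _ hl; simp [hl.symm]
    · simp
  rw [← hX]
  refine Submodule.sum_mem _ fun i _ => Submodule.sum_mem _ fun j _ => ?_
  by_cases hij : i + j = k
  · refine Submodule.mem_iSup_of_mem i (Submodule.mem_iSup_of_mem j
      (Submodule.mem_iSup_of_mem hij ?_))
    have h1 : ∀ l, superProj 𝒜 l =
        (𝒜 l).subtype ∘ₗ (superProj 𝒜 l).codRestrict (𝒜 l) (superProj_mem 𝒜 l) :=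
      fun l => rfl
    rw [h1 i, h1 j, TensorProduct.map_comp]
    exact ⟨_, rfl⟩
  · convert Submodule.zero_mem _
    refine tensor_eq_of_hom (𝒜 := 𝒜) fun i' j' φ hφ ψ hψ => ?_
    rw [pair₂_map, map_zero, ← superProj_dual, ← superProj_dual]
    exact h i j _ (superProj_mem _ _ _) _ (superProj_mem _ _ _) hij

end SignedOps

/-! ## Duality between supercoalgebras and superalgebras -/

section Duality

variable {K A : Type*} [Field K] [AddCommGroup A] [Module K A]
  {𝒜 : ZMod 2 → Submodule K A} [DirectSum.Decomposition 𝒜]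

/-- The sign (-1)^{|b||u|} of the pairing becomes a constant: φ sees only first legs u of its own
parity. -/
theorem dualOp_apply (D : A →ₗ[K] A ⊗[K] A) {i j : ZMod 2} {φ ψ : Module.Dual K A}
    (hφ : φ ∈ dualGrading 𝒜 i) (hψ : ψ ∈ dualGrading 𝒜 j) :
    dualOp 𝒜 D φ ψ = koszulSign K i j • (pair₂ φ ψ ∘ₗ D) := by
  have key : ∀ X, superDualDistrib 𝒜 (φ ⊗ₜ[K] ψ) X = koszulSign K i j * pair₂ φ ψ X := by
    intro X
    have h1 : ∀ l, superProj (dualGrading 𝒜) l ψ = if j = l then ψ else 0 :=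
      superProj_of_mem _ hψ
    have h2 : ∀ l m, (((superProj 𝒜 m).rTensor A).dualMap
        (TensorProduct.dualDistrib K A A
          ((superProj (dualGrading 𝒜) l).lTensor (Module.Dual K A) (φ ⊗ₜ[K] ψ)))) X =
        pair₂ (φ ∘ₗ superProj 𝒜 m) (superProj (dualGrading 𝒜) l ψ) X := by
      intro l m
      rw [← pair₂_rTensor]; rfl
    simp only [superDualDistrib, LinearMap.sum_apply, LinearMap.smul_apply, LinearMap.comp_apply,
      h2, dual_comp_superProj hφ, h1, smul_eq_mul]
    rw [Finset.sum_eq_single j, Finset.sum_eq_single i]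
    · simp [koszulSign_comm K i j]
    · intro l _ hl; simp [hl.symm]
    · simp
    · intro l _ hl
      refine Finset.sum_eq_zero fun m _ => ?_
      simp [hl.symm]
    · simp
  ext x
  exact key (D x)

theorem pair₂_coproduct (D : A →ₗ[K] A ⊗[K] A) {i j : ZMod 2} {φ ψ : Module.Dual K A}
    (hφ : φ ∈ dualGrading 𝒜 i) (hψ : ψ ∈ dualGrading 𝒜 j) (x : A) :
    pair₂ φ ψ (D x) = koszulSign K i j * dualOp 𝒜 D φ ψ x := by
  rw [dualOp_apply D hφ hψ, LinearMap.smul_apply, smul_eq_mul, ← mul_assoc, koszulSign_mul_self,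
    one_mul, LinearMap.comp_apply]

theorem dualOp_mem {D : A →ₗ[K] A ⊗[K] A} (hD : ∀ i, ∀ x ∈ 𝒜 i, D x ∈ tensorGrading 𝒜 i)
    {i j : ZMod 2} {φ ψ : Module.Dual K A}
    (hφ : φ ∈ dualGrading 𝒜 i) (hψ : ψ ∈ dualGrading 𝒜 j) :
    dualOp 𝒜 D φ ψ ∈ dualGrading 𝒜 (i + j) := by
  refine mem_dualGrading_of_forall fun k hk x hx => ?_
  rw [dualOp_apply D hφ hψ, LinearMap.smul_apply, LinearMap.comp_apply,
    pair₂_eq_zero_of_mem hφ hψ (hD k x hx) hk.symm, smul_zero]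

theorem coproduct_mem [FiniteDimensional K A] {D : A →ₗ[K] A ⊗[K] A}
    (hD : ∀ i j, ∀ φ ∈ dualGrading 𝒜 i, ∀ ψ ∈ dualGrading 𝒜 j,
      dualOp 𝒜 D φ ψ ∈ dualGrading 𝒜 (i + j)) {i : ZMod 2} {x : A} (hx : x ∈ 𝒜 i) :
    D x ∈ tensorGrading 𝒜 i := by
  refine mem_tensorGrading_of_pair₂ fun j k φ hφ ψ hψ hjk => ?_
  rw [pair₂_coproduct D hφ hψ, dual_apply_eq_zero (hD j k φ hφ ψ hψ) hx hjk, mul_zero]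

/-- `(φ ⊗ ψ ⊗ χ) ((id ⊗ E) D x)` in terms of the dual operations. -/
theorem pair₃_lTensor_coproduct {D E : A →ₗ[K] A ⊗[K] A}
    (hE : ∀ i j, ∀ φ ∈ dualGrading 𝒜 i, ∀ ψ ∈ dualGrading 𝒜 j,
      dualOp 𝒜 E φ ψ ∈ dualGrading 𝒜 (i + j)) {i j k : ZMod 2} {φ ψ χ : Module.Dual K A}
    (hφ : φ ∈ dualGrading 𝒜 i) (hψ : ψ ∈ dualGrading 𝒜 j) (hχ : χ ∈ dualGrading 𝒜 k) (x : A) :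
    pair₃ φ ψ χ (E.lTensor A (D x)) = koszulSign K i j * koszulSign K i k * koszulSign K j k *
      dualOp 𝒜 D φ (dualOp 𝒜 E ψ χ) x := by
  have h : pair₂ ψ χ ∘ₗ E = koszulSign K j k • dualOp 𝒜 E ψ χ := by
    ext y; simp [pair₂_coproduct E hψ hχ]
  rw [pair₃, pair₂_lTensor, h, map_smul, LinearMap.smul_apply,
    pair₂_coproduct D hφ (hE _ _ _ hψ _ hχ), koszulSign_add_right, smul_eq_mul]
  ring

/-- `(φ ⊗ ψ ⊗ χ) ((E ⊗ id) D x)` in terms of the dual operations. -/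
theorem pair₃_rTensor_coproduct {D E : A →ₗ[K] A ⊗[K] A}
    (hE : ∀ i j, ∀ φ ∈ dualGrading 𝒜 i, ∀ ψ ∈ dualGrading 𝒜 j,
      dualOp 𝒜 E φ ψ ∈ dualGrading 𝒜 (i + j)) {i j k : ZMod 2} {φ ψ χ : Module.Dual K A}
    (hφ : φ ∈ dualGrading 𝒜 i) (hψ : ψ ∈ dualGrading 𝒜 j) (hχ : χ ∈ dualGrading 𝒜 k) (x : A) :
    pair₃ φ ψ χ (TensorProduct.assoc K A A A (E.rTensor A (D x))) =
      koszulSign K i j * koszulSign K i k * koszulSign K j k *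
      dualOp 𝒜 D (dualOp 𝒜 E φ ψ) χ x := by
  have h : pair₂ φ ψ ∘ₗ E = koszulSign K i j • dualOp 𝒜 E φ ψ := by
    ext y; simp [pair₂_coproduct E hφ hψ]
  rw [pair₃_assoc, pair₂_rTensor, h, map_smul, LinearMap.smul_apply, LinearMap.smul_apply,
    pair₂_coproduct D (hE _ _ _ hφ _ hψ) hχ, koszulSign_add_left, smul_eq_mul]
  ring

theorem IsLieSupercoalgebra.dual {δ : A →ₗ[K] A ⊗[K] A} (h : IsLieSupercoalgebra 𝒜 δ) :
    IsLieSuperalgebra (dualGrading 𝒜) (dualOp 𝒜 δ) where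
  even _ _ _ hφ _ hψ := dualOp_mem h.even hφ hψ
  skew i j φ hφ ψ hψ := by
    ext x
    -- With δ(x) = X - τ(X), skewness follows from τ² = id.
    obtain ⟨X, hX⟩ := h.skew ⟨x, rfl⟩
    rw [dualOp_apply δ hφ hψ, dualOp_apply δ hψ hφ]
    simp only [LinearMap.smul_apply, LinearMap.comp_apply, LinearMap.neg_apply, ← hX,
      LinearMap.sub_apply, LinearMap.id_apply, map_sub, pair₂_superTwist hφ hψ,
      pair₂_superTwist hψ hφ, smul_eq_mul, koszulSign_comm K j i]
    linear_combination (-koszulSign K i j * pair₂ φ ψ X) * koszulSign_mul_self K i j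
  jacobi i j k φ hφ ψ hψ χ hχ := by
    have hE : ∀ i j, ∀ φ ∈ dualGrading 𝒜 i, ∀ ψ ∈ dualGrading 𝒜 j,
      dualOp 𝒜 δ φ ψ ∈ dualGrading 𝒜 (i + j) := fun _ _ _ hφ _ hψ => dualOp_mem h.even hφ hψ
    ext x
    have := congrArg (pair₃ φ ψ χ) (LinearMap.congr_fun h.cojacobi x)
    simp only [LinearMap.comp_apply, LinearMap.add_apply, LinearMap.id_apply, map_add,
      pair₃_superCyclic hφ hψ hχ, pair₃_superCyclic hχ hφ hψ,
      pair₃_lTensor_coproduct hE hφ hψ hχ, pair₃_lTensor_coproduct hE hψ hχ hφ,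
      pair₃_lTensor_coproduct hE hχ hφ hψ, LinearMap.zero_apply, map_zero] at this
    simp only [LinearMap.add_apply, LinearMap.smul_apply, LinearMap.zero_apply, smul_eq_mul]
    -- The two Jacobi relations carry different sign conventions; for fixed parities they agree up
    -- to an overall sign, whence the two alternatives.
    rcases parity_cases i with rfl | rfl <;> rcases parity_cases j with rfl | rfl <;>
      rcases parity_cases k with rfl | rfl <;> simp at this ⊢ <;>
      first | linear_combination this | linear_combination -this

theorem IsPoissonSupercoalgebra.dual {δ Δ : A →ₗ[K] A ⊗[K] A}
    (h : IsPoissonSupercoalgebra 𝒜 δ Δ) :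
    IsPoissonSuperalgebra (dualGrading 𝒜) (dualOp 𝒜 δ) (dualOp 𝒜 Δ) := by
  have hδ : ∀ i j, ∀ φ ∈ dualGrading 𝒜 i, ∀ ψ ∈ dualGrading 𝒜 j,
    dualOp 𝒜 δ φ ψ ∈ dualGrading 𝒜 (i + j) := fun _ _ _ hφ _ hψ => dualOp_mem h.lie.even hφ hψ
  have hΔ : ∀ i j, ∀ φ ∈ dualGrading 𝒜 i, ∀ ψ ∈ dualGrading 𝒜 j,
    dualOp 𝒜 Δ φ ψ ∈ dualGrading 𝒜 (i + j) :=
    fun _ _ _ hφ _ hψ => dualOp_mem h.coassoc.even hφ hψ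
  refine ⟨h.lie.dual, ⟨⟨hΔ, ?_⟩, ?_⟩, ?_⟩
  · have key : ∀ i j k, ∀ φ ∈ dualGrading 𝒜 i, ∀ ψ ∈ dualGrading 𝒜 j, ∀ χ ∈ dualGrading 𝒜 k,
        dualOp 𝒜 Δ φ (dualOp 𝒜 Δ ψ χ) = dualOp 𝒜 Δ (dualOp 𝒜 Δ φ ψ) χ := by
      intro i j k φ hφ ψ hψ χ hχ
      ext x
      have := congrArg (pair₃ φ ψ χ) (LinearMap.congr_fun h.coassoc.coassoc x)
      simp only [LinearMap.comp_apply, LinearEquiv.coe_coe, pair₃_lTensor_coproduct hΔ hφ hψ hχ,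
        pair₃_rTensor_coproduct hΔ hφ hψ hχ] at this
      exact mul_left_cancel₀ (mul_ne_zero (mul_ne_zero (koszulSign_ne_zero K _ _)
        (koszulSign_ne_zero K _ _)) (koszulSign_ne_zero K _ _)) this
    intro φ ψ χ
    rw [← sum_superProj (dualGrading 𝒜) φ, ← sum_superProj (dualGrading 𝒜) ψ,
      ← sum_superProj (dualGrading 𝒜) χ]
    simp only [map_sum, LinearMap.sum_apply]
    refine Finset.sum_congr rfl fun k _ => Finset.sum_congr rfl fun j _ =>
      Finset.sum_congr rfl fun i _ => ?_
    exact key _ _ _ _ (superProj_mem _ _ _) _ (superProj_mem _ _ _) _ (superProj_mem _ _ _)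
  · intro i j φ hφ ψ hψ
    ext x
    have := congrArg (pair₂ φ ψ) (LinearMap.congr_fun h.cocomm x)
    rw [LinearMap.comp_apply, pair₂_superTwist hφ hψ] at this
    rw [dualOp_apply Δ hφ hψ, dualOp_apply Δ hψ hφ]
    simp only [LinearMap.smul_apply, LinearMap.comp_apply, smul_eq_mul, koszulSign_comm K j i]
    rw [this]
  · intro i j φ hφ ψ hψ χ
    rw [← sum_superProj (dualGrading 𝒜) χ]
    simp only [map_sum, Finset.smul_sum, ← Finset.sum_add_distrib]
    refine Finset.sum_congr rfl fun k _ => ?_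
    have hχ := superProj_mem (dualGrading 𝒜) k χ
    generalize superProj (dualGrading 𝒜) k χ = χ at hχ
    ext x
    have := congrArg (pair₃ φ ψ χ) (LinearMap.congr_fun h.compat x)
    simp only [LinearMap.comp_apply, LinearMap.add_apply, LinearEquiv.coe_coe, map_add,
      pair₃_lTensor_coproduct hΔ hφ hψ hχ, pair₃_twistLeft χ hφ hψ,
      pair₃_lTensor_coproduct hδ hψ hφ hχ,
      pair₃_rTensor_coproduct hδ hφ hψ hχ] at this
    simp only [LinearMap.add_apply, LinearMap.smul_apply, smul_eq_mul]
    rcases parity_cases i with rfl | rfl <;> rcases parity_cases j with rfl | rfl <;>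
      rcases parity_cases k with rfl | rfl <;> simp at this ⊢ <;>
      first | linear_combination this | linear_combination -this

variable [FiniteDimensional K A]

theorem IsLieSupercoalgebra.of_dual [CharZero K] {δ : A →ₗ[K] A ⊗[K] A}
    (h : IsLieSuperalgebra (dualGrading 𝒜) (dualOp 𝒜 δ)) : IsLieSupercoalgebra 𝒜 δ where
  even _ _ hx := coproduct_mem h.even hx
  skew := by
    rintro _ ⟨x, rfl⟩
    -- Skewness of the dual bracket means τδ = -δ, so (id - τ)(δ(x)/2) = δ(x); this is where 2 must
    -- be invertible.
    refine ⟨(2⁻¹ : K) • δ x, ?_⟩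
    refine tensor_eq_of_hom (𝒜 := 𝒜) fun i j φ hφ ψ hψ => ?_
    have := LinearMap.congr_fun (h.skew i j φ hφ ψ hψ) x
    simp only [LinearMap.neg_apply, LinearMap.smul_apply, smul_eq_mul] at this
    simp only [LinearMap.sub_apply, LinearMap.id_apply, map_smul, map_sub,
      pair₂_superTwist hφ hψ, pair₂_coproduct δ hφ hψ, pair₂_coproduct δ hψ hφ, smul_eq_mul,
      koszulSign_comm K j i]
    have h2 : (2 : K)⁻¹ * 2 = 1 := inv_mul_cancel₀ two_ne_zero
    linear_combination (-2⁻¹ * koszulSign K i j) * this +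
      koszulSign K i j * dualOp 𝒜 δ φ ψ x * h2
  cojacobi := by
    ext x
    refine tensor₃_eq_of_hom (𝒜 := 𝒜) fun i j k φ hφ ψ hψ χ hχ => ?_
    have := LinearMap.congr_fun (h.jacobi i j k φ hφ ψ hψ χ hχ) x
    simp only [LinearMap.add_apply, LinearMap.smul_apply, LinearMap.zero_apply, smul_eq_mul] at this
    simp only [LinearMap.comp_apply, LinearMap.add_apply, LinearMap.id_apply, map_add,
      pair₃_superCyclic hφ hψ hχ, pair₃_superCyclic hχ hφ hψ,
      pair₃_lTensor_coproduct h.even hφ hψ hχ, pair₃_lTensor_coproduct h.even hψ hχ hφ,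
      pair₃_lTensor_coproduct h.even hχ hφ hψ, LinearMap.zero_apply, map_zero]
    rcases parity_cases i with rfl | rfl <;> rcases parity_cases j with rfl | rfl <;>
      rcases parity_cases k with rfl | rfl <;> simp at this ⊢ <;>
      first | linear_combination this | linear_combination -this

theorem IsPoissonSupercoalgebra.of_dual [CharZero K] {δ Δ : A →ₗ[K] A ⊗[K] A}
    (h : IsPoissonSuperalgebra (dualGrading 𝒜) (dualOp 𝒜 δ) (dualOp 𝒜 Δ)) :
    IsPoissonSupercoalgebra 𝒜 δ Δ where
  lie := .of_dual h.lie
  coassoc :=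
    { even := fun _ _ hx => coproduct_mem h.commAssoc.even hx
      coassoc := by
        ext x
        refine tensor₃_eq_of_hom (𝒜 := 𝒜) fun i j k φ hφ ψ hψ χ hχ => ?_
        simp only [LinearMap.comp_apply, LinearEquiv.coe_coe,
          pair₃_lTensor_coproduct h.commAssoc.even hφ hψ hχ,
          pair₃_rTensor_coproduct h.commAssoc.even hφ hψ hχ, h.commAssoc.assoc] }
  cocomm := by
    ext x
    refine tensor_eq_of_hom (𝒜 := 𝒜) fun i j φ hφ ψ hψ => ?_
    rw [LinearMap.comp_apply, pair₂_superTwist hφ hψ, pair₂_coproduct Δ hφ hψ,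
      pair₂_coproduct Δ hψ hφ, h.commAssoc.comm i j φ hφ ψ hψ, koszulSign_comm K j i]
    rfl
  compat := by
    ext x
    refine tensor₃_eq_of_hom (𝒜 := 𝒜) fun i j k φ hφ ψ hψ χ hχ => ?_
    have := LinearMap.congr_fun (h.leibniz i j φ hφ ψ hψ χ) x
    simp only [LinearMap.add_apply, LinearMap.smul_apply, smul_eq_mul] at this
    simp only [LinearMap.comp_apply, LinearMap.add_apply, LinearEquiv.coe_coe, map_add,
      pair₃_lTensor_coproduct h.commAssoc.even hφ hψ hχ, pair₃_twistLeft χ hφ hψ,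
      pair₃_lTensor_coproduct h.lie.even hψ hφ hχ,
      pair₃_rTensor_coproduct h.lie.even hφ hψ hχ, this]
    rcases parity_cases i with rfl | rfl <;> rcases parity_cases j with rfl | rfl <;>
      rcases parity_cases k with rfl | rfl <;> simp <;> ring

end Duality

/-! ## The invariant form of the double -/

section Form

variable {K A : Type*} [Field K] [AddCommGroup A] [Module K A]

theorem inl_mem {𝒜 : ZMod 2 → Submodule K A} {i : ZMod 2} {x : A} (hx : x ∈ 𝒜 i) :
    ((x, 0) : A × Module.Dual K A) ∈ doubleGrading 𝒜 i := ⟨hx, Submodule.zero_mem _⟩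

theorem inr_mem {𝒜 : ZMod 2 → Submodule K A} {i : ZMod 2} {a : Module.Dual K A}
    (ha : a ∈ dualGrading 𝒜 i) :
    ((0, a) : A × Module.Dual K A) ∈ doubleGrading 𝒜 i := ⟨Submodule.zero_mem _, ha⟩

variable {𝒜 : ZMod 2 → Submodule K A} [DirectSum.Decomposition 𝒜]

theorem mem_of_dual_apply_eq_zero {i : ZMod 2} {x : A}
    (h : ∀ j, j ≠ i → ∀ b ∈ dualGrading 𝒜 j, b x = 0) : x ∈ 𝒜 i := by
  have h0 : ∀ j, j ≠ i → superProj 𝒜 j x = 0 := by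
    intro j hj
    rw [← Module.forall_dual_apply_eq_zero_iff K]
    intro b
    rw [← LinearMap.comp_apply, ← superProj_dual]
    exact h j hj _ (superProj_mem _ _ _)
  rw [← sum_superProj 𝒜 x, Finset.sum_eq_single i (fun j _ hj => h0 j hj) (by simp)]
  exact superProj_mem 𝒜 i x

theorem superParity_apply {i : ZMod 2} {x : A} (hx : x ∈ 𝒜 i) :
    superParity 𝒜 x = koszulSign K i i • x := by
  change (∑ i, koszulSign K i i • superProj 𝒜 i) x = _
  simp only [LinearMap.sum_apply, LinearMap.smul_apply, superProj_of_mem 𝒜 hx]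
  simp

theorem dualRep_apply {P : Type*} [AddCommGroup P] [Module K P] {𝒢 : ZMod 2 → Submodule K P}
    [DirectSum.Decomposition 𝒢] (T : P →ₗ[K] A →ₗ[K] A) {i j : ZMod 2} {x : P}
    {φ : Module.Dual K A} (hx : x ∈ 𝒢 i) (hφ : φ ∈ dualGrading 𝒜 j) :
    dualRep 𝒢 𝒜 T x φ = -(koszulSign K i j • (φ ∘ₗ T x)) := by
  have h1 : ∀ l, superProj (dualGrading 𝒜) l φ = if j = l then φ else 0 :=
    superProj_of_mem _ hφ
  simp only [dualRep, LinearMap.neg_apply, LinearMap.sum_apply, LinearMap.smul_apply,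
    LinearMap.comp_apply, superProj_of_mem 𝒢 hx, LinearMap.lcomp_apply, h1]
  rw [Finset.sum_eq_single i, Finset.sum_eq_single j]
  · simp; rfl
  · intro l _ hl; simp [hl.symm]
  · simp
  · intro l _ hl
    refine Finset.sum_eq_zero fun m _ => ?_
    simp [hl.symm]
  · simp

theorem superFlip_apply {P Q U : Type*} [AddCommGroup P] [Module K P] [AddCommGroup Q]
    [Module K Q] [AddCommGroup U] [Module K U]
    {𝒢 : ZMod 2 → Submodule K P} {ℋ : ZMod 2 → Submodule K Q}
    [DirectSum.Decomposition 𝒢] [DirectSum.Decomposition ℋ] (B : Q →ₗ[K] P →ₗ[K] U)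
    {i j : ZMod 2} {x : P} {b : Q} (hx : x ∈ 𝒢 i) (hb : b ∈ ℋ j) :
    superFlip 𝒢 ℋ B x b = koszulSign K i j • B b x := by
  simp only [superFlip, LinearMap.sum_apply, LinearMap.smul_apply, LinearMap.compl₁₂_apply,
    LinearMap.flip_apply, superProj_of_mem 𝒢 hx, superProj_of_mem ℋ hb]
  rw [Finset.sum_eq_single i, Finset.sum_eq_single j]
  · simp
  · intro l _ hl; simp [hl.symm]
  · simp
  · intro l _ hl
    refine Finset.sum_eq_zero fun m _ => ?_
    simp [hl.symm]
  · simp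

theorem matchedPairOp_apply {P Q : Type*} [AddCommGroup P] [Module K P] [AddCommGroup Q]
    [Module K Q] {𝒢 : ZMod 2 → Submodule K P} {ℋ : ZMod 2 → Submodule K Q}
    [DirectSum.Decomposition 𝒢] [DirectSum.Decomposition ℋ] (s : K)
    (op₁ : P →ₗ[K] P →ₗ[K] P) (op₂ : Q →ₗ[K] Q →ₗ[K] Q)
    (ρ₁ : P →ₗ[K] Q →ₗ[K] Q) (ρ₂ : Q →ₗ[K] P →ₗ[K] P)
    {i j : ZMod 2} {u v : P × Q} (hu : u ∈ prodGrading 𝒢 ℋ i) (hv : v ∈ prodGrading 𝒢 ℋ j) :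
    matchedPairOp 𝒢 ℋ s op₁ op₂ ρ₁ ρ₂ u v =
      (op₁ u.1 v.1 + ρ₂ u.2 v.1 + (s * koszulSign K i j) • ρ₂ v.2 u.1,
        op₂ u.2 v.2 + ρ₁ u.1 v.2 + (s * koszulSign K i j) • ρ₁ v.1 u.2) := by
  simp only [matchedPairOp, LinearMap.add_apply, LinearMap.compr₂_apply, LinearMap.compl₁₂_apply,
    LinearMap.smul_apply, LinearMap.fst_apply, LinearMap.snd_apply, superFlip_apply ρ₂ hu.1 hv.2,
    superFlip_apply ρ₁ hu.2 hv.1, LinearMap.inl_apply, LinearMap.inr_apply, mul_smul]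
  simp

variable [FiniteDimensional K A]

theorem superEval_apply {i : ZMod 2} {x : A} (hx : x ∈ 𝒜 i) (b : Module.Dual K A) :
    superEval 𝒜 x b = koszulSign K i i * b x := by
  change b (superParity 𝒜 x) = _
  rw [superParity_apply hx, map_smul, smul_eq_mul]

theorem superEval_mem_iff {i : ZMod 2} {x : A} :
    superEval 𝒜 x ∈ dualGrading (dualGrading 𝒜) i ↔ x ∈ 𝒜 i := by
  constructor
  · intro h
    refine mem_of_dual_apply_eq_zero fun j hj b hb => ?_
    have key : ∀ l, b (superProj 𝒜 l x) = 0 := by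
      intro l
      by_cases hl : j = l
      · subst hl
        have h1 : superEval 𝒜 (superProj 𝒜 j x) b = superEval 𝒜 x b := by
          conv_rhs => rw [← sum_superProj 𝒜 x, map_sum, LinearMap.sum_apply]
          rw [Finset.sum_eq_single j]
          · intro m _ hm
            rw [superEval_apply (superProj_mem 𝒜 m x),
              dual_apply_eq_zero hb (superProj_mem 𝒜 m x) hm.symm, mul_zero]
          · simp
        rw [dual_apply_eq_zero h hb hj.symm, superEval_apply (superProj_mem 𝒜 j x)] at h1
        exact (mul_eq_zero.1 h1).resolve_left (koszulSign_ne_zero K _ _)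
      · exact dual_apply_eq_zero hb (superProj_mem 𝒜 l x) hl
    rw [← sum_superProj 𝒜 x, map_sum]
    exact Finset.sum_eq_zero fun l _ => key l
  · intro hx
    refine mem_dualGrading_of_forall fun j hj b hb => ?_
    rw [superEval_apply hx, dual_apply_eq_zero hb hx hj, mul_zero]

theorem superEval_bidualRep (T : Module.Dual K A →ₗ[K] Module.Dual K A →ₗ[K] Module.Dual K A)
    {i j : ZMod 2} {a : Module.Dual K A} {x : A} (ha : a ∈ dualGrading 𝒜 i) (hx : x ∈ 𝒜 j) :
    superEval 𝒜 (bidualRep 𝒜 T a x) = -(koszulSign K i j • (superEval 𝒜 x ∘ₗ T a)) := by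
  rw [← dualRep_apply T ha (superEval_mem_iff.2 hx)]
  simp [bidualRep, LinearEquiv.conj_apply]

variable (𝒜) in
/-- The invariant form `⟨x + a, y + b⟩ = ⟨a, y⟩ + ⟨x, b⟩` of `A ⊕ A*`, as an isomorphism with the
dual. -/
def doubleForm : (A × Module.Dual K A) ≃ₗ[K] Module.Dual K (A × Module.Dual K A) :=
  (LinearEquiv.prodComm K A (Module.Dual K A)).trans
    (((LinearEquiv.refl K (Module.Dual K A)).prodCongr (superEval 𝒜)).trans
      (LinearMap.coprodEquiv K))

theorem doubleForm_apply (u v : A × Module.Dual K A) :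
    doubleForm 𝒜 u v = u.2 v.1 + superEval 𝒜 u.1 v.2 := rfl

theorem doubleForm_mem {i : ZMod 2} {u : A × Module.Dual K A} (hu : u ∈ doubleGrading 𝒜 i) :
    doubleForm 𝒜 u ∈ dualGrading (doubleGrading 𝒜) i := by
  refine mem_dualGrading_of_forall fun j hj v hv => ?_
  rw [doubleForm_apply, dual_apply_eq_zero hu.2 hv.1 hj.symm,
    dual_apply_eq_zero (superEval_mem_iff.2 hu.1) hv.2 hj.symm, add_zero]

/-- For equal parities the sign built into `superEval` gives the symmetry; for different parities
both sides vanish because the form is even. -/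
theorem doubleForm_comm {i j : ZMod 2} {u v : A × Module.Dual K A} (hu : u ∈ doubleGrading 𝒜 i)
    (hv : v ∈ doubleGrading 𝒜 j) :
    doubleForm 𝒜 u v = koszulSign K i j * doubleForm 𝒜 v u := by
  by_cases hij : i = j
  · subst hij
    rw [doubleForm_apply, doubleForm_apply, superEval_apply hu.1, superEval_apply hv.1]
    linear_combination -u.2 v.1 * koszulSign_mul_self K i i
  · rw [dual_apply_eq_zero (doubleForm_mem hu) hv hij,
      dual_apply_eq_zero (doubleForm_mem hv) hu (Ne.symm hij), mul_zero]

theorem exists_doubleForm_eq {i : ZMod 2} {φ : Module.Dual K (A × Module.Dual K A)}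
    (hφ : φ ∈ dualGrading (doubleGrading 𝒜) i) :
    ∃ u ∈ doubleGrading 𝒜 i, doubleForm 𝒜 u = φ := by
  obtain ⟨u, rfl⟩ := (doubleForm 𝒜).surjective φ
  refine ⟨superProj (doubleGrading 𝒜) i u, superProj_mem _ _ _, ?_⟩
  refine hom_ext (𝒜 := doubleGrading 𝒜) fun j v hv => ?_
  by_cases hij : i = j
  · subst hij
    conv_rhs => rw [← sum_superProj (doubleGrading 𝒜) u, map_sum, LinearMap.sum_apply]
    rw [Finset.sum_eq_single i]
    · intro k _ hk
      exact dual_apply_eq_zero (doubleForm_mem (superProj_mem _ _ _)) hv hk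
    · simp
  · rw [dual_apply_eq_zero hφ hv hij,
      dual_apply_eq_zero (doubleForm_mem (superProj_mem _ _ _)) hv hij]

/-- Nondegeneracy, with test vectors of one parity only, since the form is even. -/
theorem eq_of_doubleForm {i : ZMod 2} {u v : A × Module.Dual K A} (hu : u ∈ doubleGrading 𝒜 i)
    (hv : v ∈ doubleGrading 𝒜 i)
    (h : ∀ w ∈ doubleGrading 𝒜 i, doubleForm 𝒜 u w = doubleForm 𝒜 v w) : u = v := by
  refine (doubleForm 𝒜).injective (hom_ext (𝒜 := doubleGrading 𝒜) fun j w hw => ?_)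
  by_cases hij : i = j
  · subst hij; exact h w hw
  · rw [dual_apply_eq_zero (doubleForm_mem hu) hw hij,
      dual_apply_eq_zero (doubleForm_mem hv) hw hij]

end Form

/-! ## Invariant operations on the double -/

section Manin

variable {K A : Type*} [Field K] [AddCommGroup A] [Module K A] [FiniteDimensional K A]

/-- `M` is an even, `s`-supersymmetric operation on `A ⊕ A*` for which the canonical form is
invariant and which restricts to `m` on `A` and to `n` on `A*`. -/
structure IsManinOp (𝒜 : ZMod 2 → Submodule K A) [DirectSum.Decomposition 𝒜] (s : K)
    (m : A →ₗ[K] A →ₗ[K] A)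
    (n : Module.Dual K A →ₗ[K] Module.Dual K A →ₗ[K] Module.Dual K A)
    (M : A × Module.Dual K A →ₗ[K] A × Module.Dual K A →ₗ[K] A × Module.Dual K A) : Prop where
  sign : s * s = 1
  even : ∀ i j, ∀ u ∈ doubleGrading 𝒜 i, ∀ v ∈ doubleGrading 𝒜 j, M u v ∈ doubleGrading 𝒜 (i + j)
  symm : ∀ i j, ∀ u ∈ doubleGrading 𝒜 i, ∀ v ∈ doubleGrading 𝒜 j,
    M u v = (s * koszulSign K i j) • M v u
  inv : ∀ u v w, doubleForm 𝒜 (M u v) w = doubleForm 𝒜 u (M v w)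
  inl : ∀ x y, M (x, 0) (y, 0) = (m x y, 0)
  inr : ∀ a b, M (0, a) (0, b) = (0, n a b)

variable {𝒜 : ZMod 2 → Submodule K A} [DirectSum.Decomposition 𝒜]

/-- Supersymmetry of the form and of M carries invariance from the triples (u, v, w), (u, w, v) to
those with u in the last or in the middle place. So it suffices to check it with a distinguished
argument in front. -/
theorem invariant_rotate {s : K} (hs : s * s = 1)
    {M : A × Module.Dual K A →ₗ[K] A × Module.Dual K A →ₗ[K] A × Module.Dual K A}
    (even : ∀ i j, ∀ u ∈ doubleGrading 𝒜 i, ∀ v ∈ doubleGrading 𝒜 j,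
      M u v ∈ doubleGrading 𝒜 (i + j))
    (symm : ∀ i j, ∀ u ∈ doubleGrading 𝒜 i, ∀ v ∈ doubleGrading 𝒜 j,
      M u v = (s * koszulSign K i j) • M v u)
    {i j k : ZMod 2} {u v w : A × Module.Dual K A} (hu : u ∈ doubleGrading 𝒜 i)
    (hv : v ∈ doubleGrading 𝒜 j) (hw : w ∈ doubleGrading 𝒜 k)
    (h1 : doubleForm 𝒜 (M u v) w = doubleForm 𝒜 u (M v w))
    (h2 : doubleForm 𝒜 (M u w) v = doubleForm 𝒜 u (M w v)) :
    doubleForm 𝒜 (M v w) u = doubleForm 𝒜 v (M w u) ∧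
      doubleForm 𝒜 (M v u) w = doubleForm 𝒜 v (M u w) := by
  have e1 := doubleForm_comm (even _ _ _ hv _ hw) hu
  have e2 := doubleForm_comm hv (even _ _ _ hu _ hw)
  rw [symm _ _ _ hw _ hu, symm _ _ _ hv _ hu, e1, map_smul, map_smul, LinearMap.smul_apply, e2,
    h2, symm _ _ _ hw _ hv, map_smul, h1, koszulSign_add_left, koszulSign_add_right]
  simp only [smul_eq_mul]
  constructor
  · rcases parity_cases i with rfl | rfl <;> rcases parity_cases j with rfl | rfl <;>
      rcases parity_cases k with rfl | rfl <;> simp <;>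
      linear_combination -doubleForm 𝒜 u (M v w) * hs
  · rcases parity_cases i with rfl | rfl <;> rcases parity_cases j with rfl | rfl <;>
      rcases parity_cases k with rfl | rfl <;> simp

/-- The action -(s • T*) is ad* for s = -1 and -L* for s = 1. Since T* is by definition a signed
negative transpose, invariance on mixed triples is its defining property. -/
theorem isManinOp_matchedPairOp {s : K} (hs : s * s = 1) {m : A →ₗ[K] A →ₗ[K] A}
    {n : Module.Dual K A →ₗ[K] Module.Dual K A →ₗ[K] Module.Dual K A}
    (hm : ∀ i j, ∀ x ∈ 𝒜 i, ∀ y ∈ 𝒜 j, m x y ∈ 𝒜 (i + j))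
    (hn : ∀ i j, ∀ a ∈ dualGrading 𝒜 i, ∀ b ∈ dualGrading 𝒜 j, n a b ∈ dualGrading 𝒜 (i + j))
    (hm' : ∀ i j, ∀ x ∈ 𝒜 i, ∀ y ∈ 𝒜 j, m x y = (s * koszulSign K i j) • m y x)
    (hn' : ∀ i j, ∀ a ∈ dualGrading 𝒜 i, ∀ b ∈ dualGrading 𝒜 j,
      n a b = (s * koszulSign K i j) • n b a) :
    IsManinOp 𝒜 s m n (matchedPairOp 𝒜 (dualGrading 𝒜) s m n
      (-(s • dualRep 𝒜 𝒜 m)) (-(s • bidualRep 𝒜 n))) := by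
  set M := matchedPairOp 𝒜 (dualGrading 𝒜) s m n
      (-(s • dualRep 𝒜 𝒜 m)) (-(s • bidualRep 𝒜 n)) with hM
  have h₁ : ∀ {i j x a}, x ∈ 𝒜 i → a ∈ dualGrading 𝒜 j →
      dualRep 𝒜 𝒜 m x a ∈ dualGrading 𝒜 (i + j) := by
    intro i j x a hx ha
    rw [dualRep_apply m hx ha, add_comm]
    exact Submodule.neg_mem _ (Submodule.smul_mem _ _
      (dual_comp_mem ha fun k y hy => hm _ _ _ hx _ hy))
  have h₂ : ∀ {i j a x}, a ∈ dualGrading 𝒜 i → x ∈ 𝒜 j → bidualRep 𝒜 n a x ∈ 𝒜 (i + j) := by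
    intro i j a x ha hx
    rw [← superEval_mem_iff, superEval_bidualRep n ha hx, add_comm]
    exact Submodule.neg_mem _ (Submodule.smul_mem _ _
      (dual_comp_mem (superEval_mem_iff.2 hx) fun k b hb => hn _ _ _ ha _ hb))
  have apply_eq : ∀ {i j u v}, u ∈ doubleGrading 𝒜 i → v ∈ doubleGrading 𝒜 j → M u v =
      (m u.1 v.1 - s • bidualRep 𝒜 n u.2 v.1 - koszulSign K i j • bidualRep 𝒜 n v.2 u.1,
        n u.2 v.2 - s • dualRep 𝒜 𝒜 m u.1 v.2 - koszulSign K i j • dualRep 𝒜 𝒜 m v.1 u.2) := by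
    intro i j u v hu hv
    rw [hM, matchedPairOp_apply s m n _ _ hu hv]
    simp only [LinearMap.neg_apply, LinearMap.smul_apply, smul_neg, smul_smul, ← sub_eq_add_neg,
      mul_right_comm s _ s, hs, one_mul]
  have even : ∀ i j, ∀ u ∈ doubleGrading 𝒜 i, ∀ v ∈ doubleGrading 𝒜 j,
      M u v ∈ doubleGrading 𝒜 (i + j) := by
    intro i j u hu v hv
    rw [apply_eq hu hv]
    exact ⟨Submodule.sub_mem _ (Submodule.sub_mem _ (hm _ _ _ hu.1 _ hv.1)
        (Submodule.smul_mem _ _ (h₂ hu.2 hv.1)))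
        (Submodule.smul_mem _ _ (add_comm j i ▸ h₂ hv.2 hu.1)),
      Submodule.sub_mem _ (Submodule.sub_mem _ (hn _ _ _ hu.2 _ hv.2)
        (Submodule.smul_mem _ _ (h₁ hu.1 hv.2)))
        (Submodule.smul_mem _ _ (add_comm j i ▸ h₁ hv.1 hu.2))⟩
  have symm : ∀ i j, ∀ u ∈ doubleGrading 𝒜 i, ∀ v ∈ doubleGrading 𝒜 j,
      M u v = (s * koszulSign K i j) • M v u := by
    intro i j u hu v hv
    have hk := koszulSign_mul_self K i j
    have e1 : s * koszulSign K i j * s = koszulSign K i j := by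
      linear_combination koszulSign K i j * hs
    have e2 : s * koszulSign K i j * koszulSign K i j = s := by linear_combination s * hk
    rw [apply_eq hu hv, apply_eq hv hu, hm' _ _ _ hu.1 _ hv.1, hn' _ _ _ hu.2 _ hv.2,
      koszulSign_comm K j i]
    refine Prod.ext ?_ ?_ <;>
    · simp only [Prod.smul_mk, smul_sub, smul_smul, e1, e2]
      abel
  have inl : ∀ x y, M (x, 0) (y, 0) = (m x y, 0) := by
    intro x y
    simp [hM, matchedPairOp]
  have inr : ∀ a b, M (0, a) (0, b) = (0, n a b) := by
    intro a b
    simp [hM, matchedPairOp]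
  have i1 : ∀ {i j a x}, a ∈ dualGrading 𝒜 i → x ∈ 𝒜 j → ∀ y,
      doubleForm 𝒜 (M (0, a) (x, 0)) (y, 0) = doubleForm 𝒜 (0, a) (M (x, 0) (y, 0)) := by
    intro i j a x ha hx y
    rw [apply_eq (inr_mem ha) (inl_mem hx), inl, doubleForm_apply, doubleForm_apply]
    simp [dualRep_apply m hx ha, koszulSign_comm K j i, ← mul_assoc, koszulSign_mul_self]
  have i2 : ∀ {i j a x}, x ∈ 𝒜 i → a ∈ dualGrading 𝒜 j → ∀ b,
      doubleForm 𝒜 (M (x, 0) (0, a)) (0, b) = doubleForm 𝒜 (x, 0) (M (0, a) (0, b)) := by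
    intro i j a x hx ha b
    rw [apply_eq (inl_mem hx) (inr_mem ha), inr, doubleForm_apply, doubleForm_apply]
    simp [superEval_bidualRep n ha hx, koszulSign_comm K j i, ← mul_assoc, koszulSign_mul_self]
  refine ⟨hs, even, symm, ?_, inl, inr⟩
  have key : ∀ i j k, ∀ u ∈ doubleGrading 𝒜 i, ∀ v ∈ doubleGrading 𝒜 j,
      ∀ w ∈ doubleGrading 𝒜 k, doubleForm 𝒜 (M u v) w = doubleForm 𝒜 u (M v w) := by
    intro i j k ⟨x, a⟩ hu ⟨y, b⟩ hv ⟨z, c⟩ hw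
    have hx : x ∈ 𝒜 i := hu.1
    have ha : a ∈ dualGrading 𝒜 i := hu.2
    have hy : y ∈ 𝒜 j := hv.1
    have hb : b ∈ dualGrading 𝒜 j := hv.2
    have hz : z ∈ 𝒜 k := hw.1
    have hc : c ∈ dualGrading 𝒜 k := hw.2
    -- The functional stands first, second and last in `a1`, `a2`, `a3`; the vector does so in `b1`,
    -- `b2`, `b3`.
    have a1 := i1 ha hy z
    have a2 := (invariant_rotate hs even symm (inr_mem hb) (inl_mem hx) (inl_mem hz)
      (i1 hb hx z) (i1 hb hz x)).2
    have a3 := (invariant_rotate hs even symm (inr_mem hc) (inl_mem hx) (inl_mem hy)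
      (i1 hc hx y) (i1 hc hy x)).1
    have b1 := i2 hx hb c
    have b2 := (invariant_rotate hs even symm (inl_mem hy) (inr_mem ha) (inr_mem hc)
      (i2 hy ha c) (i2 hy hc a)).2
    have b3 := (invariant_rotate hs even symm (inl_mem hz) (inr_mem ha) (inr_mem hb)
      (i2 hz ha b) (i2 hz hb a)).1
    -- Unmixed triples contribute nothing: A and A* are isotropic and closed under M.
    have c1 : doubleForm 𝒜 (M (x, 0) (y, 0)) (z, 0) = 0 := by rw [inl, doubleForm_apply]; simp
    have c2 : doubleForm 𝒜 (x, 0) (M (y, 0) (z, 0)) = 0 := by rw [inl, doubleForm_apply]; simp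
    have c3 : doubleForm 𝒜 (M (0, a) (0, b)) (0, c) = 0 := by rw [inr, doubleForm_apply]; simp
    have c4 : doubleForm 𝒜 (0, a) (M (0, b) (0, c)) = 0 := by rw [inr, doubleForm_apply]; simp
    have d : ∀ x : A, ∀ a : Module.Dual K A, (x, a) = (x, 0) + (0, a) := by simp
    rw [d x a, d y b, d z c]
    simp only [map_add, LinearMap.add_apply]
    linear_combination a1 + a2 + a3 + b1 + b2 + b3 + c1 - c2 + c3 - c4
  intro u v w
  rw [← sum_superProj (doubleGrading 𝒜) u, ← sum_superProj (doubleGrading 𝒜) v,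
    ← sum_superProj (doubleGrading 𝒜) w]
  simp only [map_sum, LinearMap.sum_apply]
  exact Finset.sum_congr rfl fun k _ => Finset.sum_congr rfl fun j _ =>
    Finset.sum_congr rfl fun i _ => key _ _ _ _ (superProj_mem _ _ _) _ (superProj_mem _ _ _) _
      (superProj_mem _ _ _)

end Manin

/-! ## Rotated forms of the axioms -/

section Rotated

variable {K A : Type*} [Field K] [AddCommGroup A] [Module K A] {𝒜 : ZMod 2 → Submodule K A}
  {br mul : A →ₗ[K] A →ₗ[K] A} {i j k : ZMod 2} {x y z : A}

/-- With the inner bracket on the left, pairing with t and invariance produce terms ⟨M(x, y), M(z,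
t)⟩. -/
theorem IsLieSuperalgebra.jacobi_left (h : IsLieSuperalgebra 𝒜 br) (hx : x ∈ 𝒜 i) (hy : y ∈ 𝒜 j)
    (hz : z ∈ 𝒜 k) : br (br x y) z + koszulSign K i (j + k) • br (br y z) x +
      koszulSign K k (i + j) • br (br z x) y = 0 := by
  have e := h.jacobi _ _ _ _ hx _ hy _ hz
  rw [h.skew _ _ _ (h.even _ _ _ hx _ hy) _ hz, h.skew _ _ _ (h.even _ _ _ hy _ hz) _ hx,
    h.skew _ _ _ (h.even _ _ _ hz _ hx) _ hy]
  simp only [koszulSign_add_left, koszulSign_add_right]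
  rcases parity_cases i with rfl | rfl <;> rcases parity_cases j with rfl | rfl <;>
    rcases parity_cases k with rfl | rfl <;>
    simp only [koszulSign_zero_left, koszulSign_zero_right, koszulSign_one_one] at e ⊢ <;>
    first | linear_combination (norm := module) e | linear_combination (norm := module) -e

theorem IsLieSuperalgebra.of_jacobi_left
    (even : ∀ i j, ∀ x ∈ 𝒜 i, ∀ y ∈ 𝒜 j, br x y ∈ 𝒜 (i + j))
    (skew : ∀ i j, ∀ x ∈ 𝒜 i, ∀ y ∈ 𝒜 j, br x y = -(koszulSign K i j • br y x))
    (h : ∀ i j k, ∀ x ∈ 𝒜 i, ∀ y ∈ 𝒜 j, ∀ z ∈ 𝒜 k, br (br x y) z +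
      koszulSign K i (j + k) • br (br y z) x + koszulSign K k (i + j) • br (br z x) y = 0) :
    IsLieSuperalgebra 𝒜 br where
  even := even
  skew := skew
  jacobi i j k x hx y hy z hz := by
    have e := h _ _ _ _ hx _ hy _ hz
    rw [skew _ _ _ (even _ _ _ hx _ hy) _ hz, skew _ _ _ (even _ _ _ hy _ hz) _ hx,
      skew _ _ _ (even _ _ _ hz _ hx) _ hy] at e
    simp only [koszulSign_add_left, koszulSign_add_right] at e
    rcases parity_cases i with rfl | rfl <;> rcases parity_cases j with rfl | rfl <;>
      rcases parity_cases k with rfl | rfl <;>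
      simp only [koszulSign_zero_left, koszulSign_zero_right, koszulSign_one_one] at e ⊢ <;>
      first | linear_combination (norm := module) e | linear_combination (norm := module) -e

theorem IsCommAssociativeSuperalgebra.mul_right_comm
    (h : IsCommAssociativeSuperalgebra 𝒜 mul) (x : A) (hy : y ∈ 𝒜 j)
    (hz : z ∈ 𝒜 k) : mul (mul x y) z = koszulSign K j k • mul (mul x z) y := by
  rw [← h.assoc, ← h.assoc, h.comm _ _ _ hy _ hz, map_smul]

theorem IsCommAssociativeSuperalgebra.mul_rotate
    (h : IsCommAssociativeSuperalgebra 𝒜 mul) (hx : x ∈ 𝒜 i) (hy : y ∈ 𝒜 j)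
    (hz : z ∈ 𝒜 k) : mul (mul x y) z = koszulSign K i (j + k) • mul (mul y z) x := by
  rw [← h.assoc, h.comm _ _ _ hx _ (h.even _ _ _ hy _ hz)]

/-- Expanding by Leibniz gives six products, which cancel in pairs by commutativity and skewness.
This is the instance of the Leibniz identity of the double in which the derivation argument lies on
the other side of the duality from the remaining three. -/
theorem IsPoissonSuperalgebra.leibniz_cyclic (h : IsPoissonSuperalgebra 𝒜 br mul) (hx : x ∈ 𝒜 i)
    (hy : y ∈ 𝒜 j) (hz : z ∈ 𝒜 k) :
    br x (mul y z) + koszulSign K i (j + k) • br y (mul z x) +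
      koszulSign K k (i + j) • br z (mul x y) = 0 := by
  have hl := h.lie
  have hc := h.commAssoc
  rw [h.leibniz _ _ _ hx _ hy, h.leibniz _ _ _ hy _ hz, h.leibniz _ _ _ hz _ hx,
    hc.comm _ _ _ (hl.even _ _ _ hx _ hy) _ hz, hl.skew _ _ _ hx _ hy,
    hc.comm _ _ _ (hl.even _ _ _ hy _ hz) _ hx, hl.skew _ _ _ hy _ hz,
    hc.comm _ _ _ (hl.even _ _ _ hz _ hx) _ hy, hl.skew _ _ _ hz _ hx]
  simp only [koszulSign_add_left, koszulSign_add_right, map_neg, map_smul]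
  rcases parity_cases i with rfl | rfl <;> rcases parity_cases j with rfl | rfl <;>
    rcases parity_cases k with rfl | rfl <;>
    simp only [koszulSign_zero_left, koszulSign_zero_right, koszulSign_one_one] <;>
    module

end Rotated

/-! ## The compatibility conditions in terms of the form -/

section Mixed

variable {K A : Type*} [Field K] [AddCommGroup A] [Module K A] [FiniteDimensional K A]
  {𝒜 : ZMod 2 → Submodule K A} [DirectSum.Decomposition 𝒜]
  {s s' : K} {m m' : A →ₗ[K] A →ₗ[K] A} {D D' : A →ₗ[K] A ⊗[K] A}
  {M N : A × Module.Dual K A →ₗ[K] A × Module.Dual K A →ₗ[K] A × Module.Dual K A}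

/-- Invariance determines the mixed products: this is the A*-component of a * x, and
`IsManinOp.apply_inr_inl` gives its A-component through n. -/
theorem IsManinOp.snd_inr_inl {n : Module.Dual K A →ₗ[K] Module.Dual K A →ₗ[K] Module.Dual K A}
    (hM : IsManinOp 𝒜 s m n M) (a : Module.Dual K A) (x : A) :
    (M (0, a) (x, 0)).2 = a ∘ₗ m x := by
  ext y
  have := hM.inv (0, a) (x, 0) (y, 0)
  rw [hM.inl, doubleForm_apply, doubleForm_apply] at this
  simpa using this

theorem IsManinOp.apply_inr_inl {n : Module.Dual K A →ₗ[K] Module.Dual K A →ₗ[K] Module.Dual K A}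
    (hM : IsManinOp 𝒜 s m n M) (p b : Module.Dual K A) (y : A) :
    n p b y = p (M (0, b) (y, 0)).1 := by
  have := hM.inv (0, p) (0, b) (y, 0)
  rw [hM.inr, doubleForm_apply, doubleForm_apply] at this
  simpa using this

variable {i j k l : ZMod 2} {a b : Module.Dual K A} {x y : A}

/-- The sign of `superEval` depends on i + k alone; it may be replaced by the sign of the pair (i +
k, j + l), which is multiplicative in each parity, because the term vanishes when the two sums
differ. -/
theorem doubleForm_inr_inl_inr_inl
    {n n' : Module.Dual K A →ₗ[K] Module.Dual K A →ₗ[K] Module.Dual K A}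
    (hM : IsManinOp 𝒜 s m n M) (hN : IsManinOp 𝒜 s' m' n' N)
    (ha : a ∈ dualGrading 𝒜 i) (hb : b ∈ dualGrading 𝒜 j) (hx : x ∈ 𝒜 k) (hy : y ∈ 𝒜 l) :
    doubleForm 𝒜 (M (0, a) (x, 0)) (N (0, b) (y, 0)) =
      (M (0, a) (x, 0)).2 (N (0, b) (y, 0)).1 +
        koszulSign K (i + k) (j + l) * (N (0, b) (y, 0)).2 (M (0, a) (x, 0)).1 := by
  have h1 := hM.even _ _ _ (inr_mem ha) _ (inl_mem hx)
  have h2 := hN.even _ _ _ (inr_mem hb) _ (inl_mem hy)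
  rw [doubleForm_apply, superEval_apply h1.1]
  by_cases h : i + k = j + l
  · rw [h]
  · rw [dual_apply_eq_zero h2.2 h1.1 (Ne.symm h), mul_zero, mul_zero]

/-- Together with `pair₂_rightAct_coproduct` this translates each term of a bialgebra compatibility
condition into one of the two summands of `doubleForm_inr_inl_inr_inl`. -/
theorem pair₂_leftAct_coproduct (hM : IsManinOp 𝒜 s m (dualOp 𝒜 D) M)
    (hN : IsManinOp 𝒜 s' m' (dualOp 𝒜 D') N)
    (ha : a ∈ dualGrading 𝒜 i) (hb : b ∈ dualGrading 𝒜 j) (hx : x ∈ 𝒜 k) (y : A) :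
    pair₂ a b (leftAct m x (D' y)) = koszulSign K (i + k) j *
      (M (0, a) (x, 0)).2 (N (0, b) (y, 0)).1 := by
  have h1 := (hM.even _ _ _ (inr_mem ha) _ (inl_mem hx)).2
  rw [pair₂_leftAct, ← hM.snd_inr_inl, pair₂_coproduct D' h1 hb, hN.apply_inr_inl]

/-- Here the transformed functional is the second factor of the dual operation; symmetry of N moves
it to the first, which costs the factor s'. -/
theorem pair₂_rightAct_coproduct (hM : IsManinOp 𝒜 s m (dualOp 𝒜 D) M)
    (hN : IsManinOp 𝒜 s' m' (dualOp 𝒜 D') N)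
    (ha : a ∈ dualGrading 𝒜 i) (hb : b ∈ dualGrading 𝒜 j) (hx : x ∈ 𝒜 k) (y : A) :
    pair₂ a b (rightAct 𝒜 m x (D' y)) = s' * koszulSign K k i *
      (M (0, b) (x, 0)).2 (N (0, a) (y, 0)).1 := by
  have h1 := (hM.even _ _ _ (inr_mem hb) _ (inl_mem hx)).2
  have h2 := hN.symm _ _ _ (inr_mem ha) _ (inr_mem h1)
  rw [hN.inr, hN.inr] at h2
  have h3 : dualOp 𝒜 D' a (M (0, b) (x, 0)).2 =
    (s' * koszulSign K i (j + k)) • dualOp 𝒜 D' (M (0, b) (x, 0)).2 a := congrArg Prod.snd h2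
  rw [pair₂_rightAct m b hx ha, ← hM.snd_inr_inl, pair₂_coproduct D' ha h1, h3,
    LinearMap.smul_apply, hN.apply_inr_inl, smul_eq_mul]
  linear_combination (koszulSign K k i * s' * (M (0, b) (x, 0)).2 (N (0, a) (y, 0)).1) *
    koszulSign_mul_self K i (j + k)

/-- The cocycle condition evaluated at a ⊗ b: its four terms are the components of the two forms on
the right. Read on the double, it is the Jacobi identity with two arguments in A and two in A*. -/
theorem form_compat_lie {br : A →ₗ[K] A →ₗ[K] A} {δ : A →ₗ[K] A ⊗[K] A}
    (h : IsLieSuperbialgebra 𝒜 br δ) (hM : IsManinOp 𝒜 (-1) br (dualOp 𝒜 δ) M)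
    (ha : a ∈ dualGrading 𝒜 i) (hb : b ∈ dualGrading 𝒜 j) (hx : x ∈ 𝒜 k) (hy : y ∈ 𝒜 l) :
    doubleForm 𝒜 (M (0, a) (0, b)) (M (x, 0) (y, 0)) =
      koszulSign K k j * doubleForm 𝒜 (M (0, a) (x, 0)) (M (0, b) (y, 0)) -
      koszulSign K i j * koszulSign K k i *
        doubleForm 𝒜 (M (0, b) (x, 0)) (M (0, a) (y, 0)) := by
  have e : doubleForm 𝒜 (M (0, a) (0, b)) (M (x, 0) (y, 0)) =
      koszulSign K i j * pair₂ a b (δ (br x y)) := by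
    rw [hM.inl, hM.inr, doubleForm_apply, dualOp_apply δ ha hb]
    simp
  rw [e, h.compat _ _ _ hx _ hy, doubleForm_inr_inl_inr_inl hM hM ha hb hx hy,
    doubleForm_inr_inl_inr_inl hM hM hb ha hx hy]
  simp only [map_sub, map_smul, LinearMap.add_apply, map_add,
    pair₂_leftAct_coproduct hM hM ha hb hx, pair₂_leftAct_coproduct hM hM ha hb hy,
    pair₂_rightAct_coproduct hM hM ha hb hx, pair₂_rightAct_coproduct hM hM ha hb hy, smul_eq_mul,
    koszulSign_add_left, koszulSign_add_right]
  rcases parity_cases i with rfl | rfl <;> rcases parity_cases j with rfl | rfl <;>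
    rcases parity_cases k with rfl | rfl <;> rcases parity_cases l with rfl | rfl <;>
    simp only [koszulSign_zero_left, koszulSign_zero_right, koszulSign_one_one] <;> ring

theorem form_compat_mul {mul : A →ₗ[K] A →ₗ[K] A} {Δ : A →ₗ[K] A ⊗[K] A}
    (hc : IsCommAssociativeSuperalgebra 𝒜 mul)
    (h : IsInfinitesimalSuperbialgebra 𝒜 mul Δ) (hM : IsManinOp 𝒜 1 mul (dualOp 𝒜 Δ) M)
    (ha : a ∈ dualGrading 𝒜 i) (hb : b ∈ dualGrading 𝒜 j) (hx : x ∈ 𝒜 k) (hy : y ∈ 𝒜 l) :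
    doubleForm 𝒜 (M (0, a) (0, b)) (M (x, 0) (y, 0)) =
      koszulSign K k j * doubleForm 𝒜 (M (0, a) (x, 0)) (M (0, b) (y, 0)) := by
  have e : doubleForm 𝒜 (M (0, a) (0, b)) (M (x, 0) (y, 0)) =
      koszulSign K i j * pair₂ a b (Δ (mul x y)) := by
    rw [hM.inl, hM.inr, doubleForm_apply, dualOp_apply Δ ha hb]
    simp
  -- The functional b sees yz only when z has parity j + l, so right and left multiplication by y
  -- differ by a fixed sign.
  have h1 : b ∘ₗ mul.flip y = koszulSign K l (j + l) • (b ∘ₗ mul y) := by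
    refine hom_ext (𝒜 := 𝒜) fun n z hz => ?_
    rw [LinearMap.comp_apply, LinearMap.flip_apply, hc.comm _ _ _ hz _ hy, map_smul,
      LinearMap.smul_apply, LinearMap.comp_apply]
    by_cases hn : j = l + n
    · have : j + l = n := by
        rw [hn]; exact (show ∀ l n : ZMod 2, l + n + l = n by decide) l n
      rw [this, koszulSign_comm]
    · rw [dual_apply_eq_zero hb (hc.even _ _ _ hy _ hz) hn, smul_zero, smul_zero]
  have h2 : pair₂ a b ((mul.flip y).lTensor A (Δ x)) =
      koszulSign K l (j + l) * (M (0, b) (y, 0)).2 (M (0, a) (x, 0)).1 := by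
    have h3 := pair₂_rightAct_coproduct hM hM ha hb hy x
    rw [pair₂_rightAct mul b hy ha] at h3
    rw [pair₂_lTensor, h1, map_smul, LinearMap.smul_apply, smul_eq_mul]
    congr 1
    refine mul_left_cancel₀ (koszulSign_ne_zero K l i) ?_
    rw [h3, one_mul]
  rw [e, h.compat, doubleForm_inr_inl_inr_inl hM hM ha hb hx hy, map_add, h2,
    pair₂_leftAct_coproduct hM hM ha hb hx]
  -- The two signs of this term agree only if i + k = j + l; otherwise the term vanishes.
  have h4 : i + k ≠ j + l → (M (0, b) (y, 0)).2 (M (0, a) (x, 0)).1 = 0 := fun h =>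
    dual_apply_eq_zero (hM.even _ _ _ (inr_mem hb) _ (inl_mem hy)).2
      (hM.even _ _ _ (inr_mem ha) _ (inl_mem hx)).1 h.symm
  generalize (M (0, b) (y, 0)).2 (M (0, a) (x, 0)).1 = X at h4
  clear h1 h2 e
  simp only [koszulSign_add_left, koszulSign_add_right]
  rcases parity_cases i with rfl | rfl <;> rcases parity_cases j with rfl | rfl <;>
    rcases parity_cases k with rfl | rfl <;> rcases parity_cases l with rfl | rfl <;>
    simp at h4 ⊢ <;> first | ring1 | simp [h4]

variable {br mul : A →ₗ[K] A →ₗ[K] A} {δ Δ : A →ₗ[K] A ⊗[K] A}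

theorem form_compat_bracket_mul (h : IsPoissonSuperbialgebra 𝒜 br mul δ Δ)
    (hM : IsManinOp 𝒜 (-1) br (dualOp 𝒜 δ) M) (hN : IsManinOp 𝒜 1 mul (dualOp 𝒜 Δ) N)
    (ha : a ∈ dualGrading 𝒜 i) (hb : b ∈ dualGrading 𝒜 j) (hx : x ∈ 𝒜 k) (hy : y ∈ 𝒜 l) :
    doubleForm 𝒜 (M (0, a) (0, b)) (N (x, 0) (y, 0)) =
      koszulSign K k j * doubleForm 𝒜 (N (0, a) (x, 0)) (M (0, b) (y, 0)) +
      koszulSign K k l * koszulSign K l j *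
        doubleForm 𝒜 (N (0, a) (y, 0)) (M (0, b) (x, 0)) := by
  have e : doubleForm 𝒜 (M (0, a) (0, b)) (N (x, 0) (y, 0)) =
      koszulSign K i j * pair₂ a b (δ (mul x y)) := by
    rw [hN.inl, hM.inr, doubleForm_apply, dualOp_apply δ ha hb]
    simp
  rw [e, h.compat_mul _ _ _ hx _ hy, doubleForm_inr_inl_inr_inl hN hM ha hb hx hy,
    doubleForm_inr_inl_inr_inl hN hM ha hb hy hx]
  simp only [map_smul, map_add,
    pair₂_leftAct_coproduct hN hM ha hb hx, pair₂_leftAct_coproduct hN hM ha hb hy,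
    pair₂_rightAct_coproduct hM hN ha hb hx, pair₂_rightAct_coproduct hM hN ha hb hy, smul_eq_mul,
    koszulSign_add_left, koszulSign_add_right]
  rcases parity_cases i with rfl | rfl <;> rcases parity_cases j with rfl | rfl <;>
    rcases parity_cases k with rfl | rfl <;> rcases parity_cases l with rfl | rfl <;>
    simp only [koszulSign_zero_left, koszulSign_zero_right, koszulSign_one_one] <;> ring

theorem form_compat_mul_bracket (h : IsPoissonSuperbialgebra 𝒜 br mul δ Δ)
    (hM : IsManinOp 𝒜 (-1) br (dualOp 𝒜 δ) M) (hN : IsManinOp 𝒜 1 mul (dualOp 𝒜 Δ) N)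
    (ha : a ∈ dualGrading 𝒜 i) (hb : b ∈ dualGrading 𝒜 j) (hx : x ∈ 𝒜 k) (hy : y ∈ 𝒜 l) :
    doubleForm 𝒜 (N (0, a) (0, b)) (M (x, 0) (y, 0)) =
      koszulSign K k j * doubleForm 𝒜 (M (0, a) (x, 0)) (N (0, b) (y, 0)) +
      koszulSign K i j * koszulSign K k i *
        doubleForm 𝒜 (M (0, b) (x, 0)) (N (0, a) (y, 0)) := by
  have e : doubleForm 𝒜 (N (0, a) (0, b)) (M (x, 0) (y, 0)) =
      koszulSign K i j * pair₂ a b (Δ (br x y)) := by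
    rw [hM.inl, hN.inr, doubleForm_apply, dualOp_apply Δ ha hb]
    simp
  rw [e, h.compat_bracket _ _ _ hx _ hy, doubleForm_inr_inl_inr_inl hM hN ha hb hx hy,
    doubleForm_inr_inl_inr_inl hM hN hb ha hx hy]
  simp only [map_smul, map_add, map_sub, LinearMap.add_apply, LinearMap.sub_apply,
    pair₂_leftAct_coproduct hM hN ha hb hx, pair₂_leftAct_coproduct hN hM ha hb hy,
    pair₂_rightAct_coproduct hM hN ha hb hx, pair₂_rightAct_coproduct hN hM ha hb hy, smul_eq_mul,
    koszulSign_add_left, koszulSign_add_right]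
  rcases parity_cases i with rfl | rfl <;> rcases parity_cases j with rfl | rfl <;>
    rcases parity_cases k with rfl | rfl <;> rcases parity_cases l with rfl | rfl <;>
    simp only [koszulSign_zero_left, koszulSign_zero_right, koszulSign_one_one] <;> ring

end Mixed

/-! ## The double is a Poisson superalgebra -/

section DoubleInduction

variable {K A : Type*} [Field K] [AddCommGroup A] [Module K A]
  {𝒜 : ZMod 2 → Submodule K A}

/-- The inclusion of `A` into `A ⊕ A*` on homogeneous elements. -/
def homInl {i : ZMod 2} (x : 𝒜 i) : doubleGrading 𝒜 i := ⟨(x, 0), inl_mem x.2⟩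

/-- The inclusion of `A*` into `A ⊕ A*` on homogeneous elements. -/
def homInr {i : ZMod 2} (a : dualGrading 𝒜 i) : doubleGrading 𝒜 i := ⟨(0, a), inr_mem a.2⟩

theorem exists_homInl_add_homInr {i : ZMod 2} (u : doubleGrading 𝒜 i) :
    ∃ (x : 𝒜 i) (a : dualGrading 𝒜 i), u = homInl x + homInr a :=
  ⟨⟨_, u.2.1⟩, ⟨_, u.2.2⟩, Subtype.ext (Prod.ext (add_zero _).symm (zero_add _).symm)⟩

/-- An additive property stable under permuting its arguments, and their parities with them, need
only be checked when the arguments from A precede those from A*. -/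
theorem double_induction₃
    {P : ∀ j k l, doubleGrading 𝒜 j → doubleGrading 𝒜 k → doubleGrading 𝒜 l → Prop}
    (add : ∀ {j k l} (u u' : doubleGrading 𝒜 j) (v : doubleGrading 𝒜 k)
      (w : doubleGrading 𝒜 l), P _ _ _ u v w → P _ _ _ u' v w → P _ _ _ (u + u') v w)
    (swap₁₂ : ∀ {j k l} (u : doubleGrading 𝒜 j) (v : doubleGrading 𝒜 k)
      (w : doubleGrading 𝒜 l), P _ _ _ u v w → P _ _ _ v u w)
    (swap₂₃ : ∀ {j k l} (u : doubleGrading 𝒜 j) (v : doubleGrading 𝒜 k)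
      (w : doubleGrading 𝒜 l), P _ _ _ u v w → P _ _ _ u w v)
    (h₀ : ∀ {j k l} (x : 𝒜 j) (y : 𝒜 k) (z : 𝒜 l), P _ _ _ (homInl x) (homInl y) (homInl z))
    (h₁ : ∀ {j k l} (x : 𝒜 j) (y : 𝒜 k) (a : dualGrading 𝒜 l),
      P _ _ _ (homInl x) (homInl y) (homInr a))
    (h₂ : ∀ {j k l} (x : 𝒜 j) (a : dualGrading 𝒜 k) (b : dualGrading 𝒜 l),
      P _ _ _ (homInl x) (homInr a) (homInr b))
    (h₃ : ∀ {j k l} (a : dualGrading 𝒜 j) (b : dualGrading 𝒜 k) (c : dualGrading 𝒜 l),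
      P _ _ _ (homInr a) (homInr b) (homInr c))
    {j k l : ZMod 2} (u : doubleGrading 𝒜 j) (v : doubleGrading 𝒜 k) (w : doubleGrading 𝒜 l) :
    P _ _ _ u v w := by
  have add₂ : ∀ {j k l} (u : doubleGrading 𝒜 j) (v v' : doubleGrading 𝒜 k)
      (w : doubleGrading 𝒜 l), P _ _ _ u v w → P _ _ _ u v' w → P _ _ _ u (v + v') w :=
    fun u v v' w h h' =>
    swap₁₂ _ _ _ (add _ _ _ _ (swap₁₂ _ _ _ h) (swap₁₂ _ _ _ h'))
  have add₃ : ∀ {j k l} (u : doubleGrading 𝒜 j) (v : doubleGrading 𝒜 k)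
      (w w' : doubleGrading 𝒜 l), P _ _ _ u v w → P _ _ _ u v w' → P _ _ _ u v (w + w') :=
    fun u v w w' h h' =>
    swap₂₃ _ _ _ (add₂ _ _ _ _ (swap₂₃ _ _ _ h) (swap₂₃ _ _ _ h'))
  obtain ⟨x, a, rfl⟩ := exists_homInl_add_homInr u
  obtain ⟨y, b, rfl⟩ := exists_homInl_add_homInr v
  obtain ⟨z, c, rfl⟩ := exists_homInl_add_homInr w
  refine add _ _ _ _ (add₂ _ _ _ _ (add₃ _ _ _ _ (h₀ x y z) (h₁ x y c))
    (add₃ _ _ _ _ (swap₂₃ _ _ _ (h₁ x z b)) (h₂ x b c)))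
    (add₂ _ _ _ _ (add₃ _ _ _ _ (swap₁₂ _ _ _ (swap₂₃ _ _ _ (h₁ y z a)))
      (swap₁₂ _ _ _ (h₂ y a c)))
    (add₃ _ _ _ _ (swap₂₃ _ _ _ (swap₁₂ _ _ _ (h₂ z a b))) (h₃ a b c)))

/-- Among four arguments three lie in A, or three in A*, or there are two of each; in the first two
cases the fourth may stay arbitrary. -/
theorem double_induction₄
    {P : ∀ i j k l, doubleGrading 𝒜 i → doubleGrading 𝒜 j → doubleGrading 𝒜 k →
      doubleGrading 𝒜 l → Prop}
    (add : ∀ {i j k l} (u u' : doubleGrading 𝒜 i) (v : doubleGrading 𝒜 j)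
      (w : doubleGrading 𝒜 k) (t : doubleGrading 𝒜 l), P _ _ _ _ u v w t →
      P _ _ _ _ u' v w t → P _ _ _ _ (u + u') v w t)
    (swap₁₂ : ∀ {i j k l} (u : doubleGrading 𝒜 i) (v : doubleGrading 𝒜 j)
      (w : doubleGrading 𝒜 k) (t : doubleGrading 𝒜 l), P _ _ _ _ u v w t → P _ _ _ _ v u w t)
    (swap₂₃ : ∀ {i j k l} (u : doubleGrading 𝒜 i) (v : doubleGrading 𝒜 j)
      (w : doubleGrading 𝒜 k) (t : doubleGrading 𝒜 l), P _ _ _ _ u v w t → P _ _ _ _ u w v t)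
    (swap₃₄ : ∀ {i j k l} (u : doubleGrading 𝒜 i) (v : doubleGrading 𝒜 j)
      (w : doubleGrading 𝒜 k) (t : doubleGrading 𝒜 l), P _ _ _ _ u v w t → P _ _ _ _ u v t w)
    (h₀ : ∀ {i j k l} (x : 𝒜 i) (y : 𝒜 j) (z : 𝒜 k) (t : doubleGrading 𝒜 l),
      P _ _ _ _ (homInl x) (homInl y) (homInl z) t)
    (h₁ : ∀ {i j k l} (a : dualGrading 𝒜 i) (b : dualGrading 𝒜 j) (c : dualGrading 𝒜 k)
      (t : doubleGrading 𝒜 l), P _ _ _ _ (homInr a) (homInr b) (homInr c) t)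
    (h₂ : ∀ {i j k l} (a : dualGrading 𝒜 i) (b : dualGrading 𝒜 j) (x : 𝒜 k) (y : 𝒜 l),
      P _ _ _ _ (homInr a) (homInr b) (homInl x) (homInl y))
    {i j k l : ZMod 2} (u : doubleGrading 𝒜 i) (v : doubleGrading 𝒜 j) (w : doubleGrading 𝒜 k)
    (t : doubleGrading 𝒜 l) : P _ _ _ _ u v w t := by
  have add₂ : ∀ {i j k l} (u : doubleGrading 𝒜 i) (v v' : doubleGrading 𝒜 j)
      (w : doubleGrading 𝒜 k) (t : doubleGrading 𝒜 l), P _ _ _ _ u v w t → P _ _ _ _ u v' w t →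
      P _ _ _ _ u (v + v') w t := fun u v v' w t h h' =>
    swap₁₂ _ _ _ _ (add _ _ _ _ _ (swap₁₂ _ _ _ _ h) (swap₁₂ _ _ _ _ h'))
  obtain ⟨x, a, rfl⟩ := exists_homInl_add_homInr u
  refine add _ _ _ _ _ ?_ ?_
  · refine double_induction₃ (P := fun j k l v w t => P _ j k l (homInl x) v w t)
      (add₂ _) (swap₂₃ _)
      (swap₃₄ _) (fun y z t => h₀ _ _ _ _) (fun y z a => h₀ _ _ _ _) (fun y a b => ?_)
      (fun a b c => ?_) v w t
    · exact swap₂₃ _ _ _ _ (swap₁₂ _ _ _ _ (swap₃₄ _ _ _ _ (swap₂₃ _ _ _ _ (h₂ a b x y))))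
    · exact swap₁₂ _ _ _ _ (swap₂₃ _ _ _ _ (swap₃₄ _ _ _ _ (h₁ a b c (homInl x))))
  · refine double_induction₃ (P := fun j k l v w t => P _ j k l (homInr a) v w t)
      (add₂ _) (swap₂₃ _)
      (swap₃₄ _) (fun y z t => ?_) (fun y z b => ?_) (fun y b c => ?_)
      (fun _ _ _ => h₁ _ _ _ _) v w t
    · exact swap₁₂ _ _ _ _ (swap₂₃ _ _ _ _ (swap₃₄ _ _ _ _ (h₀ y z t (homInr a))))
    · exact swap₃₄ _ _ _ _ (swap₂₃ _ _ _ _ (h₂ a b y z))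
    · exact swap₂₃ _ _ _ _ (swap₃₄ _ _ _ _ (h₁ a b c (homInl y)))

end DoubleInduction

/-! ### The Jacobi, associativity and Leibniz identities on the double. -/

section DoublePoisson

variable {K A : Type*} [Field K] [AddCommGroup A] [Module K A] [FiniteDimensional K A]
  {𝒜 : ZMod 2 → Submodule K A} [DirectSum.Decomposition 𝒜]
  {br mul : A →ₗ[K] A →ₗ[K] A} {δ Δ : A →ₗ[K] A ⊗[K] A} {s s' : K}
  {m m' : A →ₗ[K] A →ₗ[K] A}
  {n n' : Module.Dual K A →ₗ[K] Module.Dual K A →ₗ[K] Module.Dual K A}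
  {M N : A × Module.Dual K A →ₗ[K] A × Module.Dual K A →ₗ[K] A × Module.Dual K A}
  {i j k l : ZMod 2} {u v w t : A × Module.Dual K A}

theorem IsManinOp.form_swap_left (hM : IsManinOp 𝒜 s m n M) (hu : u ∈ doubleGrading 𝒜 i)
    (hv : v ∈ doubleGrading 𝒜 j) (X : A × Module.Dual K A) :
    doubleForm 𝒜 (M u v) X = s * koszulSign K i j * doubleForm 𝒜 (M v u) X := by
  rw [hM.symm _ _ _ hu _ hv, map_smul]; rfl

theorem IsManinOp.form_swap_right (hM : IsManinOp 𝒜 s m n M) (hu : u ∈ doubleGrading 𝒜 i)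
    (hv : v ∈ doubleGrading 𝒜 j) (X : A × Module.Dual K A) :
    doubleForm 𝒜 X (M u v) = s * koszulSign K i j * doubleForm 𝒜 X (M v u) := by
  rw [hM.symm _ _ _ hu _ hv, map_smul]; rfl

theorem IsManinOp.form_swap (hM : IsManinOp 𝒜 s m n M) (hN : IsManinOp 𝒜 s' m' n' N)
    (hu : u ∈ doubleGrading 𝒜 i)
    (hv : v ∈ doubleGrading 𝒜 j) (hw : w ∈ doubleGrading 𝒜 k) (ht : t ∈ doubleGrading 𝒜 l) :
    doubleForm 𝒜 (M u v) (N w t) =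
      koszulSign K i k * koszulSign K i l * (koszulSign K j k * koszulSign K j l) *
        doubleForm 𝒜 (N w t) (M u v) := by
  rw [doubleForm_comm (hM.even _ _ _ hu _ hv) (hN.even _ _ _ hw _ ht)]
  simp only [koszulSign_add_left, koszulSign_add_right]
  ring

theorem doubleBracket_isLie (h : IsLieSuperbialgebra 𝒜 br δ)
    (hM : IsManinOp 𝒜 (-1) br (dualOp 𝒜 δ) M) : IsLieSuperalgebra (doubleGrading 𝒜) M := by
  have hd := h.coalg.dual
  -- By invariance ⟨M(M(u, v), w), t⟩ = ⟨M(u, v), M(w, t)⟩, so this is the left-nested Jacobi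
  -- identity paired with t. In this shape it is stable under all permutations of u, v, w, t.
  have key : ∀ i j k l (u : doubleGrading 𝒜 i) (v : doubleGrading 𝒜 j) (w : doubleGrading 𝒜 k)
      (t : doubleGrading 𝒜 l), doubleForm 𝒜 (M u v) (M w t) +
        koszulSign K i (j + k) * doubleForm 𝒜 (M v w) (M u t) +
        koszulSign K k (i + j) * doubleForm 𝒜 (M w u) (M v t) = 0 := by
    intro i j k l u v w t
    refine double_induction₄ (P := fun i j k l (u : doubleGrading 𝒜 i) (v : doubleGrading 𝒜 j)
        (w : doubleGrading 𝒜 k) (t : doubleGrading 𝒜 l) => doubleForm 𝒜 (M u v) (M w t) +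
        koszulSign K i (j + k) * doubleForm 𝒜 (M v w) (M u t) +
        koszulSign K k (i + j) * doubleForm 𝒜 (M w u) (M v t) = 0) ?_ ?_ ?_ ?_ ?_ ?_ ?_ u v w t <;>
        clear u v w t i j k l
    · intro i j k l u u' v w t h h'
      simp only [Submodule.coe_add, map_add, LinearMap.add_apply]
      linear_combination h + h'
    · intro i j k l u v w t h
      rw [hM.form_swap_left v.2 u.2, hM.form_swap_left u.2 w.2, hM.form_swap_left w.2 v.2]
      simp only [koszulSign_add_right] at h ⊢
      generalize doubleForm 𝒜 (M u v) (M w t) = X at h ⊢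
      generalize doubleForm 𝒜 (M v w) (M u t) = Y at h ⊢
      generalize doubleForm 𝒜 (M w u) (M v t) = Z at h ⊢
      clear u v w t
      rcases parity_cases i with rfl | rfl <;> rcases parity_cases j with rfl | rfl <;>
        rcases parity_cases k with rfl | rfl <;>
        simp only [koszulSign_zero_left, koszulSign_zero_right, koszulSign_one_one] at h ⊢ <;>
        first | linear_combination h | linear_combination -h
    · intro i j k l u v w t h
      rw [hM.form_swap_left v.2 u.2, hM.form_swap_left u.2 w.2, hM.form_swap_left w.2 v.2]
      simp only [koszulSign_add_right] at h ⊢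
      generalize doubleForm 𝒜 (M u v) (M w t) = X at h ⊢
      generalize doubleForm 𝒜 (M v w) (M u t) = Y at h ⊢
      generalize doubleForm 𝒜 (M w u) (M v t) = Z at h ⊢
      clear u v w t
      rcases parity_cases i with rfl | rfl <;> rcases parity_cases j with rfl | rfl <;>
        rcases parity_cases k with rfl | rfl <;>
        simp only [koszulSign_zero_left, koszulSign_zero_right, koszulSign_one_one] at h ⊢ <;>
        first | linear_combination h | linear_combination -h
    · intro i j k l u v w t h
      rw [hM.form_swap_right t.2 w.2, hM.form_swap hM v.2 t.2 u.2 w.2,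
        hM.form_swap_left u.2 w.2, hM.form_swap hM t.2 u.2 v.2 w.2, hM.form_swap_right t.2 u.2]
      simp only [koszulSign_add_right] at h ⊢
      generalize doubleForm 𝒜 (M u v) (M w t) = X at h ⊢
      generalize doubleForm 𝒜 (M v w) (M u t) = Y at h ⊢
      generalize doubleForm 𝒜 (M w u) (M v t) = Z at h ⊢
      clear u v w t
      rcases parity_cases i with rfl | rfl <;> rcases parity_cases j with rfl | rfl <;>
        rcases parity_cases k with rfl | rfl <;> rcases parity_cases l with rfl | rfl <;>
        simp only [koszulSign_zero_left, koszulSign_zero_right, koszulSign_one_one] at h ⊢ <;>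
        first | linear_combination h | linear_combination -h
    · intro i j k l x y z t
      have e := h.alg.jacobi_left x.2 y.2 z.2
      have e' : doubleForm 𝒜 ((br (br x y) z + koszulSign K i (j + k) • br (br y z) x +
        koszulSign K k (i + j) • br (br z x) y, 0) : A × Module.Dual K A) t = 0 := by
        rw [e]; exact LinearMap.congr_fun (map_zero (doubleForm 𝒜)) _
      simp only [homInl, ← hM.inv, hM.inl]
      simpa [doubleForm_apply] using e'
    · intro i j k l a b c t
      have e := hd.jacobi_left a.2 b.2 c.2
      have e' : doubleForm 𝒜 ((0, dualOp 𝒜 δ (dualOp 𝒜 δ a b) c +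
        koszulSign K i (j + k) • dualOp 𝒜 δ (dualOp 𝒜 δ b c) a +
        koszulSign K k (i + j) • dualOp 𝒜 δ (dualOp 𝒜 δ c a) b) : A × Module.Dual K A) t = 0 := by
        rw [e]; exact LinearMap.congr_fun (map_zero (doubleForm 𝒜)) _
      simp only [homInr, ← hM.inv, hM.inr]
      simpa [doubleForm_apply] using e'
    · intro i j k l a b x y
      have e := form_compat_lie h hM a.2 b.2 x.2 y.2
      rw [hM.form_swap_left (homInl x).2 (homInr a).2]
      simp only [homInl, homInr, koszulSign_add_right] at e ⊢
      rw [e]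
      generalize doubleForm 𝒜 (M (0, a) (x, 0)) (M (0, b) (y, 0)) = X
      generalize doubleForm 𝒜 (M (0, b) (x, 0)) (M (0, a) (y, 0)) = Y
      clear e
      rcases parity_cases i with rfl | rfl <;> rcases parity_cases j with rfl | rfl <;>
        rcases parity_cases k with rfl | rfl <;>
        simp only [koszulSign_zero_left, koszulSign_zero_right, koszulSign_one_one] <;> ring
  refine .of_jacobi_left hM.even (fun i j u hu v hv => ?_) fun i j k u hu v hv w hw => ?_
  · rw [hM.symm _ _ _ hu _ hv]; simp
  · have e1 := hM.even _ _ _ (hM.even _ _ _ hu _ hv) _ hw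
    have e2 := hM.even _ _ _ (hM.even _ _ _ hv _ hw) _ hu
    have e3 := hM.even _ _ _ (hM.even _ _ _ hw _ hu) _ hv
    rw [show j + k + i = i + j + k by ring] at e2
    rw [show k + i + j = i + j + k by ring] at e3
    refine eq_of_doubleForm (Submodule.add_mem _ (Submodule.add_mem _ e1
      (Submodule.smul_mem _ _ e2)) (Submodule.smul_mem _ _ e3)) (Submodule.zero_mem _)
      fun t ht => ?_
    simp only [map_add, map_smul, LinearMap.add_apply, LinearMap.smul_apply, hM.inv _ _ t,
      map_zero, LinearMap.zero_apply, smul_eq_mul]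
    exact key _ _ _ _ ⟨u, hu⟩ ⟨v, hv⟩ ⟨w, hw⟩ ⟨t, ht⟩

/-- Four elements split into two pairs in three ways, and all three forms agree up to Koszul signs.
Associativity is just one of these equalities, but permuting the arguments mixes them, so both are
carried through the induction. -/
theorem doubleMul_isCommAssociative (hc : IsCommAssociativeSuperalgebra 𝒜 mul)
    (hd : IsCommAssociativeSuperalgebra (dualGrading 𝒜) (dualOp 𝒜 Δ))
    (h : IsInfinitesimalSuperbialgebra 𝒜 mul Δ)
    (hM : IsManinOp 𝒜 1 mul (dualOp 𝒜 Δ) M) :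
    IsCommAssociativeSuperalgebra (doubleGrading 𝒜) M := by
  have key : ∀ i j k l (u : doubleGrading 𝒜 i) (v : doubleGrading 𝒜 j) (w : doubleGrading 𝒜 k)
      (t : doubleGrading 𝒜 l),
      doubleForm 𝒜 (M u v) (M w t) = koszulSign K j k * doubleForm 𝒜 (M u w) (M v t) ∧
      doubleForm 𝒜 (M u v) (M w t) = koszulSign K l (j + k) * doubleForm 𝒜 (M u t) (M v w) := by
    intro i j k l u v w t
    refine double_induction₄ (P := fun i j k l (u : doubleGrading 𝒜 i) (v : doubleGrading 𝒜 j)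
        (w : doubleGrading 𝒜 k) (t : doubleGrading 𝒜 l) =>
      doubleForm 𝒜 (M u v) (M w t) = koszulSign K j k * doubleForm 𝒜 (M u w) (M v t) ∧
      doubleForm 𝒜 (M u v) (M w t) = koszulSign K l (j + k) * doubleForm 𝒜 (M u t) (M v w))
      ?_ ?_ ?_ ?_ ?_ ?_ ?_ u v w t <;> clear u v w t i j k l
    · intro i j k l u u' v w t h h'
      simp only [Submodule.coe_add, map_add, LinearMap.add_apply]
      exact ⟨by linear_combination h.1 + h'.1, by linear_combination h.2 + h'.2⟩
    · intro i j k l u v w t h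
      rw [hM.form_swap_left v.2 u.2, hM.form_swap hM v.2 w.2 u.2 t.2,
        hM.form_swap hM v.2 t.2 u.2 w.2]
      simp only [koszulSign_add_right] at h ⊢
      generalize doubleForm 𝒜 (M u v) (M w t) = X at h ⊢
      generalize doubleForm 𝒜 (M u w) (M v t) = Y at h ⊢
      generalize doubleForm 𝒜 (M u t) (M v w) = Z at h ⊢
      clear u v w t
      rcases parity_cases i with rfl | rfl <;> rcases parity_cases j with rfl | rfl <;>
        rcases parity_cases k with rfl | rfl <;> rcases parity_cases l with rfl | rfl <;>
        simp at h ⊢ <;> grind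
    · intro i j k l u v w t h
      simp only [koszulSign_add_right] at h ⊢
      generalize doubleForm 𝒜 (M u v) (M w t) = X at h ⊢
      generalize doubleForm 𝒜 (M u w) (M v t) = Y at h ⊢
      rw [hM.form_swap_right w.2 v.2]
      generalize doubleForm 𝒜 (M u t) (M v w) = Z at h ⊢
      clear u v w t
      rcases parity_cases i with rfl | rfl <;> rcases parity_cases j with rfl | rfl <;>
        rcases parity_cases k with rfl | rfl <;> rcases parity_cases l with rfl | rfl <;>
        simp at h ⊢ <;> grind
    · intro i j k l u v w t h
      rw [hM.form_swap_right t.2 w.2]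
      simp only [koszulSign_add_right] at h ⊢
      generalize doubleForm 𝒜 (M u v) (M w t) = X at h ⊢
      generalize doubleForm 𝒜 (M u w) (M v t) = Y at h ⊢
      generalize doubleForm 𝒜 (M u t) (M v w) = Z at h ⊢
      clear u v w t
      rcases parity_cases i with rfl | rfl <;> rcases parity_cases j with rfl | rfl <;>
        rcases parity_cases k with rfl | rfl <;> rcases parity_cases l with rfl | rfl <;>
        simp at h ⊢ <;> grind
    · intro i j k l x y z t
      rw [hM.form_swap hM (homInl x).2 t.2 (homInl y).2 (homInl z).2]
      simp only [homInl, ← hM.inv, hM.inl]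
      have e1 : doubleForm 𝒜 (mul (mul x y) z, 0) t =
          koszulSign K j k * doubleForm 𝒜 (mul (mul x z) y, 0) t := by
        rw [hc.mul_right_comm x y.2 z.2]; simp [doubleForm_apply]
      have e2 : doubleForm 𝒜 (mul (mul x y) z, 0) t =
          koszulSign K i (j + k) * doubleForm 𝒜 (mul (mul y z) x, 0) t := by
        rw [hc.mul_rotate x.2 y.2 z.2]; simp [doubleForm_apply]
      refine ⟨e1, e2.trans ?_⟩
      generalize doubleForm 𝒜 (mul (mul y z) x, 0) t = X
      clear e1 e2
      simp only [koszulSign_add_right]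
      rcases parity_cases i with rfl | rfl <;> rcases parity_cases j with rfl | rfl <;>
        rcases parity_cases k with rfl | rfl <;> rcases parity_cases l with rfl | rfl <;> simp
    · intro i j k l a b c t
      rw [hM.form_swap hM (homInr a).2 t.2 (homInr b).2 (homInr c).2]
      simp only [homInr, ← hM.inv, hM.inr]
      have e1 : doubleForm 𝒜 (0, dualOp 𝒜 Δ (dualOp 𝒜 Δ a b) c) t =
          koszulSign K j k * doubleForm 𝒜 (0, dualOp 𝒜 Δ (dualOp 𝒜 Δ a c) b) t := by
        rw [hd.mul_right_comm a b.2 c.2]; simp [doubleForm_apply]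
      have e2 : doubleForm 𝒜 (0, dualOp 𝒜 Δ (dualOp 𝒜 Δ a b) c) t =
          koszulSign K i (j + k) * doubleForm 𝒜 (0, dualOp 𝒜 Δ (dualOp 𝒜 Δ b c) a) t := by
        rw [hd.mul_rotate a.2 b.2 c.2]; simp [doubleForm_apply]
      refine ⟨e1, e2.trans ?_⟩
      generalize doubleForm 𝒜 (0, dualOp 𝒜 Δ (dualOp 𝒜 Δ b c) a) t = X
      clear e1 e2
      simp only [koszulSign_add_right]
      rcases parity_cases i with rfl | rfl <;> rcases parity_cases j with rfl | rfl <;>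
        rcases parity_cases k with rfl | rfl <;> rcases parity_cases l with rfl | rfl <;> simp
    -- One compatibility condition yields both equalities: the second is the condition with x and y
    -- exchanged.
    · intro i j k l a b x y
      have e1 := form_compat_mul hc h hM a.2 b.2 x.2 y.2
      have e2 := form_compat_mul hc h hM a.2 b.2 y.2 x.2
      have e3 := hM.form_swap_right (inl_mem x.2) (inl_mem y.2) (M (0, a) (0, b))
      have e4 := hM.form_swap_right (inr_mem b.2) (inl_mem x.2) (M (0, a) (y, 0))
      refine ⟨e1.trans (by rw [koszulSign_comm]; rfl), ?_⟩
      simp only [homInl, homInr]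
      rw [e3, e2, e4, koszulSign_add_right, koszulSign_comm K k l]
      ring
  refine ⟨⟨hM.even, fun u v w => ?_⟩, fun i j u hu v hv => ?_⟩
  · have : ∀ i j k, ∀ u ∈ doubleGrading 𝒜 i, ∀ v ∈ doubleGrading 𝒜 j, ∀ w ∈ doubleGrading 𝒜 k,
        M u (M v w) = M (M u v) w := by
      intro i j k u hu v hv w hw
      have e1 := hM.even _ _ _ (hM.even _ _ _ hu _ hv) _ hw
      have e2 := hM.even _ _ _ hu _ (hM.even _ _ _ hv _ hw)
      rw [← add_assoc] at e2
      refine eq_of_doubleForm e2 e1 fun t ht => ?_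
      -- Up to signs: ⟨(uv)w, t⟩ = ⟨uv, wt⟩ = ⟨ut, vw⟩ = ⟨u, t(vw)⟩ = ⟨u(vw), t⟩.
      rw [hM.inv _ w t, (key _ _ _ _ ⟨u, hu⟩ ⟨v, hv⟩ ⟨w, hw⟩ ⟨t, ht⟩).2, hM.inv u,
        hM.form_swap_right (hM.even _ _ _ hv _ hw) ht, ← hM.inv u, koszulSign_comm, one_mul]
    rw [← sum_superProj (doubleGrading 𝒜) u, ← sum_superProj (doubleGrading 𝒜) v,
      ← sum_superProj (doubleGrading 𝒜) w]
    simp only [map_sum, LinearMap.sum_apply]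
    exact Finset.sum_congr rfl fun k _ => Finset.sum_congr rfl fun j _ =>
      Finset.sum_congr rfl fun i _ => this _ _ _ _ (superProj_mem _ _ _) _
        (superProj_mem _ _ _) _ (superProj_mem _ _ _)
  · rw [hM.symm _ _ _ hu _ hv, one_mul]

variable (𝒜) in
/-- The form of the Leibniz identity which is symmetric in its last three arguments. -/
def leibnizForm (M N : A × Module.Dual K A →ₗ[K] A × Module.Dual K A →ₗ[K] A × Module.Dual K A)
    (j k l : ZMod 2) (u v w t : A × Module.Dual K A) : K :=
  doubleForm 𝒜 (M u v) (N w t) + koszulSign K j (k + l) * doubleForm 𝒜 (M u w) (N t v) +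
    koszulSign K l (j + k) * doubleForm 𝒜 (M u t) (N v w)

/-- The defect of the Leibniz identity paired with t: invariance moves t inside, and skewness of M
supplies the minus sign of the last term. -/
theorem leibnizForm_eq (hM : IsManinOp 𝒜 (-1) m n M) (hN : IsManinOp 𝒜 1 m' n' N)
    (hu : u ∈ doubleGrading 𝒜 i) (hv : v ∈ doubleGrading 𝒜 j) (hw : w ∈ doubleGrading 𝒜 k)
    (ht : t ∈ doubleGrading 𝒜 l) :
    leibnizForm 𝒜 M N j k l u v w t = doubleForm 𝒜 (N (M u v) w) t +
      koszulSign K i j * doubleForm 𝒜 (N v (M u w)) t - doubleForm 𝒜 (M u (N v w)) t := by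
  rw [leibnizForm, hN.inv (M u v), hN.form_swap_left hv (hM.even _ _ _ hu _ hw), hN.inv (M u w),
    hM.inv u (N v w), hM.form_swap_right (hN.even _ _ _ hv _ hw) ht, ← hM.inv u,
    hN.form_swap_right ht hv]
  generalize doubleForm 𝒜 (M u v) (N w t) = X
  generalize doubleForm 𝒜 (M u w) (N v t) = Y
  generalize doubleForm 𝒜 (M u t) (N v w) = Z
  simp only [koszulSign_add_right]
  clear hu hv hw ht
  rcases parity_cases i with rfl | rfl <;> rcases parity_cases j with rfl | rfl <;>
    rcases parity_cases k with rfl | rfl <;> rcases parity_cases l with rfl | rfl <;> simp <;> ring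

theorem leibnizForm_swap₁₂ (hN : IsManinOp 𝒜 1 m' n' N)
    (hv : v ∈ doubleGrading 𝒜 j) (hw : w ∈ doubleGrading 𝒜 k)
    (ht : t ∈ doubleGrading 𝒜 l) :
    leibnizForm 𝒜 M N k j l u w v t = koszulSign K j k * leibnizForm 𝒜 M N j k l u v w t := by
  rw [leibnizForm, leibnizForm, hN.form_swap_right hv ht, hN.form_swap_right ht hw,
    hN.form_swap_right hw hv]
  simp only [koszulSign_add_right]
  rw [koszulSign_comm K k j, koszulSign_comm K l k, koszulSign_comm K l j]
  linear_combination (koszulSign K j l * doubleForm 𝒜 (M u w) (N t v)) *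
    (-koszulSign_mul_self K j k) + (koszulSign K j k * doubleForm 𝒜 (M u v) (N w t)) *
    koszulSign_mul_self K k l

theorem leibnizForm_swap₂₃ (hN : IsManinOp 𝒜 1 m' n' N)
    (hv : v ∈ doubleGrading 𝒜 j) (hw : w ∈ doubleGrading 𝒜 k)
    (ht : t ∈ doubleGrading 𝒜 l) :
    leibnizForm 𝒜 M N j l k u v t w = koszulSign K k l * leibnizForm 𝒜 M N j k l u v w t := by
  rw [leibnizForm, leibnizForm, hN.form_swap_right ht hw, hN.form_swap_right hw hv,
    hN.form_swap_right hv ht]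
  simp only [koszulSign_add_right]
  generalize doubleForm 𝒜 (M u v) (N w t) = X
  generalize doubleForm 𝒜 (M u w) (N t v) = Y
  generalize doubleForm 𝒜 (M u t) (N v w) = Z
  clear hv hw ht
  rcases parity_cases j with rfl | rfl <;>
    rcases parity_cases k with rfl | rfl <;> rcases parity_cases l with rfl | rfl <;> simp <;> ring

theorem leibnizForm_eq_zero (h : IsPoissonSuperbialgebra 𝒜 br mul δ Δ)
    (hM : IsManinOp 𝒜 (-1) br (dualOp 𝒜 δ) M) (hN : IsManinOp 𝒜 1 mul (dualOp 𝒜 Δ) N)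
    (u : doubleGrading 𝒜 i) (v : doubleGrading 𝒜 j) (w : doubleGrading 𝒜 k)
    (t : doubleGrading 𝒜 l) : leibnizForm 𝒜 M N j k l u v w t = 0 := by
  have hd := h.coalg.dual
  -- Only v, w, t may be permuted, so the derivation argument u is kept aside and split into its two
  -- components at the end.
  have reduce : ∀ u : A × Module.Dual K A,
      (∀ {j k l} (x : 𝒜 j) (y : 𝒜 k) (z : 𝒜 l),
        leibnizForm 𝒜 M N j k l u (x, 0) (y, 0) (z, 0) = 0) →
      (∀ {j k l} (x : 𝒜 j) (y : 𝒜 k) (a : dualGrading 𝒜 l),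
        leibnizForm 𝒜 M N j k l u (x, 0) (y, 0) (0, a) = 0) →
      (∀ {j k l} (x : 𝒜 j) (a : dualGrading 𝒜 k) (b : dualGrading 𝒜 l),
        leibnizForm 𝒜 M N j k l u (x, 0) (0, a) (0, b) = 0) →
      (∀ {j k l} (a : dualGrading 𝒜 j) (b : dualGrading 𝒜 k) (c : dualGrading 𝒜 l),
        leibnizForm 𝒜 M N j k l u (0, a) (0, b) (0, c) = 0) →
      leibnizForm 𝒜 M N j k l u v w t = 0 := by
    intro u h₀ h₁ h₂ h₃
    refine double_induction₃ (P := fun j k l (v : doubleGrading 𝒜 j) (w : doubleGrading 𝒜 k)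
      (t : doubleGrading 𝒜 l) => leibnizForm 𝒜 M N j k l u v w t = 0) ?_ ?_ ?_ h₀ h₁ h₂ h₃ v w t
    · intro j k l v v' w t e e'
      rw [leibnizForm] at e e' ⊢
      simp only [Submodule.coe_add, map_add, LinearMap.add_apply]
      linear_combination e + e'
    · intro j k l v w t e
      rw [leibnizForm_swap₁₂ hN v.2 w.2 t.2, e, mul_zero]
    · intro j k l v w t e
      rw [leibnizForm_swap₂₃ hN v.2 w.2 t.2, e, mul_zero]
  -- When u and two more arguments lie in A this is the Leibniz rule of A; `hS` is its analogue on
  -- A*.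
  have hA : ∀ {i j k l} (x : 𝒜 i) (y : 𝒜 j) (z : 𝒜 k) (t : doubleGrading 𝒜 l),
      leibnizForm 𝒜 M N j k l (x, 0) (y, 0) (z, 0) t = 0 := by
    intro i j k l x y z t
    have e : doubleForm 𝒜 (br x (mul y z), 0) t = _ := congrArg
      (fun p => doubleForm 𝒜 (p, 0) t) (h.alg.leibniz _ _ _ x.2 _ y.2 z)
    rw [leibnizForm_eq hM hN (inl_mem x.2) (inl_mem y.2) (inl_mem z.2) t.2]
    simp only [hM.inl, hN.inl]
    simp only [doubleForm_apply] at e ⊢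
    rw [e]
    simp
  have hS : ∀ {i j k l} (a : dualGrading 𝒜 i) (b : dualGrading 𝒜 j) (c : dualGrading 𝒜 k)
      (t : doubleGrading 𝒜 l), leibnizForm 𝒜 M N j k l (0, a) (0, b) (0, c) t = 0 := by
    intro i j k l a b c t
    have e : doubleForm 𝒜 (0, dualOp 𝒜 δ a (dualOp 𝒜 Δ b c)) t = _ := congrArg
      (fun p => doubleForm 𝒜 (0, p) t) (hd.leibniz _ _ _ a.2 _ b.2 c)
    rw [leibnizForm_eq hM hN (inr_mem a.2) (inr_mem b.2) (inr_mem c.2) t.2]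
    simp only [hM.inr, hN.inr]
    simp only [doubleForm_apply] at e ⊢
    rw [e]
    simp
  obtain ⟨x, a, rfl⟩ := exists_homInl_add_homInr u
  have hadd : leibnizForm 𝒜 M N j k l ((homInl x + homInr a : doubleGrading 𝒜 i)) v w t =
      leibnizForm 𝒜 M N j k l (x, 0) v w t + leibnizForm 𝒜 M N j k l (0, a) v w t := by
    simp only [leibnizForm, homInl, homInr, Submodule.coe_add, map_add, LinearMap.add_apply]
    ring
  have h1 := reduce (x, 0) (fun y z t => hA x y z (homInl t)) (fun y z a => hA x y z (homInr a))
    (fun {j k l} y a b => by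
      have e := form_compat_mul_bracket h hM hN a.2 b.2 x.2 y.2
      rw [leibnizForm, hM.form_swap hN (inl_mem x.2) (inl_mem y.2) (inr_mem a.2) (inr_mem b.2), e,
        hM.form_swap_left (inl_mem x.2) (inr_mem a.2),
        hM.form_swap_left (inl_mem x.2) (inr_mem b.2),
        hN.form_swap_right (inl_mem y.2) (inr_mem a.2)]
      simp only [koszulSign_add_right]
      generalize doubleForm 𝒜 (M (0, a) (x, 0)) (N (0, b) (y, 0)) = X
      generalize doubleForm 𝒜 (M (0, b) (x, 0)) (N (0, a) (y, 0)) = Y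
      clear e hadd a b y x
      rcases parity_cases i with rfl | rfl <;> rcases parity_cases j with rfl | rfl <;>
        rcases parity_cases k with rfl | rfl <;> rcases parity_cases l with rfl | rfl <;>
        simp only [koszulSign_zero_left, koszulSign_zero_right, koszulSign_one_one] <;> ring)
    (fun {j k l} a b c => by
      have e := hd.leibniz_cyclic a.2 b.2 c.2
      have e' := congrArg (fun p => doubleForm 𝒜 (x, 0) (0, p)) e
      simp only [leibnizForm, hM.inv, hN.inr, hM.inr]
      simpa [doubleForm_apply] using e')
  have h2 := reduce (0, a) (fun {j k l} x y z => by
      have e := h.alg.leibniz_cyclic x.2 y.2 z.2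
      have e' := congrArg (fun p => doubleForm 𝒜 (0, a) (p, 0)) e
      simp only [leibnizForm, hM.inv, hN.inl, hM.inl]
      simpa [doubleForm_apply] using e')
    (fun {j k l} x y b => by
      have e := form_compat_bracket_mul h hM hN b.2 a.2 x.2 y.2
      rw [leibnizForm, hM.form_swap_left (inr_mem a.2) (inr_mem b.2), e,
        hN.form_swap_right (inl_mem y.2) (inr_mem b.2),
        hM.form_swap hN (inr_mem a.2) (inl_mem x.2) (inr_mem b.2) (inl_mem y.2),
        hM.form_swap hN (inr_mem a.2) (inl_mem y.2) (inr_mem b.2) (inl_mem x.2)]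
      simp only [koszulSign_add_right]
      generalize doubleForm 𝒜 (N (0, b) (x, 0)) (M (0, a) (y, 0)) = X
      generalize doubleForm 𝒜 (N (0, b) (y, 0)) (M (0, a) (x, 0)) = Y
      clear e b y x h1 hadd a
      rcases parity_cases i with rfl | rfl <;> rcases parity_cases j with rfl | rfl <;>
        rcases parity_cases k with rfl | rfl <;> rcases parity_cases l with rfl | rfl <;>
        simp only [koszulSign_zero_left, koszulSign_zero_right, koszulSign_one_one] <;> ring)
    (fun {j k l} x b c => by
      have e := hS a b c (homInl x)
      rw [leibnizForm_swap₁₂ hN (inr_mem b.2) (inl_mem x.2) (inr_mem c.2),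
        leibnizForm_swap₂₃ hN (inr_mem b.2) (inr_mem c.2) (inl_mem x.2)]
      simp only [homInl] at e
      rw [e, mul_zero, mul_zero])
    (fun b c d => hS a b c (homInr d))
  rw [hadd, h1, h2, add_zero]

theorem double_isPoisson (h : IsPoissonSuperbialgebra 𝒜 br mul δ Δ)
    (hM : IsManinOp 𝒜 (-1) br (dualOp 𝒜 δ) M) (hN : IsManinOp 𝒜 1 mul (dualOp 𝒜 Δ) N) :
    IsPoissonSuperalgebra (doubleGrading 𝒜) M N where
  lie := doubleBracket_isLie h.lie hM
  commAssoc := doubleMul_isCommAssociative h.alg.commAssoc h.coalg.dual.commAssoc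
    h.infinitesimal hN
  leibniz i j u hu v hv w := by
    rw [← sum_superProj (doubleGrading 𝒜) w]
    simp only [map_sum, Finset.smul_sum, ← Finset.sum_add_distrib]
    refine Finset.sum_congr rfl fun k _ => ?_
    have hw := superProj_mem (doubleGrading 𝒜) k w
    generalize superProj (doubleGrading 𝒜) k w = w at hw
    have e1 := hN.even _ _ _ (hM.even _ _ _ hu _ hv) _ hw
    have e2 := hM.even _ _ _ hu _ (hN.even _ _ _ hv _ hw)
    have e3 := hN.even _ _ _ hv _ (hM.even _ _ _ hu _ hw)
    rw [← add_assoc] at e2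
    rw [← add_assoc, add_comm j] at e3
    refine eq_of_doubleForm e2 (Submodule.add_mem _ e1 (Submodule.smul_mem _ _ e3)) fun t ht => ?_
    have e := leibnizForm_eq hM hN hu hv hw ht
    have e0 := leibnizForm_eq_zero h hM hN ⟨u, hu⟩ ⟨v, hv⟩ ⟨w, hw⟩ ⟨t, ht⟩
    rw [e0] at e
    simp only [map_add, map_smul, LinearMap.add_apply, LinearMap.smul_apply, smul_eq_mul]
    linear_combination e

end DoublePoisson

/-! ## Coboundary structures -/

section Coboundary

variable {K A : Type*} [Field K] [AddCommGroup A] [Module K A]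
  {𝒜 : ZMod 2 → Submodule K A} {br mul : A →ₗ[K] A →ₗ[K] A} {i j k l : ZMod 2} {x y : A}

theorem IsPoissonSuperalgebra.ad_comp_mul (h : IsPoissonSuperalgebra 𝒜 br mul) (hx : x ∈ 𝒜 i)
    (hy : y ∈ 𝒜 j) :
    br x ∘ₗ mul y = mul (br x y) + koszulSign K i j • (mul y ∘ₗ br x) := by
  ext z
  exact h.leibniz _ _ _ hx _ hy z

variable [DirectSum.Decomposition 𝒜]

theorem IsLieSuperalgebra.ad_bracket (h : IsLieSuperalgebra 𝒜 br) (hx : x ∈ 𝒜 i) (hy : y ∈ 𝒜 j) :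
    br (br x y) = br x ∘ₗ br y - koszulSign K i j • (br y ∘ₗ br x) := by
  refine hom_ext (𝒜 := 𝒜) fun k z hz => ?_
  have e := h.jacobi _ _ _ _ hx _ hy _ hz
  rw [h.skew _ _ _ hz _ (h.even _ _ _ hx _ hy), h.skew _ _ _ hz _ hx, map_neg, map_smul] at e
  simp only [LinearMap.sub_apply, LinearMap.smul_apply, LinearMap.comp_apply]
  simp only [koszulSign_add_right] at e
  rcases parity_cases i with rfl | rfl <;> rcases parity_cases j with rfl | rfl <;>
    rcases parity_cases k with rfl | rfl <;>
    simp only [koszulSign_zero_left, koszulSign_zero_right, koszulSign_one_one] at e ⊢ <;>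
    first | linear_combination (norm := module) e | linear_combination (norm := module) -e

theorem IsPoissonSuperalgebra.ad_mul (h : IsPoissonSuperalgebra 𝒜 br mul) (hx : x ∈ 𝒜 i)
    (hy : y ∈ 𝒜 j) :
    br (mul x y) = mul x ∘ₗ br y + koszulSign K i j • (mul y ∘ₗ br x) := by
  refine hom_ext (𝒜 := 𝒜) fun k z hz => ?_
  have hl := h.lie
  have hc := h.commAssoc
  simp only [LinearMap.add_apply, LinearMap.smul_apply, LinearMap.comp_apply]
  rw [hl.skew _ _ _ (hc.even _ _ _ hx _ hy) _ hz, h.leibniz _ _ _ hz _ hx,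
    hl.skew _ _ _ hy _ hz, hl.skew _ _ _ hx _ hz, map_neg, map_neg, map_smul, map_smul,
    hc.comm _ _ _ (hl.even _ _ _ hz _ hx) _ hy]
  simp only [koszulSign_add_left]
  rcases parity_cases i with rfl | rfl <;> rcases parity_cases j with rfl | rfl <;>
    rcases parity_cases k with rfl | rfl <;>
    simp only [koszulSign_zero_left, koszulSign_zero_right, koszulSign_one_one] <;> module

theorem adTensor_apply (r : A ⊗[K] A) (x : A) :
    adTensor 𝒜 br r x = leftAct br x r + rightAct 𝒜 br x r := rfl

theorem mulTensor_apply (r : A ⊗[K] A) (x : A) :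
    mulTensor 𝒜 mul r x = leftAct mul x r - rightAct 𝒜 mul x r := rfl

variable [FiniteDimensional K A] (r : A ⊗[K] A)

/-- A coboundary is a cocycle: ad respects brackets on each leg, and the cross terms, with ad(x) on
one leg and ad(y) on the other, cancel by supercommutation. This holds for every r. -/
theorem adTensor_bracket (h : IsLieSuperalgebra 𝒜 br) (hx : x ∈ 𝒜 k) (hy : y ∈ 𝒜 l) :
    adTensor 𝒜 br r (br x y) = (leftAct br x + rightAct 𝒜 br x) (adTensor 𝒜 br r y) -
      koszulSign K k l • (leftAct br y + rightAct 𝒜 br y) (adTensor 𝒜 br r x) := by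
  refine tensor_eq_of_hom (𝒜 := 𝒜) fun i j φ hφ ψ hψ => ?_
  have h1 := dual_comp_mem hφ fun m z hz => h.even _ _ _ hx _ hz
  have h2 := dual_comp_mem hφ fun m z hz => h.even _ _ _ hy _ hz
  simp only [adTensor_apply, LinearMap.add_apply, map_add, map_sub, map_smul, pair₂_leftAct,
    pair₂_rightAct br ψ (h.even _ _ _ hx _ hy) hφ, pair₂_rightAct br _ hx hφ,
    pair₂_rightAct br _ hy hφ, pair₂_rightAct br _ hy h1, pair₂_rightAct br _ hx h2,
    h.ad_bracket hx hy, LinearMap.comp_sub, LinearMap.comp_smul, LinearMap.sub_apply,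
    LinearMap.smul_apply, LinearMap.comp_assoc, koszulSign_add_left, koszulSign_add_right,
    smul_eq_mul]
  generalize pair₂ (φ ∘ₗ br x) (ψ ∘ₗ br y) r = X
  generalize pair₂ (φ ∘ₗ br y) (ψ ∘ₗ br x) r = Y
  rw [koszulSign_comm K l k]
  linear_combination koszulSign K k i * Y * koszulSign_mul_self K k l

theorem adTensor_mul (h : IsPoissonSuperalgebra 𝒜 br mul) (hx : x ∈ 𝒜 k) (hy : y ∈ 𝒜 l) :
    adTensor 𝒜 br r (mul x y) =
      koszulSign K k l • leftAct mul y (adTensor 𝒜 br r x) + leftAct mul x (adTensor 𝒜 br r y) +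
      rightAct 𝒜 br x ((-mulTensor 𝒜 mul r) y) +
      koszulSign K k l • rightAct 𝒜 br y ((-mulTensor 𝒜 mul r) x) := by
  refine tensor_eq_of_hom (𝒜 := 𝒜) fun i j φ hφ ψ hψ => ?_
  have h1 := dual_comp_mem hφ fun m z hz => h.commAssoc.even _ _ _ hx _ hz
  have h2 := dual_comp_mem hφ fun m z hz => h.commAssoc.even _ _ _ hy _ hz
  -- On the first leg ad(xy) is expanded with L outermost, on the second with ad outermost, as the
  -- right side demands; the reordering terms cancel because {x, y} is skew.
  have e : br (mul x y) = br x ∘ₗ mul y + koszulSign K k l • (br y ∘ₗ mul x) := by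
    rw [h.ad_mul hx hy, h.ad_comp_mul hx hy, h.ad_comp_mul hy hx, h.lie.skew _ _ _ hx _ hy,
      map_neg, map_smul, smul_add, smul_smul, koszulSign_comm K l k, koszulSign_mul_self]
    module
  have e1 : φ ∘ₗ br (mul x y) = φ ∘ₗ mul x ∘ₗ br y + koszulSign K k l • (φ ∘ₗ mul y ∘ₗ br x) := by
    rw [h.ad_mul hx hy, LinearMap.comp_add, LinearMap.comp_smul]
  have e2 : ψ ∘ₗ br (mul x y) = ψ ∘ₗ br x ∘ₗ mul y + koszulSign K k l • (ψ ∘ₗ br y ∘ₗ mul x) := by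
    rw [e, LinearMap.comp_add, LinearMap.comp_smul]
  simp only [adTensor_apply, mulTensor_apply, LinearMap.neg_apply, map_neg, LinearMap.add_apply,
    map_add, map_sub, map_smul,
    pair₂_leftAct, pair₂_rightAct br ψ (h.commAssoc.even _ _ _ hx _ hy) hφ,
    pair₂_rightAct br _ hx hφ, pair₂_rightAct br _ hy hφ, pair₂_rightAct mul _ hx hφ,
    pair₂_rightAct mul _ hy hφ, pair₂_rightAct br _ hy h1, pair₂_rightAct br _ hx h2,
    e1, e2, LinearMap.smul_apply, LinearMap.comp_assoc, koszulSign_add_left,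
    koszulSign_add_right, smul_eq_mul]
  generalize pair₂ (φ ∘ₗ mul x) (ψ ∘ₗ br y) r = X
  generalize pair₂ (φ ∘ₗ mul y) (ψ ∘ₗ br x) r = Y
  rw [koszulSign_comm K l k]
  linear_combination (-koszulSign K k i * Y) * koszulSign_mul_self K k l

theorem mulTensor_bracket (h : IsPoissonSuperalgebra 𝒜 br mul) (hx : x ∈ 𝒜 k) (hy : y ∈ 𝒜 l) :
    (-mulTensor 𝒜 mul r) (br x y) =
      (leftAct br x + rightAct 𝒜 br x) ((-mulTensor 𝒜 mul r) y) +
      koszulSign K k l • (leftAct mul y - rightAct 𝒜 mul y) (adTensor 𝒜 br r x) := by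
  refine tensor_eq_of_hom (𝒜 := 𝒜) fun i j φ hφ ψ hψ => ?_
  have h1 := dual_comp_mem hφ fun m z hz => h.lie.even _ _ _ hx _ hz
  have h2 := dual_comp_mem hφ fun m z hz => h.commAssoc.even _ _ _ hy _ hz
  have e : mul (br x y) = br x ∘ₗ mul y - koszulSign K k l • (mul y ∘ₗ br x) := by
    rw [h.ad_comp_mul hx hy, add_sub_cancel_right]
  simp only [adTensor_apply, mulTensor_apply, LinearMap.neg_apply, map_neg, LinearMap.add_apply,
    LinearMap.sub_apply, map_add, map_sub, map_smul,
    pair₂_leftAct, pair₂_rightAct mul ψ (h.lie.even _ _ _ hx _ hy) hφ,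
    pair₂_rightAct br _ hx hφ, pair₂_rightAct mul _ hy hφ, pair₂_rightAct mul _ hy h1,
    pair₂_rightAct br _ hx h2, e, LinearMap.comp_sub, LinearMap.comp_smul,
    LinearMap.smul_apply, LinearMap.comp_assoc, koszulSign_add_left,
    koszulSign_add_right, smul_eq_mul]
  generalize pair₂ (φ ∘ₗ br x) (ψ ∘ₗ mul y) r = X
  generalize pair₂ (φ ∘ₗ mul y) (ψ ∘ₗ br x) r = Y
  rw [koszulSign_comm K l k]
  linear_combination -koszulSign K k i * Y * koszulSign_mul_self K k l

variable {r}

/-- Since r is even, pairing its first leg with φ of parity i leaves only second legs of parity i,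
on which right multiplication by y is left multiplication up to a fixed sign. -/
theorem pair₂_comp_flip (hc : IsCommAssociativeSuperalgebra 𝒜 mul) (hr : r ∈ tensorGrading 𝒜 0)
    {φ ψ : Module.Dual K A} (hφ : φ ∈ dualGrading 𝒜 i) (hy : y ∈ 𝒜 l) :
    pair₂ φ (ψ ∘ₗ mul.flip y) r = koszulSign K l i * pair₂ φ (ψ ∘ₗ mul y) r := by
  have hr' : (superProj 𝒜 i).lTensor A r = (superProj 𝒜 i).rTensor A r := by
    refine tensor_eq_of_hom (𝒜 := 𝒜) fun p q α hα β hβ => ?_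
    rw [pair₂_lTensor, pair₂_rTensor, dual_comp_superProj hα, dual_comp_superProj hβ]
    by_cases hpq : p = q
    · subst hpq; split_ifs <;> simp
    · have : pair₂ α β r = 0 := pair₂_eq_zero_of_mem hα hβ hr
        ((show ∀ p q : ZMod 2, p ≠ q → p + q ≠ 0 by decide) p q hpq)
      split_ifs <;> simp [this]
  have key : ∀ β : Module.Dual K A, pair₂ φ β r = pair₂ φ (β ∘ₗ superProj 𝒜 i) r := by
    intro β
    rw [← pair₂_lTensor, hr', pair₂_rTensor, dual_comp_superProj hφ, if_pos rfl]
  have hop : (ψ ∘ₗ mul.flip y) ∘ₗ superProj 𝒜 i =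
      koszulSign K l i • ((ψ ∘ₗ mul y) ∘ₗ superProj 𝒜 i) := by
    ext z
    simp only [LinearMap.comp_apply, LinearMap.flip_apply, LinearMap.smul_apply]
    rw [hc.comm _ _ _ (superProj_mem 𝒜 i z) _ hy, map_smul, koszulSign_comm]
  rw [key, hop, map_smul, LinearMap.smul_apply, smul_eq_mul, ← key]

/-- The middle terms, with x on the first leg and y on the second, cancel once right multiplication
by y is rewritten by `pair₂_comp_flip`. -/
theorem mulTensor_mul (hc : IsCommAssociativeSuperalgebra 𝒜 mul) (hr : r ∈ tensorGrading 𝒜 0)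
    (x y : A) : (-mulTensor 𝒜 mul r) (mul x y) = leftAct mul x ((-mulTensor 𝒜 mul r) y) +
      (mul.flip y).lTensor A ((-mulTensor 𝒜 mul r) x) := by
  have key : ∀ k l, ∀ x ∈ 𝒜 k, ∀ y ∈ 𝒜 l,
      (-mulTensor 𝒜 mul r) (mul x y) = leftAct mul x ((-mulTensor 𝒜 mul r) y) +
      (mul.flip y).lTensor A ((-mulTensor 𝒜 mul r) x) := by
    intro k l x hx y hy
    refine tensor_eq_of_hom (𝒜 := 𝒜) fun i j φ hφ ψ hψ => ?_
    have h1 := dual_comp_mem hφ fun m z hz => hc.even _ _ _ hx _ hz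
    have e : mul (mul x y) = mul x ∘ₗ mul y := by ext z; simp [hc.assoc]
    have e' : (ψ ∘ₗ mul.flip y) ∘ₗ mul x = (ψ ∘ₗ mul x) ∘ₗ mul.flip y := by
      ext z; simp [hc.assoc]
    have h3 := pair₂_comp_flip (ψ := ψ ∘ₗ mul x) hc hr hφ hy
    rw [LinearMap.comp_assoc, LinearMap.comp_assoc] at h3
    simp only [mulTensor_apply, LinearMap.neg_apply, map_neg, map_add, map_sub,
      pair₂_leftAct, pair₂_lTensor, pair₂_rightAct mul _ (hc.even _ _ _ hx _ hy) hφ,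
      pair₂_rightAct mul _ hx hφ, pair₂_rightAct mul _ hy h1, e', h3,
      pair₂_comp_flip hc hr h1 hy, e, koszulSign_add_left, LinearMap.comp_assoc]
    ring
  refine DirectSum.Decomposition.inductionOn 𝒜 (motive := fun x => (-mulTensor 𝒜 mul r) (mul x y) =
    leftAct mul x ((-mulTensor 𝒜 mul r) y) + (mul.flip y).lTensor A ((-mulTensor 𝒜 mul r) x))
    (by simp) (fun {k} x => ?_) (fun x x' hx hx' => ?_) x
  · refine DirectSum.Decomposition.inductionOn 𝒜 (motive := fun y =>
      (-mulTensor 𝒜 mul r) (mul x y) = leftAct mul x ((-mulTensor 𝒜 mul r) y) +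
        (mul.flip y).lTensor A ((-mulTensor 𝒜 mul r) x))
      (by simp) (fun {l} y => key k l x x.2 y y.2) (fun y y' hy hy' => ?_) y
    rw [map_add, map_add, hy, hy', map_add, map_add, map_add, LinearMap.lTensor_add,
      LinearMap.add_apply]
    abel
  · rw [map_add, LinearMap.add_apply, map_add, hx, hx', map_add, map_add, map_add,
      LinearMap.add_apply]
    abel

end Coboundary

/-! ## The dual of the coboundary cooperations on the double -/

section Split

variable {K A : Type*} [Field K] [AddCommGroup A] [Module K A]

/-- The operation `(x + a) * (y + b) = -m(x, y) + n(a, b)` on `A ⊕ A*`. -/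
def splitOp (m : A →ₗ[K] A →ₗ[K] A)
    (n : Module.Dual K A →ₗ[K] Module.Dual K A →ₗ[K] Module.Dual K A) :
    A × Module.Dual K A →ₗ[K] A × Module.Dual K A →ₗ[K] A × Module.Dual K A :=
  ((-m).compl₁₂ (LinearMap.fst K _ _) (LinearMap.fst K _ _)).compr₂ (LinearMap.inl K _ _) +
    (n.compl₁₂ (LinearMap.snd K _ _) (LinearMap.snd K _ _)).compr₂ (LinearMap.inr K _ _)

theorem splitOp_apply (m : A →ₗ[K] A →ₗ[K] A)
    (n : Module.Dual K A →ₗ[K] Module.Dual K A →ₗ[K] Module.Dual K A)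
    (u v : A × Module.Dual K A) : splitOp m n u v = (-m u.1 v.1, n u.2 v.2) := by
  simp [splitOp]

variable {𝒜 : ZMod 2 → Submodule K A} {br mul : A →ₗ[K] A →ₗ[K] A}
  {n n' : Module.Dual K A →ₗ[K] Module.Dual K A →ₗ[K] Module.Dual K A}

/-- Negating both operations of A is harmless: Jacobi, associativity and Leibniz are quadratic in
them and the symmetries are linear. -/
theorem splitOp_isPoisson (h : IsPoissonSuperalgebra 𝒜 br mul)
    (h' : IsPoissonSuperalgebra (dualGrading 𝒜) n n') :
    IsPoissonSuperalgebra (doubleGrading 𝒜) (splitOp br n) (splitOp mul n') where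
  lie :=
    { even := fun i j u hu v hv => by
        rw [splitOp_apply]
        exact ⟨Submodule.neg_mem _ (h.lie.even _ _ _ hu.1 _ hv.1), h'.lie.even _ _ _ hu.2 _ hv.2⟩
      skew := fun i j u hu v hv => by
        rw [splitOp_apply, splitOp_apply, h.lie.skew _ _ _ hu.1 _ hv.1,
          h'.lie.skew _ _ _ hu.2 _ hv.2]
        simp
      jacobi := fun i j k u hu v hv w hw => by
        refine Prod.ext ?_ ?_
        · simpa [splitOp_apply] using h.lie.jacobi _ _ _ _ hu.1 _ hv.1 _ hw.1
        · simpa [splitOp_apply] using h'.lie.jacobi _ _ _ _ hu.2 _ hv.2 _ hw.2 }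
  commAssoc :=
    { even := fun i j u hu v hv => by
        rw [splitOp_apply]
        exact ⟨Submodule.neg_mem _ (h.commAssoc.even _ _ _ hu.1 _ hv.1),
          h'.commAssoc.even _ _ _ hu.2 _ hv.2⟩
      assoc := fun u v w => by
        simp [splitOp_apply, h.commAssoc.assoc, h'.commAssoc.assoc]
      comm := fun i j u hu v hv => by
        rw [splitOp_apply, splitOp_apply, h.commAssoc.comm _ _ _ hu.1 _ hv.1,
          h'.commAssoc.comm _ _ _ hu.2 _ hv.2]
        simp }
  leibniz := fun i j u hu v hv w => by
    simp [splitOp_apply, h.leibniz _ _ _ hu.1 _ hv.1, h'.leibniz _ _ _ hu.2 _ hv.2]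

theorem IsPoissonSuperalgebra.map {B : Type*} [AddCommGroup B] [Module K B]
    {ℬ : ZMod 2 → Submodule K B} {br' mul' : B →ₗ[K] B →ₗ[K] B} (f : A →ₗ[K] B)
    (hf : Function.Surjective f) (hf₁ : ∀ i, ∀ x ∈ 𝒜 i, f x ∈ ℬ i)
    (hf₂ : ∀ i, ∀ y ∈ ℬ i, ∃ x ∈ 𝒜 i, f x = y)
    (hbr : ∀ x y, br' (f x) (f y) = f (br x y)) (hmul : ∀ x y, mul' (f x) (f y) = f (mul x y))
    (h : IsPoissonSuperalgebra 𝒜 br mul) : IsPoissonSuperalgebra ℬ br' mul' where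
  lie :=
    { even := fun i j u hu v hv => by
        obtain ⟨x, hx, rfl⟩ := hf₂ i u hu
        obtain ⟨y, hy, rfl⟩ := hf₂ j v hv
        rw [hbr]; exact hf₁ _ _ (h.lie.even _ _ _ hx _ hy)
      skew := fun i j u hu v hv => by
        obtain ⟨x, hx, rfl⟩ := hf₂ i u hu
        obtain ⟨y, hy, rfl⟩ := hf₂ j v hv
        rw [hbr, hbr, h.lie.skew _ _ _ hx _ hy, map_neg, map_smul]
      jacobi := fun i j k u hu v hv w hw => by
        obtain ⟨x, hx, rfl⟩ := hf₂ i u hu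
        obtain ⟨y, hy, rfl⟩ := hf₂ j v hv
        obtain ⟨z, hz, rfl⟩ := hf₂ k w hw
        simp only [hbr]
        simpa only [map_add, map_smul, map_zero] using
          congrArg f (h.lie.jacobi _ _ _ _ hx _ hy _ hz) }
  commAssoc :=
    { even := fun i j u hu v hv => by
        obtain ⟨x, hx, rfl⟩ := hf₂ i u hu
        obtain ⟨y, hy, rfl⟩ := hf₂ j v hv
        rw [hmul]; exact hf₁ _ _ (h.commAssoc.even _ _ _ hx _ hy)
      assoc := fun u v w => by
        obtain ⟨x, rfl⟩ := hf u
        obtain ⟨y, rfl⟩ := hf v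
        obtain ⟨z, rfl⟩ := hf w
        simp only [hmul, h.commAssoc.assoc]
      comm := fun i j u hu v hv => by
        obtain ⟨x, hx, rfl⟩ := hf₂ i u hu
        obtain ⟨y, hy, rfl⟩ := hf₂ j v hv
        rw [hmul, hmul, h.commAssoc.comm _ _ _ hx _ hy, map_smul] }
  leibniz := fun i j u hu v hv w => by
    obtain ⟨x, hx, rfl⟩ := hf₂ i u hu
    obtain ⟨y, hy, rfl⟩ := hf₂ j v hv
    obtain ⟨z, rfl⟩ := hf w
    simp only [hmul, hbr, h.leibniz _ _ _ hx _ hy, map_add, map_smul]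

end Split

/-! ### The canonical element r and the operations dual to its coboundaries. -/

section DoubleR

variable {K A : Type*} [Field K] [AddCommGroup A] [Module K A] [FiniteDimensional K A]

theorem pair₂_coevaluation (a : Module.Dual K A) (Ψ : Module.Dual K (Module.Dual K A)) :
    pair₂ a Ψ (coevaluation K A 1) = Ψ a := by
  rw [coevaluation_apply_one, map_sum]
  simp only [pair₂_tmul]
  conv_rhs => rw [← (Module.Basis.ofVectorSpace K A).sum_dual_apply_smul_coord a, map_sum]
  simp only [map_smul, smul_eq_mul]

/-- The basis-free description of r: φ is restricted to A and handed to ψ. -/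
theorem pair₂_doubleR (φ ψ : Module.Dual K (A × Module.Dual K A)) :
    pair₂ φ ψ (doubleR K A) = ψ (0, φ ∘ₗ LinearMap.inl K A (Module.Dual K A)) := by
  rw [doubleR, pair₂_map, pair₂_coevaluation]; rfl

theorem doubleR_eq_sum {ι : Type*} [Fintype ι] (e : Module.Basis ι K A) :
    doubleR K A =
      ∑ i, ((e i, 0) : A × Module.Dual K A) ⊗ₜ[K] ((0, e.coord i) : A × Module.Dual K A) := by
  refine tensor_eq_of_pair₂ fun φ ψ => ?_
  rw [pair₂_doubleR, map_sum]
  simp only [pair₂_tmul]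
  have h : φ ∘ₗ LinearMap.inl K A (Module.Dual K A) = ∑ i, φ (e i, 0) • e.coord i :=
    (e.sum_dual_apply_smul_coord _).symm
  rw [h]
  have : ((0, ∑ i, φ (e i, 0) • e.coord i) : A × Module.Dual K A) =
      ∑ i, φ (e i, 0) • ((0, e.coord i) : A × Module.Dual K A) := by
    refine Prod.ext ?_ ?_ <;> simp [Prod.fst_sum, Prod.snd_sum]
  rw [this, map_sum]
  simp only [map_smul, smul_eq_mul]

variable {𝒜 : ZMod 2 → Submodule K A} [DirectSum.Decomposition 𝒜]

theorem doubleForm_comp_inl (u : A × Module.Dual K A) :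
    doubleForm 𝒜 u ∘ₗ LinearMap.inl K A (Module.Dual K A) = u.2 := by
  ext y
  simp [doubleForm_apply]

theorem doubleR_mem : doubleR K A ∈ tensorGrading (doubleGrading 𝒜) 0 := by
  refine mem_tensorGrading_of_pair₂ fun i j φ hφ ψ hψ hij => ?_
  obtain ⟨u, hu, rfl⟩ := exists_doubleForm_eq hφ
  rw [pair₂_doubleR, doubleForm_comp_inl]
  exact dual_apply_eq_zero hψ (inr_mem hu.2)
    ((show ∀ i j : ZMod 2, i + j ≠ 0 → j ≠ i by decide) i j hij)

variable {s : K} {m : A →ₗ[K] A →ₗ[K] A}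
  {n : Module.Dual K A →ₗ[K] Module.Dual K A →ₗ[K] Module.Dual K A}
  {M : A × Module.Dual K A →ₗ[K] A × Module.Dual K A →ₗ[K] A × Module.Dual K A}

theorem IsManinOp.form_comp (hM : IsManinOp 𝒜 s m n M) (u w : A × Module.Dual K A) :
    doubleForm 𝒜 u ∘ₗ M w = doubleForm 𝒜 (M u w) := by
  ext1 <;> ext <;> simp [hM.inv]

/-- For s = -1 the map D is the coboundary cobracket, for s = 1 the coboundary coproduct. By
invariance the action of w on a leg of r moves onto u or v, and r then projects onto A or A*. -/
theorem doubleForm_splitOp (hM : IsManinOp 𝒜 s m n M)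
    {D : A × Module.Dual K A →ₗ[K] (A × Module.Dual K A) ⊗[K] (A × Module.Dual K A)}
    (hD : ∀ w, D w = -s • leftAct M w (doubleR K A) +
      rightAct (doubleGrading 𝒜) M w (doubleR K A)) (u v : A × Module.Dual K A) :
    dualOp (doubleGrading 𝒜) D (doubleForm 𝒜 u) (doubleForm 𝒜 v) =
      doubleForm 𝒜 (splitOp m n u v) := by
  have key : ∀ i j, ∀ u ∈ doubleGrading 𝒜 i, ∀ v ∈ doubleGrading 𝒜 j,
      dualOp (doubleGrading 𝒜) D (doubleForm 𝒜 u) (doubleForm 𝒜 v) =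
      doubleForm 𝒜 (splitOp m n u v) := by
    intro i j u hu v hv
    refine hom_ext (𝒜 := doubleGrading 𝒜) fun k w hw => ?_
    have hv1 := inl_mem (𝒜 := 𝒜) hv.1
    have hu2 := inr_mem (𝒜 := 𝒜) hu.2
    have e1 : doubleForm 𝒜 v (0, (M u w).2) = doubleForm 𝒜 (M (v.1, 0) u) w := by
      rw [hM.inv, doubleForm_apply, doubleForm_apply]; simp
    have e2 : doubleForm 𝒜 (M v w) (0, u.2) = koszulSign K (j + k) i *
        doubleForm 𝒜 (M (0, u.2) v) w := by
      rw [doubleForm_comm (hM.even _ _ _ hv _ hw) hu2, hM.inv]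
    -- With u = x + a and v = y + b, the mixed product of a and y occurs in both terms and cancels;
    -- the products of a with b and of x with y remain.
    have e3 : splitOp m n u v = M (0, u.2) v - M u (v.1, 0) := by
      have d : ∀ u : A × Module.Dual K A, u = (u.1, 0) + (0, u.2) := by simp
      conv_rhs => rw [d v]
      conv_rhs => enter [2]; rw [d u]
      simp only [map_add, LinearMap.add_apply, hM.inl, hM.inr, splitOp_apply]
      refine Prod.ext ?_ ?_ <;> simp
    rw [dualOp_apply D (doubleForm_mem hu) (doubleForm_mem hv), LinearMap.smul_apply,
      LinearMap.comp_apply, hD, map_add, map_smul, pair₂_leftAct,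
      pair₂_rightAct M _ hw (doubleForm_mem hu), hM.form_comp, hM.form_comp, pair₂_doubleR,
      pair₂_doubleR, doubleForm_comp_inl, doubleForm_comp_inl, e1, e2, e3, map_sub,
      LinearMap.sub_apply, hM.form_swap_left hv1 hu]
    have hs := hM.sign
    simp only [smul_eq_mul, koszulSign_add_left]
    generalize doubleForm 𝒜 (M u (v.1, 0)) w = X
    generalize doubleForm 𝒜 (M (0, u.2) v) w = Y
    rw [koszulSign_comm K j i]
    linear_combination -X * koszulSign_mul_self K i j * s * s - X * hs +
      Y * koszulSign K k i * koszulSign K k i * koszulSign_mul_self K i j +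
      Y * koszulSign_mul_self K k i
  rw [← sum_superProj (doubleGrading 𝒜) u, ← sum_superProj (doubleGrading 𝒜) v]
  simp only [map_sum, LinearMap.sum_apply]
  exact Finset.sum_congr rfl fun j _ => Finset.sum_congr rfl fun i _ =>
    key _ _ _ (superProj_mem _ _ _) _ (superProj_mem _ _ _)

end DoubleR

/-! ## The Yang-Baxter equations -/

section Contraction

variable {K A : Type*} [Field K] [AddCommGroup A] [Module K A]

/-- `x ⊗ y ↦ φ x • y`. -/
def contrLeft (φ : Module.Dual K A) : A ⊗[K] A →ₗ[K] A :=
  (TensorProduct.lid K A).toLinearMap ∘ₗ φ.rTensor A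

/-- `x ⊗ y ↦ ψ y • x`. -/
def contrRight (ψ : Module.Dual K A) : A ⊗[K] A →ₗ[K] A :=
  (TensorProduct.rid K A).toLinearMap ∘ₗ ψ.lTensor A

@[simp] theorem contrLeft_tmul (φ : Module.Dual K A) (x y : A) :
    contrLeft φ (x ⊗ₜ[K] y) = φ x • y := by simp [contrLeft]

@[simp] theorem contrRight_tmul (ψ : Module.Dual K A) (x y : A) :
    contrRight ψ (x ⊗ₜ[K] y) = ψ y • x := by simp [contrRight]

theorem apply_contrLeft (φ ψ : Module.Dual K A) (X : A ⊗[K] A) :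
    ψ (contrLeft φ X) = pair₂ φ ψ X := by
  induction X with
  | zero => simp
  | add a b ha hb => simp only [map_add, ha, hb]
  | tmul x y => simp

theorem apply_contrRight (φ ψ : Module.Dual K A) (X : A ⊗[K] A) :
    φ (contrRight ψ X) = pair₂ φ ψ X := by
  induction X with
  | zero => simp
  | add a b ha hb => simp only [map_add, ha, hb]
  | tmul x y => simp [mul_comm]

theorem contrLeft_lTensor (φ : Module.Dual K A) (f : A →ₗ[K] A) (X : A ⊗[K] A) :
    contrLeft φ (f.lTensor A X) = f (contrLeft φ X) := by
  induction X with
  | zero => simp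
  | add a b ha hb => simp only [map_add, ha, hb]
  | tmul x y => simp

theorem contrLeft_rTensor (φ : Module.Dual K A) (f : A →ₗ[K] A) (X : A ⊗[K] A) :
    contrLeft φ (f.rTensor A X) = contrLeft (φ ∘ₗ f) X := by
  induction X with
  | zero => simp
  | add a b ha hb => simp only [map_add, ha, hb]
  | tmul x y => simp

theorem contrRight_rTensor (ψ : Module.Dual K A) (f : A →ₗ[K] A) (X : A ⊗[K] A) :
    contrRight ψ (f.rTensor A X) = f (contrRight ψ X) := by
  induction X with
  | zero => simp
  | add a b ha hb => simp only [map_add, ha, hb]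
  | tmul x y => simp

theorem contrRight_lTensor (ψ : Module.Dual K A) (f : A →ₗ[K] A) (X : A ⊗[K] A) :
    contrRight ψ (f.lTensor A X) = contrRight (ψ ∘ₗ f) X := by
  induction X with
  | zero => simp
  | add a b ha hb => simp only [map_add, ha, hb]
  | tmul x y => simp

theorem contrRight_zero (X : A ⊗[K] A) : contrRight (0 : Module.Dual K A) X = 0 := by
  simp [contrRight]

theorem contrLeft_zero (X : A ⊗[K] A) : contrLeft (0 : Module.Dual K A) X = 0 := by
  simp [contrLeft]

/-- Two elements of `(A ⊗ A) → (A ⊗ A) → K` agree if they agree on pure tensors. -/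
theorem bilin_tensor_ext {f g : A ⊗[K] A → A ⊗[K] A → K}
    (hf : ∀ a b c, f (a + b) c = f a c + f b c) (hf' : ∀ a b c, f a (b + c) = f a b + f a c)
    (hg : ∀ a b c, g (a + b) c = g a c + g b c) (hg' : ∀ a b c, g a (b + c) = g a b + g a c)
    (h : ∀ x y z t, f (x ⊗ₜ[K] y) (z ⊗ₜ[K] t) = g (x ⊗ₜ[K] y) (z ⊗ₜ[K] t)) (r s : A ⊗[K] A) :
    f r s = g r s := by
  have f0 : ∀ c, f 0 c = 0 := fun c => by simpa using hf 0 0 c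
  have g0 : ∀ c, g 0 c = 0 := fun c => by simpa using hg 0 0 c
  have f0' : ∀ c, f c 0 = 0 := fun c => by simpa using hf' c 0 0
  have g0' : ∀ c, g c 0 = 0 := fun c => by simpa using hg' c 0 0
  induction r with
  | zero => rw [f0, g0]
  | add a b ha hb => rw [hf, hg, ha, hb]
  | tmul x y =>
    induction s with
    | zero => rw [f0', g0']
    | add a b ha hb => rw [hf', hg', ha, hb]
    | tmul z t => exact h x y z t

/-- Two legs are contracted by φ and χ, leaving one product of vectors to be tested by ψ. The other
Yang-Baxter terms are treated alike. -/
theorem pair₃_op1223 (op : A →ₗ[K] A →ₗ[K] A) (φ ψ χ : Module.Dual K A) (r s : A ⊗[K] A) :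
    pair₃ φ ψ χ (op1223 op r s) = ψ (op (contrLeft φ r) (contrRight χ s)) := by
  refine bilin_tensor_ext (f := fun r s => pair₃ φ ψ χ (op1223 op r s))
    (g := fun r s => ψ (op (contrLeft φ r) (contrRight χ s))) ?_ ?_ ?_ ?_ ?_ r s
  · intro a b c; simp only [op1223, TensorProduct.add_tmul, map_add]
  · intro a b c; simp only [op1223, TensorProduct.tmul_add, map_add]
  · intro a b c; simp only [map_add, LinearMap.add_apply]
  · intro a b c; simp only [map_add]
  · intro x y z t
    simp [op1223]
    ring

theorem pair₃_mul1312 (op : A →ₗ[K] A →ₗ[K] A) (φ ψ χ : Module.Dual K A) (r s : A ⊗[K] A) :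
    pair₃ φ ψ χ (mul1312 op r s) = φ (op (contrRight χ r) (contrRight ψ s)) := by
  refine bilin_tensor_ext (f := fun r s => pair₃ φ ψ χ (mul1312 op r s))
    (g := fun r s => φ (op (contrRight χ r) (contrRight ψ s))) ?_ ?_ ?_ ?_ ?_ r s
  · intro a b c; simp only [mul1312, TensorProduct.add_tmul, map_add]
  · intro a b c; simp only [mul1312, TensorProduct.tmul_add, map_add]
  · intro a b c; simp only [map_add, LinearMap.add_apply]
  · intro a b c; simp only [map_add]
  · intro x y z t
    simp [mul1312]
    ring

theorem pair₃_mul2313 (op : A →ₗ[K] A →ₗ[K] A) (φ ψ χ : Module.Dual K A) (r s : A ⊗[K] A) :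
    pair₃ φ ψ χ (mul2313 op r s) = χ (op (contrLeft ψ r) (contrLeft φ s)) := by
  refine bilin_tensor_ext (f := fun r s => pair₃ φ ψ χ (mul2313 op r s))
    (g := fun r s => χ (op (contrLeft ψ r) (contrLeft φ s))) ?_ ?_ ?_ ?_ ?_ r s
  · intro a b c; simp only [mul2313, TensorProduct.add_tmul, map_add]
  · intro a b c; simp only [mul2313, TensorProduct.tmul_add, map_add]
  · intro a b c; simp only [map_add, LinearMap.add_apply]
  · intro a b c; simp only [map_add]
  · intro x y z t
    simp [mul2313]

theorem pair₃_rTensor_tensorComm (op : A →ₗ[K] A →ₗ[K] A) (φ ψ χ : Module.Dual K A)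
    (r s : A ⊗[K] A) :
    pair₃ φ ψ χ ((TensorProduct.lift op).rTensor (A ⊗[K] A)
      (TensorProduct.tensorTensorTensorComm K A A A A (r ⊗ₜ[K] s))) =
      φ (op (contrRight ψ r) (contrRight χ s)) := by
  refine bilin_tensor_ext (f := fun r s => pair₃ φ ψ χ ((TensorProduct.lift op).rTensor (A ⊗[K] A)
      (TensorProduct.tensorTensorTensorComm K A A A A (r ⊗ₜ[K] s))))
    (g := fun r s => φ (op (contrRight ψ r) (contrRight χ s))) ?_ ?_ ?_ ?_ ?_ r s
  · intro a b c; simp only [TensorProduct.add_tmul, map_add]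
  · intro a b c; simp only [TensorProduct.tmul_add, map_add]
  · intro a b c; simp only [map_add, LinearMap.add_apply]
  · intro a b c; simp only [map_add]
  · intro x y z t
    simp
    ring

theorem pair₃_lTensor_tensorComm (op : A →ₗ[K] A →ₗ[K] A) (φ ψ χ : Module.Dual K A)
    (r s : A ⊗[K] A) :
    pair₃ φ ψ χ (TensorProduct.assoc K A A A ((TensorProduct.lift op).lTensor (A ⊗[K] A)
      (TensorProduct.tensorTensorTensorComm K A A A A (r ⊗ₜ[K] s)))) =
      χ (op (contrLeft φ r) (contrLeft ψ s)) := by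
  refine bilin_tensor_ext (f := fun r s => pair₃ φ ψ χ (TensorProduct.assoc K A A A
      ((TensorProduct.lift op).lTensor (A ⊗[K] A)
      (TensorProduct.tensorTensorTensorComm K A A A A (r ⊗ₜ[K] s)))))
    (g := fun r s => χ (op (contrLeft φ r) (contrLeft ψ s))) ?_ ?_ ?_ ?_ ?_ r s
  · intro a b c; simp only [TensorProduct.add_tmul, map_add]
  · intro a b c; simp only [TensorProduct.tmul_add, map_add]
  · intro a b c; simp only [map_add, LinearMap.add_apply]
  · intro a b c; simp only [map_add]
  · intro x y z t
    simp
    ring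

variable {𝒜 : ZMod 2 → Submodule K A} [DirectSum.Decomposition 𝒜] {i j k : ZMod 2}

/-- The sign (-1)^{|s₁||r₂|} is constant here: r₂ is tested by ψ, of parity j, and s₁ survives only
in the contraction of s, of parity k. -/
theorem pair₃_bracket1213 (op : A →ₗ[K] A →ₗ[K] A) (φ : Module.Dual K A)
    {ψ : Module.Dual K A} (χ : Module.Dual K A) (hψ : ψ ∈ dualGrading 𝒜 j) (r : A ⊗[K] A)
    {s : A ⊗[K] A} (hs : contrRight χ s ∈ 𝒜 k) :
    pair₃ φ ψ χ (bracket1213 𝒜 op r s) =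
      koszulSign K k j * φ (op (contrRight ψ r) (contrRight χ s)) := by
  simp only [bracket1213, superMiddleSwap, LinearMap.sum_apply, LinearMap.smul_apply,
    LinearMap.comp_apply, TensorProduct.map_tmul, map_sum, map_smul, LinearEquiv.coe_coe,
    pair₃_rTensor_tensorComm, contrRight_rTensor, contrRight_lTensor, superProj_of_mem 𝒜 hs,
    dual_comp_superProj hψ, smul_eq_mul]
  rw [Finset.sum_eq_single k, Finset.sum_eq_single j]
  · simp
  · intro l _ hl; simp [hl.symm, contrRight_zero]
  · simp
  · intro l _ hl
    refine Finset.sum_eq_zero fun m _ => ?_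
    simp [hl.symm]
  · simp

theorem pair₃_bracket1323 (op : A →ₗ[K] A →ₗ[K] A) (φ : Module.Dual K A)
    {ψ : Module.Dual K A} (χ : Module.Dual K A) (hψ : ψ ∈ dualGrading 𝒜 j) {r : A ⊗[K] A}
    (s : A ⊗[K] A) (hr : contrLeft φ r ∈ 𝒜 i) :
    pair₃ φ ψ χ (bracket1323 𝒜 op r s) =
      koszulSign K j i * χ (op (contrLeft φ r) (contrLeft ψ s)) := by
  simp only [bracket1323, superMiddleSwap, LinearMap.sum_apply, LinearMap.smul_apply,
    LinearMap.comp_apply, TensorProduct.map_tmul, map_sum, map_smul, LinearEquiv.coe_coe,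
    pair₃_lTensor_tensorComm, contrLeft_rTensor, contrLeft_lTensor, superProj_of_mem 𝒜 hr,
    dual_comp_superProj hψ, smul_eq_mul]
  rw [Finset.sum_eq_single j, Finset.sum_eq_single i]
  · simp
  · intro l _ hl; simp [hl.symm]
  · simp
  · intro l _ hl
    refine Finset.sum_eq_zero fun m _ => ?_
    simp [hl.symm, contrLeft_zero]
  · simp

end Contraction

/-! ### CYBE and AYBE for r, invariance of r + τ(r), and the coboundary bialgebra. -/

section YangBaxter

variable {K A : Type*} [Field K] [AddCommGroup A] [Module K A] [FiniteDimensional K A]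
  {𝒜 : ZMod 2 → Submodule K A} [DirectSum.Decomposition 𝒜]
  {s : K} {m : A →ₗ[K] A →ₗ[K] A}
  {n : Module.Dual K A →ₗ[K] Module.Dual K A →ₗ[K] Module.Dual K A}
  {M : A × Module.Dual K A →ₗ[K] A × Module.Dual K A →ₗ[K] A × Module.Dual K A}
  {i j k : ZMod 2} {u v w : A × Module.Dual K A}

theorem contrLeft_doubleR (u : A × Module.Dual K A) :
    contrLeft (doubleForm 𝒜 u) (doubleR K A) = (0, u.2) := by
  rw [← sub_eq_zero, ← Module.forall_dual_apply_eq_zero_iff K]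
  intro f
  rw [map_sub, apply_contrLeft, pair₂_doubleR, doubleForm_comp_inl, sub_self]

/-- Unlike in `contrLeft_doubleR`, A is reached through A ≅ A**, which brings in the parity sign. -/
theorem contrRight_doubleR (hw : w ∈ doubleGrading 𝒜 k) :
    contrRight (doubleForm 𝒜 w) (doubleR K A) = koszulSign K k k • (w.1, 0) := by
  rw [← sub_eq_zero, ← Module.forall_dual_apply_eq_zero_iff K]
  intro f
  rw [map_sub, apply_contrRight, pair₂_doubleR, doubleForm_apply, superEval_apply hw.1, map_smul]
  simp

/-- The relation between the three terms of the Yang-Baxter equations, evaluated at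
`u ⊗ v ⊗ w`. -/
theorem form_yangBaxter (hM : IsManinOp 𝒜 s m n M) (hu : u ∈ doubleGrading 𝒜 i)
    (hv : v ∈ doubleGrading 𝒜 j) (hw : w ∈ doubleGrading 𝒜 k) :
    s * koszulSign K i j * doubleForm 𝒜 v (M (0, u.2) (w.1, 0)) =
      doubleForm 𝒜 u (M (v.1, 0) (w.1, 0)) +
        koszulSign K k (i + j) * doubleForm 𝒜 w (M (0, u.2) (0, v.2)) := by
  have hu2 := inr_mem (𝒜 := 𝒜) hu.2
  have hv2 := inr_mem (𝒜 := 𝒜) hv.2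
  -- The product of two vectors lies in the isotropic space A, so only the A*-component of u counts;
  -- `e2` uses the same for A*.
  have e1 : doubleForm 𝒜 u (M (v.1, 0) (w.1, 0)) =
      doubleForm 𝒜 (M (0, u.2) (v.1, 0)) (w.1, 0) := by
    rw [hM.inv, hM.inl, doubleForm_apply, doubleForm_apply]; simp
  have e2 : koszulSign K k (i + j) * doubleForm 𝒜 w (M (0, u.2) (0, v.2)) =
      doubleForm 𝒜 (M (0, u.2) (0, v.2)) (w.1, 0) := by
    rw [doubleForm_comm hw (hM.even _ _ _ hu2 _ hv2), ← mul_assoc, koszulSign_mul_self, one_mul,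
      hM.inr, doubleForm_apply, doubleForm_apply]
    simp
  have d : v = (v.1, 0) + (0, v.2) := by simp
  -- Splitting v into its two components yields exactly the terms of `e1` and `e2`.
  have e3 : doubleForm 𝒜 v (M (0, u.2) (w.1, 0)) =
      s * koszulSign K i j * (doubleForm 𝒜 (M (0, u.2) (v.1, 0)) (w.1, 0) +
        doubleForm 𝒜 (M (0, u.2) (0, v.2)) (w.1, 0)) := by
    rw [← hM.inv, hM.form_swap_left hv hu2, koszulSign_comm K j i]
    conv_lhs => rw [d]
    simp only [map_add, LinearMap.add_apply]
  rw [e1, e2, e3]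
  linear_combination (doubleForm 𝒜 (M (0, u.2) (v.1, 0)) (w.1, 0) +
    doubleForm 𝒜 (M (0, u.2) (0, v.2)) (w.1, 0)) *
    (koszulSign K i j * koszulSign K i j * hM.sign + koszulSign_mul_self K i j)

/-- The form is even, so the signs of the Yang-Baxter terms need comparing only when i = j + k. -/
theorem form_yangBaxter_eq_zero (hM : IsManinOp 𝒜 s m n M) (hu : u ∈ doubleGrading 𝒜 i)
    (hv : v ∈ doubleGrading 𝒜 j) (hw : w ∈ doubleGrading 𝒜 k) (h : i ≠ j + k) :
    doubleForm 𝒜 u (M (v.1, 0) (w.1, 0)) = 0 ∧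
      doubleForm 𝒜 v (M (0, u.2) (w.1, 0)) = 0 ∧
      doubleForm 𝒜 w (M (0, u.2) (0, v.2)) = 0 :=
  ⟨dual_apply_eq_zero (doubleForm_mem hu) (hM.even _ _ _ (inl_mem hv.1) _ (inl_mem hw.1)) h,
    dual_apply_eq_zero (doubleForm_mem hv) (hM.even _ _ _ (inr_mem hu.2) _ (inl_mem hw.1))
      ((show ∀ i j k : ZMod 2, i ≠ j + k → j ≠ i + k by decide) i j k h),
    dual_apply_eq_zero (doubleForm_mem hw) (hM.even _ _ _ (inr_mem hu.2) _ (inr_mem hv.2))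
      ((show ∀ i j k : ZMod 2, i ≠ j + k → k ≠ i + j by decide) i j k h)⟩

theorem doubleR_cybe (hM : IsManinOp 𝒜 (-1) m n M) :
    SatisfiesCYBE (doubleGrading 𝒜) M (doubleR K A) := by
  refine tensor₃_eq_of_hom (𝒜 := doubleGrading 𝒜) fun i j k φ hφ ψ hψ χ hχ => ?_
  obtain ⟨u, hu, rfl⟩ := exists_doubleForm_eq hφ
  obtain ⟨v, hv, rfl⟩ := exists_doubleForm_eq hψ
  obtain ⟨w, hw, rfl⟩ := exists_doubleForm_eq hχ
  have h1 : contrRight (doubleForm 𝒜 w) (doubleR K A) ∈ doubleGrading 𝒜 k := by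
    rw [contrRight_doubleR hw]
    exact Submodule.smul_mem _ _ (inl_mem hw.1)
  have h2 : contrLeft (doubleForm 𝒜 u) (doubleR K A) ∈ doubleGrading 𝒜 i := by
    rw [contrLeft_doubleR]
    exact inr_mem hu.2
  rw [map_add, map_add, pair₃_bracket1213 M _ _ hψ _ h1, pair₃_op1223,
    pair₃_bracket1323 M _ _ hψ _ h2, contrLeft_doubleR, contrLeft_doubleR, contrRight_doubleR hv,
    contrRight_doubleR hw]
  simp only [map_smul, LinearMap.smul_apply, smul_eq_mul, map_zero]
  have e := form_yangBaxter hM hu hv hw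
  have e0 := form_yangBaxter_eq_zero hM hu hv hw
  generalize doubleForm 𝒜 u (M (v.1, 0) (w.1, 0)) = X at e e0 ⊢
  generalize doubleForm 𝒜 v (M (0, u.2) (w.1, 0)) = Y at e e0 ⊢
  generalize doubleForm 𝒜 w (M (0, u.2) (0, v.2)) = Z at e e0 ⊢
  by_cases h : i = j + k
  · subst h
    clear hu hv hw hφ hψ hχ h1 h2 e0
    rcases parity_cases j with rfl | rfl <;> rcases parity_cases k with rfl | rfl <;>
      simp at e ⊢ <;> first | linear_combination e | linear_combination -e
  · obtain ⟨rfl, rfl, rfl⟩ := e0 h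
    simp

theorem doubleR_aybe (hM : IsManinOp 𝒜 1 m n M) : SatisfiesAYBE M (doubleR K A) := by
  refine tensor₃_eq_of_hom (𝒜 := doubleGrading 𝒜) fun i j k φ hφ ψ hψ χ hχ => ?_
  obtain ⟨u, hu, rfl⟩ := exists_doubleForm_eq hφ
  obtain ⟨v, hv, rfl⟩ := exists_doubleForm_eq hψ
  obtain ⟨w, hw, rfl⟩ := exists_doubleForm_eq hχ
  rw [map_add, map_sub, pair₃_mul1312, pair₃_op1223, pair₃_mul2313, contrLeft_doubleR,
    contrLeft_doubleR, contrRight_doubleR hv, contrRight_doubleR hw]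
  simp only [map_smul, LinearMap.smul_apply, smul_eq_mul, map_zero]
  rw [hM.form_swap_right (inl_mem hw.1) (inl_mem hv.1),
    hM.form_swap_right (inr_mem hv.2) (inr_mem hu.2)]
  have e := form_yangBaxter hM hu hv hw
  have e0 := form_yangBaxter_eq_zero hM hu hv hw
  generalize doubleForm 𝒜 u (M (v.1, 0) (w.1, 0)) = X at e e0 ⊢
  generalize doubleForm 𝒜 v (M (0, u.2) (w.1, 0)) = Y at e e0 ⊢
  generalize doubleForm 𝒜 w (M (0, u.2) (0, v.2)) = Z at e e0 ⊢
  by_cases h : i = j + k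
  · subst h
    clear hu hv hw hφ hψ hχ e0
    rcases parity_cases j with rfl | rfl <;> rcases parity_cases k with rfl | rfl <;>
      simp at e ⊢ <;> first | linear_combination e | linear_combination -e
  · obtain ⟨rfl, rfl, rfl⟩ := e0 h
    simp

/-- Up to the Koszul sign, r + τ(r) is the tensor inverse to the form, so it inherits the invariance
of the form. -/
theorem pair₂_doubleR_add_twist (hu : u ∈ doubleGrading 𝒜 i) (hv : v ∈ doubleGrading 𝒜 j) :
    pair₂ (doubleForm 𝒜 u) (doubleForm 𝒜 v)
      (doubleR K A + superTwist (doubleGrading 𝒜) (doubleR K A)) =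
      koszulSign K i j * doubleForm 𝒜 u v := by
  rw [map_add, pair₂_superTwist (doubleForm_mem hu) (doubleForm_mem hv), pair₂_doubleR,
    pair₂_doubleR, doubleForm_comp_inl, doubleForm_comp_inl]
  by_cases hij : i = j
  · subst hij
    simp only [doubleForm_apply, map_zero, zero_add, superEval_apply hv.1]
    ring
  · rw [dual_apply_eq_zero (doubleForm_mem hv) (inr_mem hu.2) (Ne.symm hij),
      dual_apply_eq_zero (doubleForm_mem hu) (inr_mem hv.2) hij,
      dual_apply_eq_zero (doubleForm_mem hu) hv hij]
    simp

theorem doubleR_add_twist_invariant (hM : IsManinOp 𝒜 s m n M) (w : A × Module.Dual K A) :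
    -s • leftAct M w (doubleR K A + superTwist (doubleGrading 𝒜) (doubleR K A)) +
      rightAct (doubleGrading 𝒜) M w
        (doubleR K A + superTwist (doubleGrading 𝒜) (doubleR K A)) = 0 := by
  set c := doubleR K A + superTwist (doubleGrading 𝒜) (doubleR K A) with hc
  have key : (-s • leftAct M + rightAct (doubleGrading 𝒜) M).flip c = 0 := by
    refine hom_ext (𝒜 := doubleGrading 𝒜) fun k w hw => ?_
    refine tensor_eq_of_hom (𝒜 := doubleGrading 𝒜) fun i j φ hφ ψ hψ => ?_
    obtain ⟨u, hu, rfl⟩ := exists_doubleForm_eq hφ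
    obtain ⟨v, hv, rfl⟩ := exists_doubleForm_eq hψ
    simp only [LinearMap.flip_apply, LinearMap.add_apply, LinearMap.smul_apply, map_add, map_smul,
      pair₂_leftAct, pair₂_rightAct M _ hw hφ, hM.form_comp, LinearMap.zero_apply, map_zero]
    rw [hc, pair₂_doubleR_add_twist (hM.even _ _ _ hu _ hw) hv,
      pair₂_doubleR_add_twist hu (hM.even _ _ _ hv _ hw), hM.inv,
      hM.form_swap_right hv hw]
    simp only [koszulSign_add_left, koszulSign_add_right, smul_eq_mul]
    generalize doubleForm 𝒜 u (M w v) = X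
    rw [koszulSign_comm K k i, koszulSign_comm K j k]
    linear_combination koszulSign K i j * koszulSign K k j * s * X * koszulSign_mul_self K i k
  simpa using LinearMap.congr_fun key w

theorem double_isCoboundary [CharZero K] {br mul : A →ₗ[K] A →ₗ[K] A} {δ Δ : A →ₗ[K] A ⊗[K] A}
    {N : A × Module.Dual K A →ₗ[K] A × Module.Dual K A →ₗ[K] A × Module.Dual K A}
    (h : IsPoissonSuperbialgebra 𝒜 br mul δ Δ)
    (hM : IsManinOp 𝒜 (-1) br (dualOp 𝒜 δ) M) (hN : IsManinOp 𝒜 1 mul (dualOp 𝒜 Δ) N) :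
    IsCoboundaryPoissonSuperbialgebra (doubleGrading 𝒜) M N
      (adTensor (doubleGrading 𝒜) M (doubleR K A))
      (-mulTensor (doubleGrading 𝒜) N (doubleR K A)) (doubleR K A) := by
  have hP := double_isPoisson h hM hN
  have hco : IsPoissonSupercoalgebra (doubleGrading 𝒜)
      (adTensor (doubleGrading 𝒜) M (doubleR K A))
      (-mulTensor (doubleGrading 𝒜) N (doubleR K A)) := by
    -- The coalgebra axioms come by duality from the split Poisson structure, carried to the dual of
    -- the double by the form.
    refine .of_dual ((splitOp_isPoisson h.alg h.coalg.dual).map (doubleForm 𝒜).toLinearMap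
      (doubleForm 𝒜).surjective (fun i u hu => doubleForm_mem hu)
      (fun i φ hφ => exists_doubleForm_eq hφ) (doubleForm_splitOp hM fun w => ?_)
      (doubleForm_splitOp hN fun w => ?_))
    · simp [adTensor_apply]
    · rw [LinearMap.neg_apply, mulTensor_apply]
      module
  exact
    { bialg :=
        { alg := hP
          coalg := hco
          lie := ⟨hP.lie, hco.lie, fun _ _ _ hx _ hy => adTensor_bracket _ hP.lie hx hy⟩
          infinitesimal := ⟨hP.commAssoc.toIsAssociativeSuperalgebra, hco.coassoc,
            mulTensor_mul hP.commAssoc doubleR_mem⟩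
          compat_mul := fun _ _ _ hx _ hy => adTensor_mul _ hP hx hy
          compat_bracket := fun _ _ _ hx _ hy => mulTensor_bracket _ hP hx hy }
      even := doubleR_mem
      cobracket := fun _ => rfl
      coproduct := fun _ => rfl }

end YangBaxter

/-! ### The two operations of the double as invariant operations. -/

section Main

variable {K A : Type*} [Field K] [AddCommGroup A] [Module K A] [FiniteDimensional K A]
  {𝒜 : ZMod 2 → Submodule K A} [DirectSum.Decomposition 𝒜]
  {br mul : A →ₗ[K] A →ₗ[K] A} {δ Δ : A →ₗ[K] A ⊗[K] A}

theorem isManinOp_doubleBracket (h : IsLieSuperbialgebra 𝒜 br δ) :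
    IsManinOp 𝒜 (-1) br (dualOp 𝒜 δ) (doubleBracket 𝒜 br δ) := by
  have hd := h.coalg.dual
  have := isManinOp_matchedPairOp (s := (-1 : K)) (by ring) h.alg.even hd.even
    (fun i j x hx y hy => by rw [h.alg.skew _ _ _ hx _ hy]; simp)
    (fun i j x hx y hy => by rw [hd.skew _ _ _ hx _ hy]; simp)
  have e₁ : -((-1 : K) • dualRep 𝒜 𝒜 br) = dualRep 𝒜 𝒜 br :=
    LinearMap.ext fun x => LinearMap.ext fun a => by
      rw [LinearMap.neg_apply, LinearMap.smul_apply, LinearMap.neg_apply, LinearMap.smul_apply,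
        neg_one_smul, neg_neg]
  have e₂ : -((-1 : K) • bidualRep 𝒜 (dualOp 𝒜 δ)) = bidualRep 𝒜 (dualOp 𝒜 δ) := by
    rw [neg_smul, one_smul, neg_neg]
  rw [e₁, e₂] at this
  exact this

theorem isManinOp_doubleMul (hc : IsCommAssociativeSuperalgebra 𝒜 mul)
    (hd : IsCommAssociativeSuperalgebra (dualGrading 𝒜) (dualOp 𝒜 Δ)) :
    IsManinOp 𝒜 1 mul (dualOp 𝒜 Δ) (doubleMul 𝒜 mul Δ) := by
  have := isManinOp_matchedPairOp (s := (1 : K)) (by ring) hc.even hd.even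
    (fun i j x hx y hy => by rw [hc.comm _ _ _ hx _ hy]; simp)
    (fun i j x hx y hy => by rw [hd.comm _ _ _ hx _ hy]; simp)
  rw [one_smul, one_smul] at this
  exact this

end Main

end PoissonSuper

end

theorem mainTheorem4 {K A : Type*} [Field K] [CharZero K] [AddCommGroup A] [Module K A]
    [FiniteDimensional K A] (𝒜 : ZMod 2 → Submodule K A) [DirectSum.Decomposition 𝒜]
    (br mul : A →ₗ[K] A →ₗ[K] A) (δ Δ : A →ₗ[K] A ⊗[K] A)
    (h : PoissonSuper.IsPoissonSuperbialgebra 𝒜 br mul δ Δ) :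
    PoissonSuper.IsPoissonSuperalgebra (PoissonSuper.dualGrading 𝒜)
      (PoissonSuper.dualOp 𝒜 δ) (PoissonSuper.dualOp 𝒜 Δ) ∧
    (∀ (ι : Type) [Fintype ι] (e : Module.Basis ι K A),
      PoissonSuper.doubleR K A =
        ∑ i, ((e i, 0) : A × Module.Dual K A) ⊗ₜ[K] ((0, e.coord i) : A × Module.Dual K A)) ∧
    PoissonSuper.SatisfiesCYBE (PoissonSuper.doubleGrading 𝒜)
      (PoissonSuper.doubleBracket 𝒜 br δ) (PoissonSuper.doubleR K A) ∧
    PoissonSuper.SatisfiesAYBE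
      (PoissonSuper.doubleMul 𝒜 mul Δ) (PoissonSuper.doubleR K A) ∧
    (∀ u, PoissonSuper.adTensor (PoissonSuper.doubleGrading 𝒜)
      (PoissonSuper.doubleBracket 𝒜 br δ)
      (PoissonSuper.doubleR K A +
        PoissonSuper.superTwist (PoissonSuper.doubleGrading 𝒜) (PoissonSuper.doubleR K A)) u
        = 0) ∧
    (∀ u, PoissonSuper.mulTensor (PoissonSuper.doubleGrading 𝒜)
      (PoissonSuper.doubleMul 𝒜 mul Δ)
      (PoissonSuper.doubleR K A +
        PoissonSuper.superTwist (PoissonSuper.doubleGrading 𝒜) (PoissonSuper.doubleR K A)) u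
        = 0) ∧
    PoissonSuper.IsCoboundaryPoissonSuperbialgebra (PoissonSuper.doubleGrading 𝒜)
      (PoissonSuper.doubleBracket 𝒜 br δ) (PoissonSuper.doubleMul 𝒜 mul Δ)
      (PoissonSuper.adTensor (PoissonSuper.doubleGrading 𝒜)
        (PoissonSuper.doubleBracket 𝒜 br δ) (PoissonSuper.doubleR K A))
      (-PoissonSuper.mulTensor (PoissonSuper.doubleGrading 𝒜)
        (PoissonSuper.doubleMul 𝒜 mul Δ) (PoissonSuper.doubleR K A))
      (PoissonSuper.doubleR K A) := by
  have hM := PoissonSuper.isManinOp_doubleBracket h.lie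
  have hN := PoissonSuper.isManinOp_doubleMul h.alg.commAssoc h.coalg.dual.commAssoc
  refine ⟨h.coalg.dual, fun ι _ e => PoissonSuper.doubleR_eq_sum e,
    PoissonSuper.doubleR_cybe hM, PoissonSuper.doubleR_aybe hN, fun u => ?_, fun u => ?_,
    PoissonSuper.double_isCoboundary h hM hN⟩
  · have e := PoissonSuper.doubleR_add_twist_invariant hM u
    rwa [neg_neg, one_smul] at e
  -- For s = 1 the invariance reads (-(L ⊗ 1) + 1 ⊗ L)(r + τ(r)) = 0.
  · have e := PoissonSuper.doubleR_add_twist_invariant hN u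
    rw [neg_one_smul, neg_add_eq_zero] at e
    rw [PoissonSuper.mulTensor_apply, e, sub_self]
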